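/- **Free field modules.** Let $V$ be a finite-dimensional complex vector space with a non-degenerate bilinear form $\langle\cdot,\cdot\rangle$, symmetric (Clifford case) or anti-symmetric (Weyl case), with a polarization $V=V^+\oplus V^-$ into isotropic subspaces and bases $\{v_i^\pm\}$ of $V^\pm$ such that $\langle v_i^-,v_j^+\rangle=\delta_{ij}$. Let $\hat V_{\rm tw}=\bigoplus_{n\in\mathbb Z}V(n)$ with $\langle u(m),v(n)\rangle=\langle u,v\rangle\delta_{m+n,0}$, and let $A(V)_{\rm tw}$ be the module for the Clifford (respectively Weyl) algebra of $\hat V_{\rm tw}$, with relations $ab\pm ba=\langle a,b\rangle$ ($+$ for Clifford, $-$ for Weyl), induced from the one-dimensional module $\mathbb C\mathbf v_{\rm tw}$ on which $V^+(0)\oplus\bigoplus_{n>0}V(n)$ acts as zero. It is the canonically twisted module of the corresponding Clifford or Weyl super vertex operator algebra, with $Y_{\rm tw}(v(-\tfrac12)\mathbf v,x)=\sum_{n\in\mathbb Z}v(n)x^{-n-1/2}$ for $v\in V$. Let $J(0)$ be the coefficient of $x^{-1}$ in $Y_{\rm tw}(\jmath,x)$, where $\jmath=\sum_iv_i^+(-\tfrac12)v_i^-(-\tfrac12)\mathbf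 v$, and let $L(0)$ be the coefficient of $x^{-2}$ in $Y_{\rm tw}(\omega,x)$, where $\omega=\tfrac12\sum_i\big(v_i^+(-\tfrac32)v_i^-(-\tfrac12)-v_i^+(-\tfrac12)v_i^-(-\tfrac32)\big)\mathbf v$. An element $g\in GL(V^+)$ acts on $V$ as $(g,g')$, where $g'\in GL(V^-)$ is determined by $\langle gu,g'u'\rangle=\langle u,u'\rangle$ for $u\in V^+$, $u'\in V^-$, and on $A(V)_{\rm tw}$ by $g\cdot v_1(n_1)\cdots v_k(n_k)\mathbf v_{\rm tw}=(gv_1)(n_1)\cdots(gv_k)(n_k)\mathbf v_{\rm tw}$. **The module.** Let $\mathfrak e,\mathfrak a,\mathfrak a'$ be $2$-dimensional with symmetric forms and let $\mathfrak b$ be $6$-dimensional with an anti-symmetric form, all polarized as above. Put $W_{\rm tw}=A(\mathfrak e)_{\rm tw}\otimes A(\mathfrak a)_{\rm tw}\otimes A(\mathfrak a')_{\rm tw}\otimes A(\mathfrak b)_{\rm tw}$, with $L(0)$ the sum of the four operators $L(0)$ of the factors, $J(0)=2J_{\mathfrak a}(0)+3J_{\mathfrak a'}(0)+J_{\mathfrak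 b}(0)$, and $(-1)^F=(-I)\otimes(-I)\otimes(-I)\otimes I$ in $GL(\mathfrak e^+)\otimes GL(\mathfrak a^+)\otimes GL(\mathfrak a'^+)\otimes GL(\mathfrak b^+)$. **The group.** Let $G^{(5)}\simeq GL_2(\mathbb F_5)/\{\pm1\}$ be the umbral group attached to the Niemeier lattice with root system $A_4^{\oplus6}$. Its conjugacy classes are named as follows: the class of a matrix $A$ with $\det A=1$ is 1A if $A$ is scalar, 2B if $\operatorname{tr}A=0$, 3A if $(\operatorname{tr}A)^2=1$, and 5A otherwise; with $\det A=4$ it is 2A if $A$ is scalar, 2C if $\operatorname{tr}A=0$, 6A if $(\operatorname{tr}A)^2=4$, and 10A otherwise; with $\det A=2$ it is 4A if $\operatorname{tr}A=0$, 12A if $(\operatorname{tr}A)^2=1$, and 4C otherwise; with $\det A=3$ it is 4B if $\operatorname{tr}A=0$, 12B if $(\operatorname{tr}A)^2=4$, and 4D otherwise. Let $G^{(5)}_{24}$ be a maximal subgroup of $G^{(5)}$ of order $24$. It is identified with $S_3\times\langle t\rangle$, $t$ of order $4$, so that for a transposition $p$ and a $3$-cycle $c$ the elements $1,t,t^2,t^3$,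 $p,pt^2$, $c,ct,ct^2,ct^3$ lie in the classes 1A, 4A, 2A, 4B, 2B, 2C, 3A, 12A, 6A, 12B of $G^{(5)}$, while $pt$ lies in 4A and $pt^3$ in 4B. Let $\varrho:G^{(5)}_{24}\to GL(\mathfrak a^+)$, $\varrho':G^{(5)}_{24}\to GL(\mathfrak a'^+)$ and $\underline\varrho:G^{(5)}_{24}\to GL(\mathfrak b^+)$ be homomorphisms with characters $\chi_2$, $\chi_3$ and $\chi_7+\chi_{12}$, where $\chi_2,\chi_3,\chi_7$ are the linear characters with $\chi_2(\sigma t^k)=(-1)^k$, $\chi_3(\sigma t^k)=i^k$, $\chi_7(\sigma t^k)=\operatorname{sgn}(\sigma)\,i^k$ for $\sigma\in S_3$, and $\chi_{12}(\sigma t^k)=\chi(\sigma)(-i)^k$ with $\chi$ the irreducible character of $S_3$ of degree $2$. Let $g\in G^{(5)}_{24}$ act on $W_{\rm tw}$ as $I\otimes\varrho(g)\otimes\varrho'(g)\otimes\underline\varrho(g)$, and put $$\widetilde\psi^{(5)}_g=-\operatorname{tr}\big((g+g^{-1})J_{\mathfrak e}(0)(-1)^Fy^{J(0)}q^{L(0)}\,\big|\,W_{\rm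 tw}\big).$$ **The functions.** Let $q=e^{2\pi i\tau}$, $y=e^{2\pi iz}$, $\eta(\tau)=q^{1/24}\prod_{n>0}(1-q^n)$, and $$\theta_1(\tau,z)=-iq^{1/8}y^{1/2}\prod_{n>0}(1-y^{-1}q^{n-1})(1-yq^n)(1-q^n),\qquad \theta_2(\tau,z)=q^{1/8}y^{1/2}\prod_{n>0}(1+y^{-1}q^{n-1})(1+yq^n)(1-q^n).$$ Let $\psi^{(5)}_g$ be the following function, depending on the class of $g$ in $G^{(5)}$: $$\psi_{1A}=2i\frac{\eta(\tau)^3\theta_1(\tau,2z)\theta_1(\tau,3z)}{\theta_1(\tau,z)^3},\quad \psi_{2A}=-2i\frac{\eta(\tau)^3\theta_1(\tau,2z)\theta_2(\tau,3z)}{\theta_2(\tau,z)^3},$$ $$\psi_{2B}=-2i\frac{\eta(\tau)^3\theta_1(\tau,2z)\theta_1(\tau,3z)}{\theta_1(\tau,z)\theta_2(\tau,z)^2},\quad \psi_{2C}=2i\frac{\eta(\tau)^3\theta_1(\tau,2z)\theta_2(\tau,3z)}{\theta_1(\tau,z)^2\theta_2(\tau,z)},$$ $$\psi_{3A}=-2i\frac{\eta(3\tau)\theta_1(\tau,2z)\theta_1(\tau,3z)}{\theta_1(3\tau,3z)},\quad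 \psi_{6A}=-2i\frac{\eta(3\tau)\theta_1(\tau,2z)\theta_2(\tau,3z)}{\theta_2(3\tau,3z)},$$ $$\psi_{4A}=\psi_{4B}=-i\frac{\eta(2\tau)^2\theta_2(\tau,2z)}{\eta(\tau)\theta_2(2\tau,2z)^2}\Big(\theta_1(\tau,z+\tfrac14)\theta_1(\tau,3z+\tfrac14)-\theta_1(\tau,z-\tfrac14)\theta_1(\tau,3z-\tfrac14)\Big),$$ $$\psi_{12A}=\psi_{12B}=i\frac{\eta(6\tau)\theta_2(\tau,2z)}{\eta(\tau)^3\theta_2(6\tau,6z)}\Big(\theta_1(\tau,z+\tfrac1{12})\theta_1(\tau,z+\tfrac14)\theta_1(\tau,z+\tfrac5{12})\theta_1(\tau,3z-\tfrac14)-\theta_1(\tau,z-\tfrac1{12})\theta_1(\tau,z-\tfrac14)\theta_1(\tau,z-\tfrac5{12})\theta_1(\tau,3z+\tfrac14)\Big).$$ **Proposition.** $W_{\rm tw}$ is spanned by its simultaneous eigenspaces for $J(0)$ and $L(0)$ with eigenvalues in $\mathbb Z\times\mathbb Z_{\ge0}$; these are finite-dimensional and preserved by $(g+g^{-1})J_{\mathfrak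 e}(0)(-1)^F$, and $\widetilde\psi^{(5)}_g\in\mathbb C[y][[y^{-1}]][[q]]$ for every $g\in G^{(5)}_{24}$. Moreover, for every $g\in G^{(5)}_{24}$ the series $\widetilde\psi^{(5)}_g$ is the expansion of $\psi^{(5)}_g$ in the domain $0<-\operatorname{Im}(z)<\operatorname{Im}(\tau)$: for all such $\tau,z$ the double series $\widetilde\psi^{(5)}_g$ converges absolutely to $\psi^{(5)}_g(\tau,z)$. -/

import Mathlib

open scoped TensorProduct
open Complex (I)

noncomputable section

namespace Umbral5

/-! ## Polarized spaces, mode algebras and canonically twisted Fock modules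

The sign `κ` treats the two free field constructions in parallel: `κ = 1` is the Clifford case
(symmetric forms, relation `a ⊗ a' + a' ⊗ a = ⟨a, a'⟩`), and `κ = -1` is the Weyl case
(anti-symmetric forms, relation `b ⊗ b' - b' ⊗ b = ⟪b, b'⟫`). -/

/-- A complex vector space with a non-degenerate bilinear form, symmetric for `κ = 1` and
anti-symmetric for `κ = -1`, together with a polarization `V = V⁺ ⊕ V⁻` into isotropic
subspaces. -/
structure PolarizedSpace (κ : ℂ) (V : Type*) [AddCommGroup V] [Module ℂ V] where
  form : LinearMap.BilinForm ℂ V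
  symm : ∀ x y, form x y = κ * form y x
  nondeg : form.Nondegenerate
  pos : Submodule ℂ V
  neg : Submodule ℂ V
  isCompl : IsCompl pos neg
  pos_isotropic : ∀ x ∈ pos, ∀ y ∈ pos, form x y = 0
  neg_isotropic : ∀ x ∈ neg, ∀ y ∈ neg, form x y = 0

/-- Bases `{v_i⁺}` of `V⁺` and `{v_i⁻}` of `V⁻` with `⟨v_i⁻, v_j⁺⟩ = δ_{ij}`. In particular
`dim V = 2 * card ι`. -/
structure DualBases {κ : ℂ} {V : Type*} [AddCommGroup V] [Module ℂ V]
    (P : PolarizedSpace κ V) (ι : Type) [DecidableEq ι] where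
  pos : Module.Basis ι ℂ P.pos
  neg : Module.Basis ι ℂ P.neg
  pairing : ∀ i j, P.form (neg i : V) (pos j : V) = if i = j then 1 else 0

section Fock

variable {κ : ℂ} {V : Type*} [AddCommGroup V] [Module ℂ V]

/-- The defining relations of the Clifford (Weyl) algebra of `V̂_tw = ⨁_{n ∈ ℤ} V(n)`, where
`⟨u(m), v(n)⟩ = ⟨u, v⟩ δ_{m+n,0}`, and `v(n)` is `Finsupp.single n v`. -/
inductive ModeRel (P : PolarizedSpace κ V) :
    TensorAlgebra ℂ (ℤ →₀ V) → TensorAlgebra ℂ (ℤ →₀ V) → Prop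
  | rel (u v : V) (m n : ℤ) : ModeRel P
      (TensorAlgebra.ι ℂ (Finsupp.single m u) * TensorAlgebra.ι ℂ (Finsupp.single n v)
        + κ • (TensorAlgebra.ι ℂ (Finsupp.single n v) * TensorAlgebra.ι ℂ (Finsupp.single m u)))
      (algebraMap ℂ _ (if m + n = 0 then P.form u v else 0))

/-- The Clifford algebra (`κ = 1`) or Weyl algebra (`κ = -1`) of `V̂_tw`. -/
abbrev ModeAlgebra (P : PolarizedSpace κ V) : Type _ := RingQuot (ModeRel P)

/-- The element `v(n)` of the mode algebra. -/
def modeElt (P : PolarizedSpace κ V) (n : ℤ) (v : V) : ModeAlgebra P :=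
  RingQuot.mkAlgHom ℂ (ModeRel P) (TensorAlgebra.ι ℂ (Finsupp.single n v))

/-- The left ideal generated by `V̂_tw⁺ = V⁺(0) ⊕ ⨁_{n > 0} V(n)`. -/
def annihilators (P : PolarizedSpace κ V) : Submodule (ModeAlgebra P) (ModeAlgebra P) :=
  Submodule.span (ModeAlgebra P)
    {x | ∃ (n : ℤ) (v : V), (0 < n ∨ (n = 0 ∧ v ∈ P.pos)) ∧ x = modeElt P n v}

/-- The underlying space of the canonically twisted module, `A(V)_tw`: the module over the mode
algebra induced from the one dimensional module `ℂ v_tw` of `⟨V̂_tw⁺⟩` on which `V̂_tw⁺` acts as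
zero, i.e. the quotient of the mode algebra by the left ideal generated by `V̂_tw⁺`. The vacuum
`v_tw` is the class of `1`. -/
abbrev TwFock (P : PolarizedSpace κ V) : Type _ := ModeAlgebra P ⧸ annihilators P

/-- The operator `v(n)` on `A(V)_tw`. -/
def mode (P : PolarizedSpace κ V) (n : ℤ) (v : V) : Module.End ℂ (TwFock P) :=
  Algebra.lsmul ℂ ℂ (TwFock P) (modeElt P n v)

end Fock

/-! ## Twisted vertex operators

A twisted field on `M` is written as a family `X : ℚ → End M`, where `X r` is the coefficient of
`z^(-r-1)` in `X(z)`. -/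

section Fields

variable {M : Type*} [AddCommGroup M] [Module ℂ M]

open Classical in
/-- The pointwise finite sum `∑ j, T j` of operators: applied to `v` it is `∑ j, T j v`. -/
def ptSum (T : ℕ → Module.End ℂ M) : Module.End ℂ M :=
  if h : ∀ v, (Function.support fun j => T j v).Finite then
    { toFun := fun v => ∑ᶠ j, T j v
      map_add' := fun v w => by
        simp only [map_add]
        exact finsum_add_distrib (h v) (h w)
      map_smul' := fun c v => by
        simp only [map_smul, RingHom.id_apply]
        exact (smul_finsum c fun j => T j v).symm }
  else 0

/-- `∑_j (-1)^j C(l,j) (X_{s+l-j} Y_{t+j} - (-1)^l ε Y_{t+l-j} X_{s+j})`, the side of the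
Borcherds identity that involves compositions of fields; `ε` is the super sign `(-1)^{|x||y|}`. -/
def borcherdsSum (ε : ℂ) (X Y : ℚ → Module.End ℂ M) (l : ℤ) (s t : ℚ) : Module.End ℂ M :=
  ptSum fun j => (((-1) ^ j * (Ring.choose l j : ℤ) : ℤ) : ℂ) •
    (X (s + l - j) * Y (t + j) - ((-1 : ℂ) ^ l * ε) • (Y (t + l - j) * X (s + j)))

/-- The twisted `l`-th product of a field `X` with modes in `1/2 + ℤ` and a field `Y`. In a
twisted module, with `X(z) = Y_tw(x,z)` and `Y(z) = Y_tw(y,z)`, the twisted Borcherds identity is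
`∑_k C(s,k) (x_{(l+k)} y)_{s+t-k} = borcherdsSum ε X Y l s t` for `s ∈ 1/2 + ℤ`. Solving it at
`s = 1/2` for the modes of `Y_tw(x_{(l)} y, z)` gives
`(x_{(l)} y)_n = ∑_j C(-1/2,j) borcherdsSum ε X Y (l+j) (1/2) (n-1/2-j)`. -/
def twProd (ε : ℂ) (l : ℤ) (X Y : ℚ → Module.End ℂ M) (n : ℚ) : Module.End ℂ M :=
  ∑ᶠ j : ℕ, ((Ring.choose (-1 / 2 : ℚ) j : ℚ) : ℂ) •
    borcherdsSum ε X Y (l + j) (1 / 2) (n - 1 / 2 - j)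

end Fields

section Vertex

variable {κ : ℂ} {V : Type*} [AddCommGroup V] [Module ℂ V]

/-- The generating field `Y_tw(v(-1/2)𝐯, z) = ∑_{n ∈ ℤ} v(n) z^(-n-1/2)`: its coefficient of
`z^(-r-1)` is `v(r + 1/2)` if `r + 1/2` is an integer, and `0` otherwise. -/
def genField (P : PolarizedSpace κ V) (v : V) (r : ℚ) : Module.End ℂ (TwFock P) :=
  if (r + 1 / 2).den = 1 then mode P (r + 1 / 2).num v else 0

/-- The twisted vertex operator `Y_tw(u, z)` of the state
`u = v₁(-k₁-1/2) v₂(-k₂-1/2) ⋯ 𝐯`, given by the list of the pairs `(v_i, k_i)`. Here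
`v(-k-1/2)` is the `(-k-1)`-st mode of the state `v(-1/2)𝐯`, the vacuum goes to the identity
field, and the super sign of a generator and a state of length `w` is `(-κ)^w`
(`(-1)^w` in the Clifford case, `1` in the Weyl case). -/
def Ytw (P : PolarizedSpace κ V) : List (V × ℕ) → ℚ → Module.End ℂ (TwFock P)
  | [] => fun r => if r = -1 then 1 else 0
  | (v, k) :: w => twProd ((-κ) ^ w.length) (-(k : ℤ) - 1) (genField P v) (Ytw P w)

variable {P : PolarizedSpace κ V} {ι : Type} [Fintype ι] [DecidableEq ι]

/-- `J(0)`: the coefficient of `z^(-1)` in `Y_tw(ȷ, z)`, `ȷ = ∑_i v_i⁺(-1/2) v_i⁻(-1/2) 𝐯`. -/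
def J0 (D : DualBases P ι) : Module.End ℂ (TwFock P) :=
  ∑ i, Ytw P [((D.pos i : V), 0), ((D.neg i : V), 0)] 0

/-- `L(0)`: the coefficient of `z^(-2)` in `Y_tw(ω, z)`, where
`ω = (1/2) ∑_i (v_i⁺(-3/2) v_i⁻(-1/2) - v_i⁺(-1/2) v_i⁻(-3/2)) 𝐯`. -/
def L0 (D : DualBases P ι) : Module.End ℂ (TwFock P) :=
  (1 / 2 : ℂ) • ∑ i, (Ytw P [((D.pos i : V), 1), ((D.neg i : V), 0)] 1
    - Ytw P [((D.pos i : V), 0), ((D.neg i : V), 1)] 1)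

/-! ## The action of `GL(V⁺)` -/

/-- The extension of `g ∈ GL(V⁺)` to `(g, g') ∈ GL(V⁺) × GL(V⁻)` acting on `V = V⁺ ⊕ V⁻`, where
`⟨g u, g' u'⟩ = ⟨u, u'⟩` for `u ∈ V⁺`, `u' ∈ V⁻`. The component in `V⁺` of `x` is
`∑_i ⟨v_i⁻, x⟩ v_i⁺`, and `g' x = ∑_i ⟨x, g⁻¹ v_i⁺⟩ v_i⁻` for `x ∈ V⁻`. -/
def ext (D : DualBases P ι) (g : LinearMap.GeneralLinearGroup ℂ P.pos) : V →ₗ[ℂ] V :=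
  ∑ i, (P.form (D.neg i : V)).smulRight ((g.val (D.pos i) : P.pos) : V)
    + ∑ i, (P.form.flip ((g⁻¹).val (D.pos i) : V)).smulRight (D.neg i : V)

theorem ext_apply (D : DualBases P ι) (g : LinearMap.GeneralLinearGroup ℂ P.pos) (x : V) :
    ext D g x = ∑ i, P.form (D.neg i : V) x • ((g.val (D.pos i) : P.pos) : V)
      + ∑ i, P.form x ((g⁻¹).val (D.pos i) : V) • (D.neg i : V) := by
  simp [ext]

theorem sum_pos (D : DualBases P ι) (u : P.pos) :
    ∑ i, P.form (D.neg i : V) (u : V) • D.pos i = u := by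
  conv_rhs => rw [← D.pos.sum_repr u]
  refine Finset.sum_congr rfl fun i _ => ?_
  congr 1
  have h := congrArg (fun w : P.pos => P.form (D.neg i : V) (w : V)) (D.pos.sum_repr u)
  simp only [Submodule.coe_sum, Submodule.coe_smul, map_sum, map_smul, D.pairing] at h
  rw [← h]
  simp

theorem ext_pos (D : DualBases P ι) (g : LinearMap.GeneralLinearGroup ℂ P.pos) (u : P.pos) :
    ext D g (u : V) = ((g.val u : P.pos) : V) := by
  have h2 : ∀ i, P.form (u : V) ((g⁻¹).val (D.pos i) : V) = 0 := fun i =>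
    P.pos_isotropic _ u.2 _ ((g⁻¹).val (D.pos i)).2
  have h1 := congrArg (fun w => ((g.val w : P.pos) : V)) (sum_pos D u)
  simp only [map_sum, map_smul, Submodule.coe_sum, Submodule.coe_smul] at h1
  rw [ext_apply]
  simp only [h2, zero_smul, Finset.sum_const_zero, add_zero]
  exact h1

theorem ext_neg (D : DualBases P ι) (g : LinearMap.GeneralLinearGroup ℂ P.pos) (x : P.neg) :
    ext D g (x : V) = ∑ i, P.form (x : V) ((g⁻¹).val (D.pos i) : V) • (D.neg i : V) := by
  have h2 : ∀ i, P.form (D.neg i : V) (x : V) = 0 := fun i =>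
    P.neg_isotropic _ (D.neg i).2 _ x.2
  rw [ext_apply]
  simp [h2]

theorem ext_neg_mem (D : DualBases P ι) (g : LinearMap.GeneralLinearGroup ℂ P.pos) (x : P.neg) :
    ext D g (x : V) ∈ P.neg := by
  rw [ext_neg]
  exact Submodule.sum_mem _ fun i _ => Submodule.smul_mem _ _ (D.neg i).2

theorem form_ext_neg_pos (D : DualBases P ι) (g : LinearMap.GeneralLinearGroup ℂ P.pos)
    (x : P.neg) (u : P.pos) : P.form (ext D g (x : V)) (ext D g (u : V)) = P.form (x : V) (u : V) := by
  have key : (g⁻¹).val (g.val u) = u := by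
    change (g⁻¹.val * g.val) u = u
    rw [Units.inv_mul]
    rfl
  have h1 := congrArg (fun w => P.form (x : V) (((g⁻¹).val w : P.pos) : V)) (sum_pos D (g.val u))
  simp only [map_sum, map_smul, Submodule.coe_sum, Submodule.coe_smul, key] at h1
  rw [ext_pos, ext_neg, ← h1]
  simp [mul_comm]

theorem form_ext (D : DualBases P ι) (g : LinearMap.GeneralLinearGroup ℂ P.pos) (x y : V) :
    P.form (ext D g x) (ext D g y) = P.form x y := by
  have dec : ∀ w : V, ∃ (u : P.pos) (v : P.neg), w = (u : V) + (v : V) := fun w => by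
    have hw : w ∈ P.pos ⊔ P.neg := by rw [P.isCompl.sup_eq_top]; trivial
    obtain ⟨a, ha, b, hb, rfl⟩ := Submodule.mem_sup.1 hw
    exact ⟨⟨a, ha⟩, ⟨b, hb⟩, rfl⟩
  obtain ⟨u, v, rfl⟩ := dec x
  obtain ⟨u', v', rfl⟩ := dec y
  have e1 : P.form (ext D g (u : V)) (ext D g (u' : V)) = P.form (u : V) (u' : V) := by
    rw [ext_pos, ext_pos, P.pos_isotropic _ (g.val u).2 _ (g.val u').2,
      P.pos_isotropic _ u.2 _ u'.2]
  have e2 : P.form (ext D g (v : V)) (ext D g (v' : V)) = P.form (v : V) (v' : V) := by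
    rw [P.neg_isotropic _ (ext_neg_mem D g v) _ (ext_neg_mem D g v'),
      P.neg_isotropic _ v.2 _ v'.2]
  have e3 := form_ext_neg_pos D g v u'
  have e4 : P.form (ext D g (u : V)) (ext D g (v' : V)) = P.form (u : V) (v' : V) := by
    rw [P.symm, form_ext_neg_pos D g v' u, ← P.symm]
  simp only [map_add, LinearMap.add_apply, e1, e2, e3, e4]

/-- The algebra endomorphism `v(n) ↦ (g v)(n)` of the mode algebra. -/
def algAct (D : DualBases P ι) (g : LinearMap.GeneralLinearGroup ℂ P.pos) :
    ModeAlgebra P →ₐ[ℂ] ModeAlgebra P :=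
  RingQuot.liftAlgHom ℂ ⟨(RingQuot.mkAlgHom ℂ (ModeRel P)).comp
    (TensorAlgebra.lift ℂ ((TensorAlgebra.ι ℂ).comp
      (Finsupp.mapRange.linearMap (α := ℤ) (ext D g)))), by
    rintro _ _ ⟨u, v, m, n⟩
    have h := RingQuot.mkAlgHom_rel ℂ (ModeRel.rel (P := P) (ext D g u) (ext D g v) m n)
    rw [form_ext] at h
    simpa using h⟩

theorem algAct_modeElt (D : DualBases P ι) (g : LinearMap.GeneralLinearGroup ℂ P.pos)
    (n : ℤ) (v : V) : algAct D g (modeElt P n v) = modeElt P n (ext D g v) := by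
  simp [algAct, modeElt]

/-- The action of `g ∈ GL(V⁺)` on `A(V)_tw`:
`g · v₁(n₁) ⋯ v_k(n_k) v_tw = (g v₁)(n₁) ⋯ (g v_k)(n_k) v_tw`. -/
def glAct (D : DualBases P ι) (g : LinearMap.GeneralLinearGroup ℂ P.pos) :
    Module.End ℂ (TwFock P) :=
  let f : TwFock P →ₛₗ[(algAct D g : ModeAlgebra P →+* ModeAlgebra P)] TwFock P :=
    (annihilators P).liftQ
      ({ toFun := fun x => (annihilators P).mkQ (algAct D g x)
         map_add' := fun x y => by simp
         map_smul' := fun c x => by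
          rw [smul_eq_mul, map_mul, ← smul_eq_mul, map_smul]; rfl } :
        ModeAlgebra P →ₛₗ[(algAct D g : ModeAlgebra P →+* ModeAlgebra P)] TwFock P)
      (by
        refine Submodule.span_le.2 ?_
        rintro _ ⟨n, v, hv, rfl⟩
        change (annihilators P).mkQ (algAct D g (modeElt P n v)) = 0
        rw [algAct_modeElt, Submodule.mkQ_apply, Submodule.Quotient.mk_eq_zero]
        refine Submodule.subset_span ⟨n, _, ?_, rfl⟩
        refine hv.imp id fun ⟨h0, hp⟩ => ⟨h0, ?_⟩
        have := ext_pos D g ⟨v, hp⟩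
        simp only at this
        rw [this]
        exact Subtype.property _)
  { toFun := f
    map_add' := f.map_add
    map_smul' := fun c x => by
      have h := f.map_smulₛₗ (algebraMap ℂ (ModeAlgebra P) c) x
      simpa [algebraMap_smul] using h }

end Vertex

/-! ## The twisted module `W_tw = A(e)_tw ⊗ A(a)_tw ⊗ A(a')_tw ⊗ A(b)_tw` -/

section Module5

variable {U₁ U₂ U₃ U₄ : Type*}
  [AddCommGroup U₁] [Module ℂ U₁] [AddCommGroup U₂] [Module ℂ U₂]
  [AddCommGroup U₃] [Module ℂ U₃] [AddCommGroup U₄] [Module ℂ U₄]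
  {Pe : PolarizedSpace 1 U₁} {Pa : PolarizedSpace 1 U₂} {Pa' : PolarizedSpace 1 U₃}
  {Pb : PolarizedSpace (-1) U₄}

/-- The space `W_tw`. -/
abbrev Wtw (Pe : PolarizedSpace 1 U₁) (Pa : PolarizedSpace 1 U₂) (Pa' : PolarizedSpace 1 U₃)
    (Pb : PolarizedSpace (-1) U₄) : Type _ :=
  TwFock Pe ⊗[ℂ] (TwFock Pa ⊗[ℂ] (TwFock Pa' ⊗[ℂ] TwFock Pb))

/-- The operator `f₁ ⊗ f₂ ⊗ f₃ ⊗ f₄` on `W_tw`. -/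
def op4 (f₁ : Module.End ℂ (TwFock Pe)) (f₂ : Module.End ℂ (TwFock Pa))
    (f₃ : Module.End ℂ (TwFock Pa')) (f₄ : Module.End ℂ (TwFock Pb)) :
    Module.End ℂ (Wtw Pe Pa Pa' Pb) :=
  TensorProduct.map f₁ (TensorProduct.map f₂ (TensorProduct.map f₃ f₄))

variable (De : DualBases Pe (Fin 1)) (Da : DualBases Pa (Fin 1)) (Da' : DualBases Pa' (Fin 1))
  (Db : DualBases Pb (Fin 3))

/-- `J_e(0)`, for `ȷ_e = ȷ ⊗ 𝐯 ⊗ 𝐯 ⊗ 𝐯`. -/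
def Je : Module.End ℂ (Wtw Pe Pa Pa' Pb) := op4 (J0 De) 1 1 1

/-- `J(0)`, for `ȷ⁽⁵⁾ = 2 𝐯 ⊗ ȷ ⊗ 𝐯 ⊗ 𝐯 + 3 𝐯 ⊗ 𝐯 ⊗ ȷ ⊗ 𝐯 + 𝐯 ⊗ 𝐯 ⊗ 𝐯 ⊗ ȷ`. -/
def J5 : Module.End ℂ (Wtw Pe Pa Pa' Pb) :=
  (2 : ℂ) • op4 1 (J0 Da) 1 1 + (3 : ℂ) • op4 1 1 (J0 Da') 1 + op4 1 1 1 (J0 Db)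

/-- `L(0)`, for the tensor product Virasoro element. -/
def L5 : Module.End ℂ (Wtw Pe Pa Pa' Pb) :=
  op4 (L0 De) 1 1 1 + op4 1 (L0 Da) 1 1 + op4 1 1 (L0 Da') 1 + op4 1 1 1 (L0 Db)

/-- `(-1)^F = (-I) ⊗ (-I) ⊗ (-I) ⊗ I`. -/
def parity : Module.End ℂ (Wtw Pe Pa Pa' Pb) :=
  op4 (glAct De (-1)) (glAct Da (-1)) (glAct Da' (-1)) 1

/-- The bigraded piece of `W_tw` on which `J(0) = m` and `L(0) = n`. -/
def Wpiece (m : ℤ) (n : ℕ) : Submodule ℂ (Wtw Pe Pa Pa' Pb) :=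
  (J5 Da Da' Db : Module.End ℂ (Wtw Pe Pa Pa' Pb)).eigenspace (m : ℂ) ⊓
    (L5 De Da Da' Db).eigenspace (n : ℂ)

variable {H : Type*} [Group H] (r : H →* LinearMap.GeneralLinearGroup ℂ Pa.pos)
  (r' : H →* LinearMap.GeneralLinearGroup ℂ Pa'.pos)
  (s : H →* LinearMap.GeneralLinearGroup ℂ Pb.pos)

/-- The action `I ⊗ r(h) ⊗ r'(h) ⊗ s(h)` of `h` on `W_tw`. -/
def grpAct (h : H) : Module.End ℂ (Wtw Pe Pa Pa' Pb) :=
  op4 1 (glAct Da (r h)) (glAct Da' (r' h)) (glAct Db (s h))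

/-- The operator `(h + h⁻¹) J_e(0) (-1)^F`. -/
def twinedOp (h : H) : Module.End ℂ (Wtw Pe Pa Pa' Pb) :=
  (grpAct Da Da' Db r r' s h + grpAct Da Da' Db r r' s h⁻¹) * Je De * parity De Da Da'

open Classical in
/-- The trace of `T` on a subspace that `T` preserves. -/
def traceOn {M : Type*} [AddCommGroup M] [Module ℂ M] (S : Submodule ℂ M)
    (T : Module.End ℂ M) : ℂ :=
  if hT : ∀ x ∈ S, T x ∈ S then LinearMap.trace ℂ S (T.restrict hT) else 0

/-- The coefficient of `y^m q^n` in
`ψ̃_h = -tr((h + h⁻¹) J_e(0) (-1)^F y^{J(0)} q^{L(0)} | W_tw)`. -/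
def psiTildeCoeff (h : H) (m : ℤ) (n : ℕ) : ℂ :=
  -traceOn (Wpiece De Da Da' Db m n) (twinedOp De Da Da' Db r r' s h)

end Module5

/-! ## The groups -/

/-- The subgroup `{1, -1}` of `GL₂(𝔽₅)`. -/
def pmOne : Subgroup (GL (Fin 2) (ZMod 5)) where
  carrier := {g | g = 1 ∨ g = -1}
  one_mem' := Or.inl rfl
  mul_mem' := by rintro _ _ (rfl | rfl) (rfl | rfl) <;> simp
  inv_mem' := by rintro _ (rfl | rfl) <;> simp

instance : pmOne.Normal where
  conj_mem := by rintro _ (rfl | rfl) g <;> simp [pmOne]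

/-- `GL₂(5)/2`, the quotient of `GL₂(𝔽₅)` by `{1, -1}`. -/
abbrev GL25mod2 : Type := GL (Fin 2) (ZMod 5) ⧸ pmOne

/-- The names of the fourteen conjugacy classes of `G⁽⁵⁾ ≃ GL₂(5)/2`. -/
inductive Cls5
  | c1A | c2A | c4A | c4B | c2B | c2C | c4C | c4D | c3A | c6A | c12A | c12B | c5A | c10A

/-- The name of the conjugacy class of the image of a matrix `A`. The linear character `χ₃` of
`G⁽⁵⁾` sends `A` to `i^k` where `det A = 2^k`, and the classes with a given determinant are told
apart by `(tr A)²` and by whether `A` is scalar. -/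
def clsMatrix (A : Matrix (Fin 2) (Fin 2) (ZMod 5)) : Cls5 :=
  if A.det = 1 then
    if A.trace ^ 2 = 0 then .c2B
    else if A.trace ^ 2 = 1 then .c3A
    else if A = Matrix.scalar (Fin 2) (A 0 0) then .c1A else .c5A
  else if A.det = 4 then
    if A.trace ^ 2 = 0 then .c2C
    else if A.trace ^ 2 = 4 then .c6A
    else if A = Matrix.scalar (Fin 2) (A 0 0) then .c2A else .c10A
  else if A.det = 2 then
    if A.trace ^ 2 = 0 then .c4A
    else if A.trace ^ 2 = 1 then .c12A
    else .c4C
  else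
    if A.trace ^ 2 = 0 then .c4B
    else if A.trace ^ 2 = 4 then .c12B
    else .c4D

theorem clsMatrix_neg (A : Matrix (Fin 2) (Fin 2) (ZMod 5)) : clsMatrix (-A) = clsMatrix A := by
  have h1 : (-A).det = A.det := by simp [Matrix.det_neg]
  have h2 : (-A).trace ^ 2 = A.trace ^ 2 := by simp [Matrix.trace_neg]
  have h3 : (-A = Matrix.scalar (Fin 2) ((-A) 0 0)) = (A = Matrix.scalar (Fin 2) (A 0 0)) := by
    rw [Matrix.neg_apply, map_neg, neg_inj]
  unfold clsMatrix
  simp only [h1, h2, h3]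

/-- The name of the conjugacy class of an element of `GL₂(5)/2`. -/
def cls5 (g : GL25mod2) : Cls5 :=
  Quotient.liftOn' g (fun A => clsMatrix A.val) (by
    intro A B hAB
    rw [QuotientGroup.leftRel_apply] at hAB
    have hB : B = A ∨ B = -A := by
      rcases hAB with h | h
      · exact Or.inl (inv_mul_eq_one.1 h).symm
      · exact Or.inr (by rw [inv_mul_eq_iff_eq_mul.1 h]; simp)
    rcases hB with rfl | rfl
    · rfl
    · simp [clsMatrix_neg])

/-- The group `S₃ × 4`. -/
abbrev S3C4 : Type := Equiv.Perm (Fin 3) × Multiplicative (ZMod 4)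

/-- The names of the twelve conjugacy classes of `G⁽⁵⁾₂₄ ≃ S₃ × 4`. -/
inductive Cls24
  | c1A | c2A | c4A | c4B | c2B | c2C | c4C | c4D | c3A | c6A | c12A | c12B

/-- The name of the conjugacy class of `(p, t^k)` in `S₃ × 4`, with `t` a generator of the
cyclic group of order four. -/
def cls24 (x : S3C4) : Cls24 :=
  let k : Fin 4 := (Multiplicative.toAdd x.2 : ZMod 4)
  if x.1 = 1 then ![.c1A, .c4A, .c2A, .c4B] k
  else if Equiv.Perm.sign x.1 = -1 then ![.c2B, .c4C, .c2C, .c4D] k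
  else ![.c3A, .c12A, .c6A, .c12B] k

/-- The fusion of conjugacy classes under the inclusion of `G⁽⁵⁾₂₄` in `G⁽⁵⁾`. -/
def Cls24.fusion : Cls24 → Cls5
  | .c1A => .c1A | .c2A => .c2A | .c4A => .c4A | .c4B => .c4B | .c2B => .c2B | .c2C => .c2C
  | .c4C => .c4A | .c4D => .c4B | .c3A => .c3A | .c6A => .c6A | .c12A => .c12A | .c12B => .c12B

/-- The character `χ₂` of `S₃ × 4`. -/
def chi2 : Cls24 → ℂ
  | .c1A => 1 | .c2A => 1 | .c4A => -1 | .c4B => -1 | .c2B => 1 | .c2C => 1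
  | .c4C => -1 | .c4D => -1 | .c3A => 1 | .c6A => 1 | .c12A => -1 | .c12B => -1

/-- The character `χ₃` of `S₃ × 4`. -/
def chi3 : Cls24 → ℂ
  | .c1A => 1 | .c2A => -1 | .c4A => I | .c4B => -I | .c2B => 1 | .c2C => -1
  | .c4C => I | .c4D => -I | .c3A => 1 | .c6A => -1 | .c12A => I | .c12B => -I

/-- The character `χ₇` of `S₃ × 4`. -/
def chi7 : Cls24 → ℂ
  | .c1A => 1 | .c2A => -1 | .c4A => I | .c4B => -I | .c2B => -1 | .c2C => 1
  | .c4C => -I | .c4D => I | .c3A => 1 | .c6A => -1 | .c12A => I | .c12B => -I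

/-- The character `χ₁₂` of `S₃ × 4`. -/
def chi12 : Cls24 → ℂ
  | .c1A => 2 | .c2A => -2 | .c4A => -2 * I | .c4B => 2 * I | .c2B => 0 | .c2C => 0
  | .c4C => 0 | .c4D => 0 | .c3A => -1 | .c6A => 1 | .c12A => I | .c12B => -I

/-! ## The meromorphic Jacobi forms -/

/-- `e(x) = exp(2πix)`. -/
def e (x : ℂ) : ℂ := Complex.exp (2 * Real.pi * I * x)

/-- `θ₁(τ,z) = -i q^{1/8} y^{1/2} ∏_{n>0} (1 - y⁻¹ q^{n-1})(1 - y q^n)(1 - q^n)`. -/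
def theta1 (τ z : ℂ) : ℂ :=
  -I * e (τ / 8) * e (z / 2) *
    ∏' n : ℕ, (1 - (e z)⁻¹ * e τ ^ n) * (1 - e z * e τ ^ (n + 1)) * (1 - e τ ^ (n + 1))

/-- `θ₂(τ,z) = q^{1/8} y^{1/2} ∏_{n>0} (1 + y⁻¹ q^{n-1})(1 + y q^n)(1 - q^n)`. -/
def theta2 (τ z : ℂ) : ℂ :=
  e (τ / 8) * e (z / 2) *
    ∏' n : ℕ, (1 + (e z)⁻¹ * e τ ^ n) * (1 + e z * e τ ^ (n + 1)) * (1 - e τ ^ (n + 1))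

open ModularForm (eta)

/-- The meromorphic Jacobi form `ψ⁽⁵⁾_g` for `g` in the given conjugacy class of `G⁽⁵⁾`, for each
class that is represented in `G⁽⁵⁾₂₄`; the value `0` on the other four classes is a placeholder
that is never used. -/
def psi5 (c : Cls5) (τ z : ℂ) : ℂ :=
  match c with
  | .c1A => 2 * I * (eta τ ^ 3 * theta1 τ (2 * z) * theta1 τ (3 * z) / theta1 τ z ^ 3)
  | .c2A => -2 * I * (eta τ ^ 3 * theta1 τ (2 * z) * theta2 τ (3 * z) / theta2 τ z ^ 3)
  | .c2B => -2 * I * (eta τ ^ 3 * theta1 τ (2 * z) * theta1 τ (3 * z) /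
      (theta1 τ z * theta2 τ z ^ 2))
  | .c2C => 2 * I * (eta τ ^ 3 * theta1 τ (2 * z) * theta2 τ (3 * z) /
      (theta1 τ z ^ 2 * theta2 τ z))
  | .c3A => -2 * I * (eta (3 * τ) * theta1 τ (2 * z) * theta1 τ (3 * z) /
      theta1 (3 * τ) (3 * z))
  | .c6A => -2 * I * (eta (3 * τ) * theta1 τ (2 * z) * theta2 τ (3 * z) /
      theta2 (3 * τ) (3 * z))
  | .c4A | .c4B => -I * (eta (2 * τ) ^ 2 * theta2 τ (2 * z) /
        (eta τ * theta2 (2 * τ) (2 * z) ^ 2)) *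
      (theta1 τ (z + 1 / 4) * theta1 τ (3 * z + 1 / 4)
        - theta1 τ (z - 1 / 4) * theta1 τ (3 * z - 1 / 4))
  | .c12A | .c12B => I * (eta (6 * τ) * theta2 τ (2 * z) /
        (eta τ ^ 3 * theta2 (6 * τ) (6 * z))) *
      (theta1 τ (z + 1 / 12) * theta1 τ (z + 1 / 4) * theta1 τ (z + 5 / 12) *
          theta1 τ (3 * z - 1 / 4)
        - theta1 τ (z - 1 / 12) * theta1 τ (z - 1 / 4) * theta1 τ (z - 5 / 12) *
          theta1 τ (3 * z + 1 / 4))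
  | .c4C | .c4D | .c5A | .c10A => 0

end Umbral5

end

noncomputable section

/-! The trace is computed in a basis of `W_tw` in which every operator involved is diagonal, and the
resulting infinite products are compared with the theta quotients class by class.

Each factor is a Fock space, spanned by monomials in the creation modes v_i⁺(-k-1) and v_i⁻(-k)
applied to the vacuum. These monomials, indexed by finite sets (Clifford) or multisets (Weyl), form
a basis: number operators separate them (`linearIndependent_of_joint_eigenvector`), and no
admissible one is zero because the vacuum is nonzero, which an explicit model shows
(`vac_ne_zero_of_model`). The twisted Borcherds identity turns J(0) and L(0) into normally ordered
quadratic sums plus constants (`isPtSum_current`, `isPtSum_virasoro`). So they act on a monomial by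
adding the charges and levels of its letters to the vacuum values κ/2 and κ/8 per dual pair. An
element of `GL(V⁺)` of finite order is diagonal once the dual bases are adapted to it.

With u a scalar times a power of y, a Clifford factor with (-1)^F then contributes ∏ (1 - u⁻¹q^k)(1
- uq^(k+1)), called `thetaProd q u`. The Weyl factor contributes the inverse of such a product
(`hasSum_weyl`), expanded in geometric series; this is where |y| > 1 and |yq| < 1 enter, which is
the domain 0 < -Im z < Im τ. On the factor of 𝔢 the insertion of J(0) cancels the zero of its
product and leaves ∏ (1 - q^n)² (`hasSum_chargeTerm`). Absolute convergence of the sum over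
monomials also yields the finiteness of the bigraded pieces (`finite_jWt_lWt`).

The trace of h thus depends only on the scalars χ₂, χ₃ and the three eigenvalues on 𝔟⁺. The power
sums of these eigenvalues are the character values at h, h², h³, so Newton's identities recover them
from the class (`prod_eq_of_power_sums_eq`, `stdEig`). What remains are product identities. They
rest on multiplying theta products over roots of unity (`prod_thetaProd`), and for the classes of
order 4 and 12 on bringing the terms of h and h⁻¹ to a common denominator. -/

namespace Umbral5

/-! ### The Fock module, abstracted to its modes and its vacuum -/

section FockModule

variable {κ : ℂ} {V : Type*} [AddCommGroup V] [Module ℂ V] (P : PolarizedSpace κ V)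

/-- The linear map `v ↦ v(n)` to the mode algebra. -/
def modeEltHom (n : ℤ) : V →ₗ[ℂ] ModeAlgebra P :=
  (RingQuot.mkAlgHom ℂ (ModeRel P)).toLinearMap ∘ₗ TensorAlgebra.ι ℂ ∘ₗ Finsupp.lsingle n

/-- The linear map `v ↦ v(n)` to the operators on the Fock space. -/
def modeHom (n : ℤ) : V →ₗ[ℂ] Module.End ℂ (TwFock P) :=
  (Algebra.lsmul ℂ ℂ (TwFock P)).toLinearMap ∘ₗ modeEltHom P n

theorem mode_apply (n : ℤ) (v : V) (w : TwFock P) : mode P n v w = modeElt P n v • w := rfl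

/-- The vacuum vector of the twisted Fock space. -/
def vac : TwFock P := (annihilators P).mkQ 1

theorem modeElt_rel (u v : V) (m n : ℤ) :
    modeElt P m u * modeElt P n v + κ • (modeElt P n v * modeElt P m u) =
      algebraMap ℂ _ (if m + n = 0 then P.form u v else 0) := by
  have h := RingQuot.mkAlgHom_rel ℂ (ModeRel.rel (P := P) u v m n)
  simpa [modeElt] using h

theorem mode_rel (u v : V) (m n : ℤ) :
    mode P m u * mode P n v + κ • (mode P n v * mode P m u) =
      (if m + n = 0 then P.form u v else 0) • (1 : Module.End ℂ (TwFock P)) := by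
  have h := congrArg (Algebra.lsmul ℂ ℂ (TwFock P)) (modeElt_rel P u v m n)
  rw [map_add, map_mul, map_smul, map_mul, AlgHom.commutes, Algebra.algebraMap_eq_smul_one] at h
  exact h

theorem mode_mode (u v : V) (m n : ℤ) (w : TwFock P) :
    mode P m u (mode P n v w) =
      (if m + n = 0 then P.form u v else 0) • w - κ • mode P n v (mode P m u w) := by
  have h := congrArg (fun T : Module.End ℂ (TwFock P) => T w) (mode_rel P u v m n)
  simp only [LinearMap.add_apply, Module.End.mul_apply, LinearMap.smul_apply,
    Module.End.one_apply] at h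
  rw [← h]
  abel

theorem mode_vac {n : ℤ} {v : V} (h : 0 < n ∨ (n = 0 ∧ v ∈ P.pos)) :
    mode P n v (vac P) = 0 := by
  rw [mode_apply, vac, Submodule.mkQ_apply, ← Submodule.Quotient.mk_smul,
    Submodule.Quotient.mk_eq_zero, smul_eq_mul, mul_one]
  exact Submodule.subset_span ⟨n, v, h, rfl⟩

/-- A subspace that contains the vacuum and is stable under all modes is everything. -/
theorem eq_top_of_mode_mem (S : Submodule ℂ (TwFock P)) (h0 : vac P ∈ S)
    (h : ∀ n v, ∀ w ∈ S, mode P n v w ∈ S) : S = ⊤ := by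
  have key : ∀ (t : TensorAlgebra ℂ (ℤ →₀ V)), ∀ w ∈ S,
      RingQuot.mkAlgHom ℂ (ModeRel P) t • w ∈ S := by
    intro t
    induction t using TensorAlgebra.induction with
    | algebraMap c =>
      intro w hw
      rw [AlgHom.commutes, algebraMap_smul]
      exact S.smul_mem _ hw
    | ι x =>
      induction x using Finsupp.induction_linear with
      | zero => intro w _; simp
      | add f g hf hg =>
        intro w hw
        rw [map_add, map_add, add_smul]
        exact S.add_mem (hf w hw) (hg w hw)
      | single n v => exact fun w hw => h n v w hw
    | mul a b ha hb =>
      intro w hw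
      rw [map_mul, mul_smul]
      exact ha _ (hb _ hw)
    | add a b ha hb =>
      intro w hw
      rw [map_add, add_smul]
      exact S.add_mem (ha w hw) (hb w hw)
  rw [eq_top_iff]
  rintro w -
  obtain ⟨a, rfl⟩ := Submodule.mkQ_surjective _ w
  obtain ⟨t, rfl⟩ := RingQuot.mkAlgHom_surjective ℂ (ModeRel P) a
  have := key t _ h0
  rwa [vac, ← map_smul, smul_eq_mul, mul_one] at this

end FockModule

/-- A module `M` with operators `v(n)` satisfying the Clifford (Weyl) relations that is generated
by a vector annihilated by the positive modes. -/
structure FockRep {κ : ℂ} {V : Type*} [AddCommGroup V] [Module ℂ V] (P : PolarizedSpace κ V)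
    (M : Type*) [AddCommGroup M] [Module ℂ M] where
  mode : ℤ → V →ₗ[ℂ] Module.End ℂ M
  vac : M
  mode_mode : ∀ (u v : V) (m n : ℤ) (w : M), mode m u (mode n v w) =
    (if m + n = 0 then P.form u v else 0) • w - κ • mode n v (mode m u w)
  mode_vac : ∀ {n : ℤ} {v : V}, (0 < n ∨ (n = 0 ∧ v ∈ P.pos)) → mode n v vac = 0
  eq_top : ∀ S : Submodule ℂ M, vac ∈ S → (∀ n v, ∀ w ∈ S, mode n v w ∈ S) → S = ⊤

/-- The twisted Fock space with its modes. -/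
def twFockRep {κ : ℂ} {V : Type*} [AddCommGroup V] [Module ℂ V] (P : PolarizedSpace κ V) :
    FockRep P (TwFock P) where
  mode := modeHom P
  vac := vac P
  mode_mode := mode_mode P
  mode_vac := mode_vac P
  eq_top := eq_top_of_mode_mem P

namespace FockRep

variable {κ : ℂ} {V : Type*} [AddCommGroup V] [Module ℂ V] {P : PolarizedSpace κ V}
  {M : Type*} [AddCommGroup M] [Module ℂ M] (R : FockRep P M)

theorem induction {p : M → Prop} (h0 : p R.vac)
    (hadd : ∀ x y, p x → p y → p (x + y)) (hsmul : ∀ (c : ℂ) x, p x → p (c • x))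
    (hmode : ∀ n v w, p w → p (R.mode n v w)) (w : M) : p w := by
  let S : Submodule ℂ M :=
    { carrier := {x | p x}
      add_mem' := fun {x y} hx hy => hadd x y hx hy
      zero_mem' := by simpa using hsmul 0 _ h0
      smul_mem' := fun c x hx => hsmul c x hx }
  have : S = ⊤ := R.eq_top S h0 hmode
  exact (this ▸ Submodule.mem_top : w ∈ S)

/-- Every vector is annihilated by all sufficiently positive modes. -/
theorem exists_mode_eq_zero (w : M) :
    ∃ N : ℕ, ∀ n : ℤ, N ≤ n → ∀ v, R.mode n v w = 0 := by
  induction w using R.induction with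
  | h0 => exact ⟨1, fun n hn v => R.mode_vac (Or.inl (by lia))⟩
  | hadd x y hx hy =>
    obtain ⟨a, ha⟩ := hx
    obtain ⟨b, hb⟩ := hy
    refine ⟨max a b, fun n hn v => ?_⟩
    rw [map_add, ha n (by lia), hb n (by lia), add_zero]
  | hsmul c x hx =>
    obtain ⟨a, ha⟩ := hx
    refine ⟨a, fun n hn v => ?_⟩
    rw [map_smul, ha n hn, smul_zero]
  | hmode m u w hw =>
    obtain ⟨a, ha⟩ := hw
    -- The bound forces n ≥ a and n + m > 0, so the contraction with the new mode vanishes as well.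
    refine ⟨a + (1 - m).toNat, fun n hn v => ?_⟩
    rw [R.mode_mode, if_neg (by lia), ha n (by lia)]
    simp

end FockRep

/-! ### Locally finite sums of operators -/

section PointwiseSums

open Filter

variable {M : Type*} [AddCommGroup M] [Module ℂ M]

/-- `T` is the pointwise eventually constant limit of the partial sums of the `S j`. -/
def IsPtSum (S : ℕ → Module.End ℂ M) (T : Module.End ℂ M) : Prop :=
  ∀ w, ∀ᶠ N in atTop, T w = ∑ j ∈ Finset.range N, S j w

theorem IsPtSum.smul {S : ℕ → Module.End ℂ M} {T : Module.End ℂ M} (c : ℂ)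
    (h : IsPtSum S T) : IsPtSum (fun j => c • S j) (c • T) := by
  intro w
  filter_upwards [h w] with N h1
  simp [h1, Finset.smul_sum]

theorem IsPtSum.sub {S S' : ℕ → Module.End ℂ M} {T T' : Module.End ℂ M}
    (h : IsPtSum S T) (h' : IsPtSum S' T') : IsPtSum (fun j => S j - S' j) (T - T') := by
  intro w
  filter_upwards [h w, h' w] with N h1 h2
  simp [h1, h2, Finset.sum_sub_distrib]

theorem IsPtSum.unique {S : ℕ → Module.End ℂ M} {T T' : Module.End ℂ M}
    (h : IsPtSum S T) (h' : IsPtSum S T') : T = T' := by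
  ext w
  obtain ⟨N, h1, h2⟩ := ((h w).and (h' w)).exists
  rw [h1, h2]

/-- The hypothesis makes every pointwise sum finite, which excludes the default value 0 of `ptSum`.
-/
theorem isPtSum_ptSum {S : ℕ → Module.End ℂ M}
    (h : ∀ w, ∃ N : ℕ, ∀ j, N ≤ j → S j w = 0) : IsPtSum S (ptSum S) := by
  have hf : ∀ w, (Function.support fun j => S j w).Finite := fun w => by
    obtain ⟨N, hN⟩ := h w
    refine (Finset.range N).finite_toSet.subset fun j hj => ?_
    by_contra hc
    exact hj (hN j (by simpa using hc))
  intro w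
  obtain ⟨N, hN⟩ := h w
  filter_upwards [eventually_ge_atTop N] with K hK
  rw [ptSum, dif_pos hf]
  refine finsum_eq_sum_of_support_subset _ fun j hj => ?_
  by_contra hc
  exact hj (hN j (hK.trans (by simpa using hc)))

theorem IsPtSum.ptSum_eq {S : ℕ → Module.End ℂ M} {T : Module.End ℂ M}
    (hS : ∀ w, ∃ N : ℕ, ∀ j, N ≤ j → S j w = 0) (h : IsPtSum S T) : ptSum S = T :=
  (isPtSum_ptSum hS).unique h

theorem ptSum_eq_sum {S : ℕ → Module.End ℂ M} (N : ℕ) (h : ∀ j, N ≤ j → S j = 0) :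
    ptSum S = ∑ j ∈ Finset.range N, S j := by
  refine IsPtSum.ptSum_eq (fun w => ⟨N, fun j hj => by simp [h j hj]⟩) fun w => ?_
  filter_upwards [eventually_ge_atTop N] with K hK
  rw [LinearMap.sum_apply]
  refine Finset.sum_subset (by simpa using hK) fun j _ hj => ?_
  rw [h j (by simpa using hj), LinearMap.zero_apply]

end PointwiseSums

/-! ### Binomial coefficients and alternating sums -/

section BinomialCoefficients

theorem choose_neg_one (j : ℕ) : Ring.choose (-1 : ℤ) j = (-1) ^ j := by
  have h := Ring.choose_neg (r := (1 : ℤ)) (n := j)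
  rw [h]
  have : (1 : ℤ) + j - 1 = (j : ℤ) := by ring
  rw [this, Ring.choose_natCast]
  simp [Int.negOnePow_def, Units.smul_def]

theorem choose_neg_two (j : ℕ) : Ring.choose (-2 : ℤ) j = (-1) ^ j * (j + 1) := by
  have h := Ring.choose_neg (r := (2 : ℤ)) (n := j)
  rw [h]
  have : (2 : ℤ) + j - 1 = ((j + 1 : ℕ) : ℤ) := by push_cast; ring
  rw [this, Ring.choose_natCast]
  simp [Int.negOnePow_def, Units.smul_def, mul_add, Nat.choose_succ_self_right]

theorem choose_neg_half_two : Ring.choose (-1 / 2 : ℚ) 2 = 3 / 8 := by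
  have h := Ring.descPochhammer_eq_factorial_smul_choose (-1 / 2 : ℚ) 2
  simp only [descPochhammer_succ_right, descPochhammer_zero, one_mul, Polynomial.smeval_mul,
    Polynomial.smeval_sub, Polynomial.smeval_X, Polynomial.smeval_natCast, pow_one, pow_zero,
    Nat.factorial, nsmul_eq_mul] at h
  norm_num at h
  linarith

/-- The l-th difference of a polynomial of degree below l is zero. This case of constants and the
linear case below make all but the first few Borcherds sums of free fields vanish. -/
theorem alternating_sum_choose {l : ℕ} (h : l ≠ 0) :
    ∑ j ∈ Finset.range (l + 1), (-1 : ℂ) ^ j * (l.choose j : ℂ) = 0 := by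
  have := Int.alternating_sum_range_choose_of_ne h
  exact_mod_cast congrArg (Int.cast : ℤ → ℂ) this

theorem alternating_sum_choose_mul {l : ℕ} (h : 2 ≤ l) :
    ∑ j ∈ Finset.range (l + 1), (-1 : ℂ) ^ j * (l.choose j : ℂ) * j = 0 := by
  obtain ⟨k, rfl⟩ : ∃ k, l = k + 1 := ⟨l - 1, by lia⟩
  rw [Finset.sum_range_succ']
  have h1 := alternating_sum_choose (l := k) (by lia)
  have : ∀ j, (-1 : ℂ) ^ (j + 1) * ((k + 1).choose (j + 1) : ℂ) * ((j + 1 : ℕ) : ℂ) =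
      -(k + 1) * ((-1 : ℂ) ^ j * (k.choose j : ℂ)) := fun j => by
    have := congrArg (Nat.cast : ℕ → ℂ) (Nat.add_one_mul_choose_eq k j)
    push_cast at this ⊢
    linear_combination (-1 : ℂ) ^ j * this
  rw [Finset.sum_congr rfl fun j _ => this j, ← Finset.mul_sum, h1]
  simp

end BinomialCoefficients

/-! ### Borcherds sums, and products with the vacuum field -/

section Borcherds

variable {M : Type*} [AddCommGroup M] [Module ℂ M]

theorem borcherdsSum_neg_one (ε : ℂ) (X Y : ℚ → Module.End ℂ M) (s t : ℚ) :
    borcherdsSum ε X Y (-1) s t =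
      ptSum fun j => X (s - 1 - j) * Y (t + j) + ε • (Y (t - 1 - j) * X (s + j)) := by
  unfold borcherdsSum
  congr 1
  funext j
  have h1 : ((((-1) ^ j * (Ring.choose (-1 : ℤ) j : ℤ) : ℤ) : ℂ)) = 1 := by
    rw [choose_neg_one, ← mul_pow]; simp
  rw [h1, one_smul]
  simp [sub_eq_add_neg]

theorem borcherdsSum_neg_two (ε : ℂ) (X Y : ℚ → Module.End ℂ M) (s t : ℚ) :
    borcherdsSum ε X Y (-2) s t = ptSum fun j =>
      ((j : ℂ) + 1) • (X (s - 2 - j) * Y (t + j) - ε • (Y (t - 2 - j) * X (s + j))) := by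
  unfold borcherdsSum
  congr 1
  funext j
  have h1 : ((((-1) ^ j * (Ring.choose (-2 : ℤ) j : ℤ) : ℤ) : ℂ)) = j + 1 := by
    rw [choose_neg_two, ← mul_assoc, ← mul_pow]; simp
  rw [h1]
  simp [sub_eq_add_neg]

/-- For a nonnegative index the Borcherds sum is a finite sum of supercommutators. -/
theorem borcherdsSum_natCast {ε : ℂ} {X Y : ℚ → Module.End ℂ M} {l : ℕ} {s t : ℚ}
    {C : ℕ → Module.End ℂ M}
    (h : ∀ j ≤ l, X (s + l - j) * Y (t + j) - ε • (Y (t + j) * X (s + l - j)) = C j) :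
    borcherdsSum ε X Y l s t =
      ∑ j ∈ Finset.range (l + 1), ((-1 : ℂ) ^ j * (l.choose j : ℂ)) • C j := by
  unfold borcherdsSum
  rw [ptSum_eq_sum (l + 1) fun j hj => by
    rw [Ring.choose_natCast, Nat.choose_eq_zero_of_lt (by lia)]; simp]
  -- The second half is written in the index l - j; after `Finset.sum_flip` both halves involve the
  -- same pair of modes and combine to supercommutators.
  have h1 : ∀ j ∈ Finset.range (l + 1), ((((-1) ^ j * (Ring.choose ((l : ℕ) : ℤ) j : ℤ) : ℤ) : ℂ)) •
      (X (s + (l : ℤ) - j) * Y (t + j)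
        - ((-1 : ℂ) ^ (l : ℤ) * ε) • (Y (t + (l : ℤ) - j) * X (s + j))) =
      ((-1 : ℂ) ^ j * (l.choose j : ℂ)) • (X (s + l - j) * Y (t + j)) -
      ((-1 : ℂ) ^ (l - j) * (l.choose (l - j) : ℂ)) •
        ε • (Y (t + (l - j : ℕ)) * X (s + l - (l - j : ℕ))) := by
    intro j hj
    have hj : j ≤ l := by simpa [Nat.lt_succ_iff] using hj
    have e1 : t + (l - j : ℕ) = t + l - j := by push_cast [hj]; ring
    have e2 : s + l - (l - j : ℕ) = s + j := by push_cast [hj]; ring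
    have e3 : (-1 : ℂ) ^ l * (-1) ^ j = (-1) ^ (l - j) := by
      rw [← pow_add, show l + j = (l - j) + 2 * j by lia, pow_add, pow_mul]; simp
    rw [e1, e2, Nat.choose_symm hj, Ring.choose_natCast, ← e3, smul_sub, smul_smul, smul_smul]
    push_cast
    rw [zpow_natCast]
    congr 2
    ring
  rw [Finset.sum_congr rfl h1, Finset.sum_sub_distrib,
    Finset.sum_flip (fun j => ((-1 : ℂ) ^ j * (l.choose j : ℂ)) •
        ε • (Y (t + j) * X (s + l - j))), ← Finset.sum_sub_distrib]
  refine Finset.sum_congr rfl fun j hj => ?_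
  rw [← smul_sub, h j (by simpa [Nat.lt_succ_iff] using hj)]

/-- The twisted product when only the first three Borcherds sums contribute. -/
theorem twProd_eq {ε : ℂ} {l : ℤ} {X Y : ℚ → Module.End ℂ M} {n : ℚ}
    (h : ∀ j : ℕ, 3 ≤ j → borcherdsSum ε X Y (l + j) (1 / 2) (n - 1 / 2 - j) = 0) :
    twProd ε l X Y n = borcherdsSum ε X Y l (1 / 2) (n - 1 / 2)
      - (1 / 2 : ℂ) • borcherdsSum ε X Y (l + 1) (1 / 2) (n - 3 / 2)
      + (3 / 8 : ℂ) • borcherdsSum ε X Y (l + 2) (1 / 2) (n - 5 / 2) := by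
  unfold twProd
  rw [finsum_eq_sum_of_support_subset (s := Finset.range 3) _ fun j hj => by
    by_contra hc
    refine hj ?_
    simp only
    rw [h j (by simpa using hc), smul_zero]]
  -- The coefficients C(-1/2, j) for j = 0, 1, 2 are 1, -1/2, 3/8.
  simp only [Finset.sum_range_succ, Finset.sum_range_zero, zero_add, Ring.choose_zero_right,
    Ring.choose_one_right, choose_neg_half_two]
  have e1 : n - 1 / 2 - 1 = n - 3 / 2 := by ring
  have e2 : n - 1 / 2 - 2 = n - 5 / 2 := by ring
  push_cast
  rw [e1, e2, add_zero, sub_zero, one_smul, neg_div, neg_smul, ← sub_eq_add_neg]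

/-- The field of the vacuum state. -/
def idField (r : ℚ) : Module.End ℂ M := if r = -1 then 1 else 0

theorem idField_commute (X : Module.End ℂ M) (r : ℚ) :
    X * idField r - (1 : ℂ) • (idField r * X) = 0 := by
  unfold idField
  split_ifs <;> simp

theorem borcherdsSum_idField_natCast (X : ℚ → Module.End ℂ M) (l : ℕ) (s t : ℚ) :
    borcherdsSum 1 X idField l s t = 0 := by
  rw [borcherdsSum_natCast (C := 0) fun j _ => idField_commute _ _]
  simp

/-- The identity field has a single nonzero mode, so a single index j contributes: j = -1 - t from
the first products if t < 0, and j = t from the second if t ≥ 0. Either way the mode is a (t + 1).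
-/
theorem borcherdsSum_idField_neg_one {X : ℚ → Module.End ℂ M} {a : ℤ → Module.End ℂ M}
    (hX : ∀ m : ℤ, X ((m : ℚ) - 1 / 2) = a m) (t : ℤ) :
    borcherdsSum 1 X idField (-1) (1 / 2) t = a (t + 1) := by
  have h : ∀ j : ℕ, X (1 / 2 - 1 - j) * idField ((t : ℚ) + j)
      + (1 : ℂ) • (idField ((t : ℚ) - 1 - j) * X (1 / 2 + j)) =
      if j = (if t < 0 then (-1 - t).toNat else t.toNat) then a (t + 1) else 0 := by
    intro j
    have e1 := hX (-j)
    have e2 := hX (j + 1)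
    rw [show ((-j : ℤ) : ℚ) - 1 / 2 = 1 / 2 - 1 - j by push_cast; ring] at e1
    rw [show ((j + 1 : ℤ) : ℚ) - 1 / 2 = 1 / 2 + j by push_cast; ring] at e2
    have i1 : ((t : ℚ) + j = -1) ↔ t + j = -1 := by exact_mod_cast Iff.rfl
    have i2 : ((t : ℚ) - 1 - j = -1) ↔ t - 1 - j = -1 := by exact_mod_cast Iff.rfl
    rw [e1, e2, one_smul]
    simp only [idField, i1, i2]
    split_ifs with h1 h2 h3 h4 h5 h6 <;> first | lia | skip
    all_goals simp only [mul_one, mul_zero, one_mul, zero_mul, add_zero, zero_add]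
    all_goals first | lia | (congr 1; lia)
  rw [borcherdsSum_neg_one]
  simp only [h]
  rw [ptSum_eq_sum ((if t < 0 then (-1 - t).toNat else t.toNat) + 1) fun j hj => by
    rw [if_neg (by lia)]]
  simp

theorem borcherdsSum_idField_neg_two {X : ℚ → Module.End ℂ M} {a : ℤ → Module.End ℂ M}
    (hX : ∀ m : ℤ, X ((m : ℚ) - 1 / 2) = a m) (t : ℤ) :
    borcherdsSum 1 X idField (-2) (1 / 2) t = (-(t : ℂ)) • a t := by
  have h : ∀ j : ℕ, ((j : ℂ) + 1) • (X (1 / 2 - 2 - j) * idField ((t : ℚ) + j)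
      - (1 : ℂ) • (idField ((t : ℚ) - 2 - j) * X (1 / 2 + j))) =
      if j = (if t < 0 then (-1 - t).toNat else (t - 1).toNat) then (-(t : ℂ)) • a t else 0 := by
    intro j
    have e1 := hX (-j - 1)
    have e2 := hX (j + 1)
    rw [show ((-j - 1 : ℤ) : ℚ) - 1 / 2 = 1 / 2 - 2 - j by push_cast; ring] at e1
    rw [show ((j + 1 : ℤ) : ℚ) - 1 / 2 = 1 / 2 + j by push_cast; ring] at e2
    have i1 : ((t : ℚ) + j = -1) ↔ t + j = -1 := by exact_mod_cast Iff.rfl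
    have i2 : ((t : ℚ) - 2 - j = -1) ↔ t - 2 - j = -1 := by exact_mod_cast Iff.rfl
    rw [e1, e2, one_smul]
    simp only [idField, i1, i2]
    by_cases h1 : t + j = -1
    · rw [if_pos h1, if_neg (by lia), if_pos (by rw [if_pos (by lia)]; lia)]
      obtain rfl : t = -j - 1 := by lia
      simp only [mul_one, zero_mul, sub_zero]
      push_cast
      module
    · by_cases h2 : t - 2 - j = -1
      · rw [if_neg h1, if_pos h2, if_pos (by rw [if_neg (by lia)]; lia)]
        obtain rfl : t = j + 1 := by lia
        simp only [mul_zero, one_mul, zero_sub]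
        push_cast
        module
      · rw [if_neg h1, if_neg h2]
        by_cases h3 : j = (if t < 0 then (-1 - t).toNat else (t - 1).toNat)
        -- At t = 0 no product survives, while the index formula still selects j = 0; the
        -- coefficient -t is then zero.
        · have : t = 0 := by split_ifs at h3 <;> lia
          simp [this]
        · rw [if_neg h3]; simp
  rw [borcherdsSum_neg_two]
  simp only [h]
  rw [ptSum_eq_sum ((if t < 0 then (-1 - t).toNat else (t - 1).toNat) + 1) fun j hj => by
    rw [if_neg (by lia)]]
  simp

/-- The vacuum axiom x₍₋₁₎𝐯 = x: the field that `Ytw` assigns to a generator is the generating field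
itself. -/
theorem twProd_idField_neg_one {X : ℚ → Module.End ℂ M} {a : ℤ → Module.End ℂ M}
    (hX : ∀ m : ℤ, X ((m : ℚ) - 1 / 2) = a m) (m : ℤ) :
    twProd 1 (-1) X idField ((m : ℚ) - 1 / 2) = a m := by
  have h : ∀ (l : ℕ) (t : ℚ), borcherdsSum 1 X idField l (1 / 2) t = 0 := fun l t =>
    borcherdsSum_idField_natCast X l _ t
  rw [twProd_eq fun j hj => by rw [← h (j - 1)]; congr 1; lia]
  have h1 := h 0 ((m : ℚ) - 1 / 2 - 3 / 2)
  have h2 := h 1 ((m : ℚ) - 1 / 2 - 5 / 2)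
  have h3 := borcherdsSum_idField_neg_one hX (m - 1)
  push_cast at h1 h2 h3
  rw [show (-1 : ℤ) + 1 = 0 by lia, show (-1 : ℤ) + 2 = 1 by lia, h1, h2,
    show (m : ℚ) - 1 / 2 - 1 / 2 = m - 1 by ring, h3]
  simp

/-- The product x₍₋₂₎𝐯 is the derivative of the field. The index -2 gives -(m - 1) and the
correction of index -1 gives -1/2, which together are the exponent lowered by d/dz. -/
theorem twProd_idField_neg_two {X : ℚ → Module.End ℂ M} {a : ℤ → Module.End ℂ M}
    (hX : ∀ m : ℤ, X ((m : ℚ) - 1 / 2) = a m) (m : ℤ) :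
    twProd 1 (-2) X idField ((m : ℚ) - 1 / 2) = (-((m : ℂ) - 1 / 2)) • a (m - 1) := by
  have h : ∀ (l : ℕ) (t : ℚ), borcherdsSum 1 X idField l (1 / 2) t = 0 := fun l t =>
    borcherdsSum_idField_natCast X l _ t
  rw [twProd_eq fun j hj => by rw [← h (j - 2)]; congr 1; lia]
  have h1 := borcherdsSum_idField_neg_one hX (m - 2)
  have h2 := h 0 ((m : ℚ) - 1 / 2 - 5 / 2)
  have h3 := borcherdsSum_idField_neg_two hX (m - 1)
  push_cast at h1 h2 h3
  rw [show (-2 : ℤ) + 1 = -1 by lia, show (-2 : ℤ) + 2 = 0 by lia, h2,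
    show (m : ℚ) - 1 / 2 - 3 / 2 = m - 2 by ring, h1,
    show (m : ℚ) - 1 / 2 - 1 / 2 = m - 1 by ring, h3,
    show m - 2 + 1 = m - 1 by ring]
  module

end Borcherds

/-! ### Borcherds sums of two free fields -/

section Bilinear

variable {M : Type*} [AddCommGroup M] [Module ℂ M]

theorem halfField_apply {X : ℚ → Module.End ℂ M} {a : ℤ → Module.End ℂ M}
    (hX : ∀ m : ℤ, X ((m : ℚ) - 1 / 2) = a m) (m : ℤ) (r : ℚ) (hr : r = m - 1 / 2) : X r = a m :=
  hr ▸ hX m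

theorem isPtSum_borcherdsSum_neg_one {X Y : ℚ → Module.End ℂ M} {a b : ℤ → Module.End ℂ M}
    (hX : ∀ m : ℤ, X ((m : ℚ) - 1 / 2) = a m) (hY : ∀ m : ℤ, Y ((m : ℚ) - 1 / 2) = b m)
    (ha : ∀ w, ∃ N : ℕ, ∀ n : ℤ, N ≤ n → a n w = 0) (hb : ∀ w, ∃ N : ℕ, ∀ n : ℤ, N ≤ n → b n w = 0)
    (ε : ℂ) {p : ℤ} {t : ℚ} (ht : t = p - 1 / 2) :
    IsPtSum (fun j => a (-j) * b (p + j) + ε • (b (p - 1 - j) * a (j + 1)))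
      (borcherdsSum ε X Y (-1) (1 / 2) t) := by
  rw [borcherdsSum_neg_one, ht]
  have h : (fun j : ℕ => X (1 / 2 - 1 - j) * Y (p - 1 / 2 + j)
      + ε • (Y (p - 1 / 2 - 1 - j) * X (1 / 2 + j))) =
      fun j : ℕ => a (-j) * b (p + j) + ε • (b (p - 1 - j) * a (j + 1)) := by
    funext j
    rw [halfField_apply hX (-j) (1 / 2 - 1 - j) (by push_cast; ring),
      halfField_apply hX (j + 1) (1 / 2 + j) (by push_cast; ring),
      halfField_apply hY (p + j) (p - 1 / 2 + j) (by push_cast; ring),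
      halfField_apply hY (p - 1 - j) (p - 1 / 2 - 1 - j) (by push_cast; ring)]
  rw [h]
  refine isPtSum_ptSum fun w => ?_
  obtain ⟨A, hA⟩ := ha w
  obtain ⟨B, hB⟩ := hb w
  refine ⟨A + B + p.natAbs, fun j hj => ?_⟩
  simp [hA (j + 1) (by lia), hB (p + j) (by lia)]

theorem isPtSum_borcherdsSum_neg_two {X Y : ℚ → Module.End ℂ M} {a b : ℤ → Module.End ℂ M}
    (hX : ∀ m : ℤ, X ((m : ℚ) - 1 / 2) = a m) (hY : ∀ m : ℤ, Y ((m : ℚ) - 1 / 2) = b m)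
    (ha : ∀ w, ∃ N : ℕ, ∀ n : ℤ, N ≤ n → a n w = 0) (hb : ∀ w, ∃ N : ℕ, ∀ n : ℤ, N ≤ n → b n w = 0)
    (ε : ℂ) {p : ℤ} {t : ℚ} (ht : t = p - 1 / 2) :
    IsPtSum (fun j => ((j : ℂ) + 1) •
        (a (-1 - j) * b (p + j) - ε • (b (p - 2 - j) * a (j + 1))))
      (borcherdsSum ε X Y (-2) (1 / 2) t) := by
  rw [borcherdsSum_neg_two, ht]
  have h : (fun j : ℕ => ((j : ℂ) + 1) • (X (1 / 2 - 2 - j) * Y (p - 1 / 2 + j)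
      - ε • (Y (p - 1 / 2 - 2 - j) * X (1 / 2 + j)))) =
      fun j : ℕ => ((j : ℂ) + 1) •
        (a (-1 - j) * b (p + j) - ε • (b (p - 2 - j) * a (j + 1))) := by
    funext j
    rw [halfField_apply hX (-1 - j) (1 / 2 - 2 - j) (by push_cast; ring),
      halfField_apply hX (j + 1) (1 / 2 + j) (by push_cast; ring),
      halfField_apply hY (p + j) (p - 1 / 2 + j) (by push_cast; ring),
      halfField_apply hY (p - 2 - j) (p - 1 / 2 - 2 - j) (by push_cast; ring)]
  rw [h]
  refine isPtSum_ptSum fun w => ?_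
  obtain ⟨A, hA⟩ := ha w
  obtain ⟨B, hB⟩ := hb w
  refine ⟨A + B + p.natAbs, fun j hj => ?_⟩
  simp [hA (j + 1) (by lia), hB (p + j) (by lia)]

/-- Supercommutators of free fields are scalars, so for nonnegative index only an alternating
binomial sum of scalars remains. It vanishes for l ≥ 1 if they are constant in j, and for l ≥ 2 if
they are affine in j. -/
theorem borcherdsSum_natCast_of_rel {X Y : ℚ → Module.End ℂ M} {a b : ℤ → Module.End ℂ M}
    (hX : ∀ m : ℤ, X ((m : ℚ) - 1 / 2) = a m) (hY : ∀ m : ℤ, Y ((m : ℚ) - 1 / 2) = b m)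
    {ε : ℂ} (l : ℕ) {p : ℤ} {t : ℚ} (ht : t = p - 1 / 2) {c : ℕ → ℂ}
    (h : ∀ j ≤ l, a (1 + l - j) * b (p + j) - ε • (b (p + j) * a (1 + l - j)) = c j • 1) :
    borcherdsSum ε X Y l (1 / 2) t =
      (∑ j ∈ Finset.range (l + 1), (-1 : ℂ) ^ j * (l.choose j : ℂ) * c j) • 1 := by
  rw [borcherdsSum_natCast (C := fun j => c j • 1) fun j hj => by
    rw [← h j hj, ht, halfField_apply hX (1 + l - j) (1 / 2 + l - j) (by push_cast; ring),
      halfField_apply hY (p + j) (p - 1 / 2 + j) (by push_cast; ring)]]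
  simp only [smul_smul, ← Finset.sum_smul]

end Bilinear

/-! ### Zero modes of quadratic states as normally ordered sums -/

namespace FockRep

variable {κ : ℂ} {V : Type*} [AddCommGroup V] [Module ℂ V] {P : PolarizedSpace κ V}
  {M : Type*} [AddCommGroup M] [Module ℂ M] (R : FockRep P M)

theorem exists_mode_apply_eq_zero (v : V) (w : M) :
    ∃ N : ℕ, ∀ n : ℤ, N ≤ n → R.mode n v w = 0 := by
  obtain ⟨N, hN⟩ := R.exists_mode_eq_zero w
  exact ⟨N, fun n hn => hN n hn v⟩

theorem mode_mul_mode (u v : V) (m n : ℤ) :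
    R.mode m u * R.mode n v - (-κ) • (R.mode n v * R.mode m u) =
      (if m + n = 0 then P.form u v else 0) • 1 := by
  ext w
  simp only [LinearMap.sub_apply, Module.End.mul_apply, LinearMap.smul_apply, Module.End.one_apply]
  rw [R.mode_mode]
  module

variable {X Y : ℚ → Module.End ℂ M} {u v : V}

/-- The zero mode of the current `u(-1/2) v(-1/2)` in terms of normally ordered products. -/
theorem isPtSum_current (hX : ∀ m : ℤ, X ((m : ℚ) - 1 / 2) = R.mode m u)
    (hY : ∀ m : ℤ, Y ((m : ℚ) - 1 / 2) = R.mode m v) :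
    IsPtSum (fun j => R.mode (-j) u * R.mode j v - κ • (R.mode (-1 - j) v * R.mode (j + 1) u))
      (twProd (-κ) (-1) X Y 0 + (P.form u v / 2) • 1) := by
  have h0 : ∀ (l : ℕ) {p : ℤ} {t : ℚ} (_ : t = p - 1 / 2) (_ : l + p = -1), _ := fun l p t ht hp =>
    borcherdsSum_natCast_of_rel hX hY (ε := -κ) l ht (c := fun _ => P.form u v)
      fun j hj => by rw [R.mode_mul_mode, if_pos (by lia)]
  rw [twProd_eq fun j hj => by
    have h := h0 (j - 1) (p := -j) (t := 0 - 1 / 2 - j) (by push_cast; ring) (by lia)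
    rw [← Finset.sum_mul, alternating_sum_choose (by lia), zero_mul, zero_smul] at h
    rw [← h]
    congr 1
    lia]
  -- Index 0 gives ⟨u,v⟩ with coefficient -1/2, the source of the shift by ⟨u,v⟩/2; index 1 gives
  -- zero.
  have h1 := h0 0 (p := -1) (t := 0 - 3 / 2) (by norm_num) (by norm_num)
  have h2 := h0 1 (p := -2) (t := 0 - 5 / 2) (by norm_num) (by norm_num)
  rw [← Finset.sum_mul, alternating_sum_choose one_ne_zero, zero_mul, zero_smul] at h2
  simp only [Nat.cast_zero, Nat.cast_one, zero_add, Finset.sum_range_one, pow_zero,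
    Nat.choose_self, one_mul] at h1 h2
  rw [show (-1 : ℤ) + 1 = 0 by lia, show (-1 : ℤ) + 2 = 1 by lia, h1, h2]
  have h3 := isPtSum_borcherdsSum_neg_one hX hY (R.exists_mode_apply_eq_zero u)
    (R.exists_mode_apply_eq_zero v) (-κ) (p := 0) (t := 0 - 1 / 2) (by norm_num)
  convert h3 using 1
  · funext j
    rw [zero_add, zero_sub, neg_smul, sub_eq_add_neg]
  · module

/-- Starting from index -2, the third Borcherds sum has index 0 and equals ⟨u,v⟩. Its coefficient
C(-1/2, 2) = 3/8 is the constant subtracted here. -/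
theorem isPtSum_deriv_left (hX : ∀ m : ℤ, X ((m : ℚ) - 1 / 2) = R.mode m u)
    (hY : ∀ m : ℤ, Y ((m : ℚ) - 1 / 2) = R.mode m v) :
    IsPtSum (fun j => (j + 1 : ℂ) • (R.mode (-1 - j) u * R.mode (1 + j) v
          + κ • (R.mode (-1 - j) v * R.mode (j + 1) u))
        - (1 / 2 : ℂ) • (R.mode (-j) u * R.mode j v - κ • (R.mode (-1 - j) v * R.mode (j + 1) u)))
      (twProd (-κ) (-2) X Y 1 - (3 * P.form u v / 8) • 1) := by
  have h0 : ∀ (l : ℕ) {p : ℤ} {t : ℚ} (_ : t = p - 1 / 2) (_ : l + p = -1), _ := fun l p t ht hp =>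
    borcherdsSum_natCast_of_rel hX hY (ε := -κ) l ht (c := fun _ => P.form u v)
      fun j hj => by rw [R.mode_mul_mode, if_pos (by lia)]
  rw [twProd_eq fun j hj => by
    have h := h0 (j - 2) (p := 1 - j) (t := 1 - 1 / 2 - j) (by push_cast; ring) (by lia)
    rw [← Finset.sum_mul, alternating_sum_choose (by lia), zero_mul, zero_smul] at h
    rw [← h]
    congr 1
    lia]
  have h1 := h0 0 (p := -1) (t := 1 - 5 / 2) (by norm_num) (by norm_num)
  simp only [Nat.cast_zero, zero_add, Finset.sum_range_one, pow_zero,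
    Nat.choose_self, one_mul] at h1
  rw [show (-2 : ℤ) + 1 = -1 by lia, show (-2 : ℤ) + 2 = 0 by lia, h1, Nat.cast_one]
  have h2 := isPtSum_borcherdsSum_neg_one hX hY (R.exists_mode_apply_eq_zero u)
    (R.exists_mode_apply_eq_zero v) (-κ) (p := 0) (t := 1 - 3 / 2) (by norm_num)
  have h3 := isPtSum_borcherdsSum_neg_two hX hY (R.exists_mode_apply_eq_zero u)
    (R.exists_mode_apply_eq_zero v) (-κ) (p := 1) (t := 1 - 1 / 2) (by norm_num)
  convert h3.sub (h2.smul (1 / 2)) using 1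
  · funext j
    simp only [zero_add, neg_smul, sub_eq_add_neg, neg_neg]
    norm_num
  · module

/-- The supercommutator with a differentiated field is affine in the mode, so the sums of index 0
and 1 both survive. They equal ⟨u,v⟩/2 and ⟨u,v⟩, and -1/2 · 1/2 + 3/8 = 1/8. -/
theorem isPtSum_deriv_right (hX : ∀ m : ℤ, X ((m : ℚ) - 1 / 2) = R.mode m u)
    (hY : ∀ m : ℤ, Y ((m : ℚ) - 1 / 2) = (-((m : ℂ) - 1 / 2)) • R.mode (m - 1) v) :
    IsPtSum (fun j => (-(j + 1 / 2 : ℂ)) • (R.mode (-j) u * R.mode j v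
          + κ • (R.mode (-1 - j) v * R.mode (j + 1) u)))
      (twProd (-κ) (-1) X Y 1 - (P.form u v / 8) • 1) := by
  have h0 : ∀ (l : ℕ) {p : ℤ} {t : ℚ} (_ : t = p - 1 / 2) (_ : l + p = 0), _ := fun l p t ht hp =>
    borcherdsSum_natCast_of_rel hX hY (ε := -κ) l ht
      (c := fun j => (-((p : ℂ) - 1 / 2)) * P.form u v - P.form u v * j)
      fun j hj => by
        rw [mul_smul_comm, smul_mul_assoc, smul_comm (-κ), ← smul_sub, R.mode_mul_mode,
          if_pos (by lia), smul_smul]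
        congr 1
        push_cast
        ring
  have h0' : ∀ (l : ℕ) (p : ℂ), 2 ≤ l → (∑ j ∈ Finset.range (l + 1), (-1 : ℂ) ^ j *
      (l.choose j : ℂ) * ((-(p - 1 / 2)) * P.form u v - P.form u v * j)) = 0 := fun l p hl => by
    have h1 := alternating_sum_choose (l := l) (by lia)
    have h2 := alternating_sum_choose_mul hl
    simp only [mul_sub, Finset.sum_sub_distrib, ← Finset.sum_mul, h1, zero_mul]
    simp only [mul_comm (P.form u v), ← mul_assoc, ← Finset.sum_mul, h2]
    simp
  rw [twProd_eq fun j hj => by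
    have h := h0 (j - 1) (p := 1 - j) (t := 1 - 1 / 2 - j) (by push_cast; ring) (by lia)
    rw [h0' _ _ (by lia), zero_smul] at h
    rw [← h]
    congr 1
    lia]
  have h1 := h0 0 (p := 0) (t := 1 - 3 / 2) (by norm_num) (by norm_num)
  have h2 := h0 1 (p := -1) (t := 1 - 5 / 2) (by norm_num) (by norm_num)
  simp only [Nat.cast_zero, Nat.cast_one, zero_add, pow_zero,
    Nat.choose_self, one_mul, Finset.sum_range_succ, Nat.choose_zero_right] at h1 h2
  rw [show (-1 : ℤ) + 1 = 0 by lia, show (-1 : ℤ) + 2 = 1 by lia, h1, h2]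
  have h3 := isPtSum_borcherdsSum_neg_one hX hY (R.exists_mode_apply_eq_zero u)
    (fun w => by
      obtain ⟨N, hN⟩ := R.exists_mode_apply_eq_zero v w
      exact ⟨N + 1, fun n hn => by simp [hN (n - 1) (by lia)]⟩)
    (-κ) (p := 1) (t := 1 - 1 / 2) (by norm_num)
  convert h3 using 1
  · funext j
    rw [mul_smul_comm, smul_mul_assoc, show (1 : ℤ) + j - 1 = j by ring,
      show (1 : ℤ) - 1 - j - 1 = -1 - j by ring]
    push_cast
    module
  · push_cast
    module

end FockRep

/-! ### Commutators of the zero modes with the modes -/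

theorem sum_range_ite_intCast {M : Type*} [AddCommGroup M] (F : ℤ → M) (k : ℤ) {N : ℕ}
    (h : k < N) : ∑ j ∈ Finset.range N, (if (j : ℤ) = k then F j else 0) =
      if 0 ≤ k then F k else 0 := by
  split_ifs with h0
  · lift k to ℕ using h0
    rw [Finset.sum_eq_single k (fun j _ hj => if_neg (by exact_mod_cast hj))
      (fun hk => absurd (Finset.mem_range.2 (by exact_mod_cast h)) hk), if_pos rfl]
  · exact Finset.sum_eq_zero fun j _ => if_neg (by lia)

namespace FockRep

variable {κ : ℂ} {V : Type*} [AddCommGroup V] [Module ℂ V] {P : PolarizedSpace κ V}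
  {M : Type*} [AddCommGroup M] [Module ℂ M] (R : FockRep P M)

/-- Moving v(n) past two modes costs the sign κ² = 1. Hence quadratic expressions have ordinary
commutators with modes, linear in the modes, for both statistics. -/
theorem quadratic_comm (hκ : κ * κ = 1) (x y v : V) (p q n : ℤ) (w : M) :
    R.mode p x (R.mode q y (R.mode n v w)) = R.mode n v (R.mode p x (R.mode q y w))
      + (if q + n = 0 then P.form y v else 0) • R.mode p x w
      - (κ * if p + n = 0 then P.form x v else 0) • R.mode q y w := by
  rw [R.mode_mode y v, map_sub, map_smul, map_smul, R.mode_mode x v p n (R.mode q y w)]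
  linear_combination (norm := module) (hκ • R.mode n v (R.mode p x (R.mode q y w)))

/-- Termwise, x(n) contracts with a summand for at most four values of j, so the commutator
collapses to the two modes u(n) and v(n). -/
theorem current_comm (hκ : κ * κ = 1) {u v : V} {T : Module.End ℂ M}
    (h : IsPtSum (fun j => R.mode (-j) u * R.mode j v
      - κ • (R.mode (-1 - j) v * R.mode (j + 1) u)) T) (n : ℤ) (x : V) (w : M) :
    T (R.mode n x w) = R.mode n x (T w)
      + (P.form v x • R.mode n u w - (κ * P.form u x) • R.mode n v w) := by
  -- One N at which both partial sums have stabilized, and large enough to include every index where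
  -- a contraction with x(n) occurs.
  obtain ⟨N, ⟨h1, h2⟩, hN⟩ :=
    (((h (R.mode n x w)).and (h w)).and (Filter.eventually_gt_atTop (n.natAbs))).exists
  have key : ∀ j : ℕ, (R.mode (-j) u * R.mode j v
      - κ • (R.mode (-1 - j) v * R.mode (j + 1) u)) (R.mode n x w) =
      R.mode n x ((R.mode (-j) u * R.mode j v
        - κ • (R.mode (-1 - j) v * R.mode (j + 1) u)) w)
      + ((if (j : ℤ) = -n then P.form v x • R.mode (-j) u w else 0)
        - (if (j : ℤ) = n then (κ * P.form u x) • R.mode j v w else 0)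
        - (if (j : ℤ) = -n - 1 then (κ * P.form u x) • R.mode (-1 - j) v w else 0)
        + (if (j : ℤ) = n - 1 then P.form v x • R.mode (j + 1) u w else 0)) := by
    intro j
    simp only [LinearMap.sub_apply, LinearMap.smul_apply, Module.End.mul_apply, map_sub, map_smul]
    rw [R.quadratic_comm hκ u v x (-j) j, R.quadratic_comm hκ v u x (-1 - j) (j + 1)]
    simp only [show ((j : ℤ) + n = 0 ↔ (j : ℤ) = -n) by lia, show (-(j : ℤ) + n = 0 ↔ (j : ℤ) = n) by lia,
      show ((j : ℤ) + 1 + n = 0 ↔ (j : ℤ) = -n - 1) by lia,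
      show (-1 - (j : ℤ) + n = 0 ↔ (j : ℤ) = n - 1) by lia]
    have e (c : ℂ) : κ * (κ * c) = c := by rw [← mul_assoc, hκ, one_mul]
    split_ifs <;> simp only [smul_add, smul_sub, smul_smul, e, mul_zero, zero_smul, smul_zero] <;>
      abel
  rw [h1, h2, Finset.sum_congr rfl fun j _ => key j, Finset.sum_add_distrib, map_sum]
  congr 1
  rw [Finset.sum_add_distrib, Finset.sum_sub_distrib, Finset.sum_sub_distrib,
    sum_range_ite_intCast (fun j => P.form v x • R.mode (-j) u w) (-n) (by lia),
    sum_range_ite_intCast (fun j => (κ * P.form u x) • R.mode j v w) n (by lia),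
    sum_range_ite_intCast (fun j => (κ * P.form u x) • R.mode (-1 - j) v w) (-n - 1) (by lia),
    sum_range_ite_intCast (fun j => P.form v x • R.mode (j + 1) u w) (n - 1) (by lia)]
  rw [show -1 - (-n - 1) = n by ring, neg_neg, sub_add_cancel]
  -- The u-terms need n ≤ 0 or n ≥ 1, and the v-terms n ≥ 0 or n ≤ -1; exactly one of each pair is
  -- present.
  split_ifs <;> first | lia | abel

/-- Only u(0)v(0) at j = 0 fails to annihilate the vacuum termwise, and it gives the contraction
⟨u,v⟩ because u(0) kills the vacuum. -/
theorem current_vac {u v : V} (hu : u ∈ P.pos) {T : Module.End ℂ M}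
    (h : IsPtSum (fun j => R.mode (-j) u * R.mode j v
      - κ • (R.mode (-1 - j) v * R.mode (j + 1) u)) T) : T R.vac = P.form u v • R.vac := by
  obtain ⟨N, h1, hN⟩ := ((h R.vac).and (Filter.eventually_gt_atTop 0)).exists
  rw [h1, Finset.sum_eq_single_of_mem 0 (Finset.mem_range.2 hN)]
  · simp only [LinearMap.sub_apply, LinearMap.smul_apply, Module.End.mul_apply, Nat.cast_zero]
    rw [R.mode_mode, neg_zero, R.mode_vac (Or.inr ⟨rfl, hu⟩), R.mode_vac (Or.inl (by lia))]
    simp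
  · intro j _ hj
    simp only [LinearMap.sub_apply, LinearMap.smul_apply, Module.End.mul_apply]
    rw [R.mode_vac (Or.inl (by lia)), R.mode_vac (Or.inl (by lia))]
    simp

/-- The summands of the zero mode of the conformal vector of a dual pair, up to a constant. -/
def virasoroTerm (u v : V) (j : ℕ) : Module.End ℂ M :=
  (1 / 2 : ℂ) • (((j + 1 : ℂ) • (R.mode (-1 - j) u * R.mode (1 + j) v
          + κ • (R.mode (-1 - j) v * R.mode (j + 1) u))
        - (1 / 2 : ℂ) • (R.mode (-j) u * R.mode j v - κ • (R.mode (-1 - j) v * R.mode (j + 1) u)))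
      - (-(j + 1 / 2 : ℂ)) • (R.mode (-j) u * R.mode j v
          + κ • (R.mode (-1 - j) v * R.mode (j + 1) u)))

/-- The first two families are shifts of each other and add up to k u(-k)v(k) for k ≥ 1. Together
with κ k v(-k)u(k) this is the usual energy operator. -/
theorem virasoroTerm_apply (u v : V) (j : ℕ) (w : M) : R.virasoroTerm u v j w =
    ((j + 1 : ℂ) / 2) • R.mode (-1 - j) u (R.mode (1 + j) v w)
      + ((j : ℂ) / 2) • R.mode (-j) u (R.mode j v w)
      + (κ * (j + 1)) • R.mode (-1 - j) v (R.mode (j + 1) u w) := by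
  simp only [virasoroTerm, LinearMap.sub_apply, LinearMap.smul_apply, Module.End.mul_apply,
    LinearMap.add_apply]
  module

theorem virasoro_comm (hκ : κ * κ = 1) {u v : V} {T : Module.End ℂ M}
    (h : IsPtSum (R.virasoroTerm u v) T) (n : ℤ) (x : V) (w : M) :
    T (R.mode n x w) = R.mode n x (T w)
      + (-(n : ℂ)) • (P.form v x • R.mode n u w + (κ * P.form u x) • R.mode n v w) := by
  obtain ⟨N, ⟨h1, h2⟩, hN⟩ :=
    (((h (R.mode n x w)).and (h w)).and (Filter.eventually_gt_atTop (n.natAbs))).exists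
  have key : ∀ j : ℕ, R.virasoroTerm u v j (R.mode n x w) =
      R.mode n x (R.virasoroTerm u v j w)
      + ((if (j : ℤ) = -n - 1 then ((((j : ℤ) : ℂ) + 1) / 2 * P.form v x) • R.mode (-1 - j) u w
            else 0)
        - (if (j : ℤ) = n - 1 then ((((j : ℤ) : ℂ) + 1) / 2 * (κ * P.form u x)) •
            R.mode (1 + j) v w else 0)
        + (if (j : ℤ) = -n then (((j : ℤ) : ℂ) / 2 * P.form v x) • R.mode (-j) u w else 0)
        - (if (j : ℤ) = n then (((j : ℤ) : ℂ) / 2 * (κ * P.form u x)) • R.mode j v w else 0)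
        + (if (j : ℤ) = -n - 1 then ((((j : ℤ) : ℂ) + 1) * (κ * P.form u x)) • R.mode (-1 - j) v w
            else 0)
        - (if (j : ℤ) = n - 1 then ((((j : ℤ) : ℂ) + 1) * P.form v x) • R.mode (j + 1) u w
            else 0)) := by
    intro j
    simp only [virasoroTerm_apply, map_add, map_smul]
    rw [R.quadratic_comm hκ u v x (-1 - j) (1 + j), R.quadratic_comm hκ u v x (-j) j,
      R.quadratic_comm hκ v u x (-1 - j) (j + 1)]
    simp only [show ((j : ℤ) + n = 0 ↔ (j : ℤ) = -n) by lia, show (-(j : ℤ) + n = 0 ↔ (j : ℤ) = n) by lia,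
      show ((j : ℤ) + 1 + n = 0 ↔ (j : ℤ) = -n - 1) by lia,
      show (1 + (j : ℤ) + n = 0 ↔ (j : ℤ) = -n - 1) by lia,
      show (-1 - (j : ℤ) + n = 0 ↔ (j : ℤ) = n - 1) by lia]
    have e (c d : ℂ) : (κ * d) * (κ * c) = d * c := by linear_combination d * c * hκ
    have e' (c d : ℂ) : (κ * d) * c = d * (κ * c) := by ring
    split_ifs <;> simp only [smul_add, smul_sub, smul_smul, e, mul_zero, zero_smul, smul_zero,
      Int.cast_natCast] <;> (try simp only [e']) <;> abel
  rw [h1, h2, Finset.sum_congr rfl fun j _ => key j, Finset.sum_add_distrib, map_sum]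
  congr 1
  rw [Finset.sum_sub_distrib, Finset.sum_add_distrib, Finset.sum_sub_distrib,
    Finset.sum_add_distrib, Finset.sum_sub_distrib,
    sum_range_ite_intCast (fun j => (((j : ℂ) + 1) / 2 * P.form v x) • R.mode (-1 - j) u w)
      (-n - 1) (by lia),
    sum_range_ite_intCast (fun j => (((j : ℂ) + 1) / 2 * (κ * P.form u x)) • R.mode (1 + j) v w)
      (n - 1) (by lia),
    sum_range_ite_intCast (fun j => ((j : ℂ) / 2 * P.form v x) • R.mode (-j) u w) (-n) (by lia),
    sum_range_ite_intCast (fun j => ((j : ℂ) / 2 * (κ * P.form u x)) • R.mode j v w) n (by lia),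
    sum_range_ite_intCast (fun j => (((j : ℂ) + 1) * (κ * P.form u x)) • R.mode (-1 - j) v w)
      (-n - 1) (by lia),
    sum_range_ite_intCast (fun j => (((j : ℂ) + 1) * P.form v x) • R.mode (j + 1) u w)
      (n - 1) (by lia)]
  rw [show -1 - (-n - 1) = n by ring, show 1 + (n - 1) = n by ring, neg_neg, sub_add_cancel]
  -- For n ≠ 0 three of the six terms remain, two halves for u and a full term for v or the reverse;
  -- at n = 0 the remaining coefficients are zero.
  rcases lt_trichotomy n 0 with h0 | rfl | h0
  · rw [if_pos (by lia), if_neg (by lia), if_pos (by lia), if_neg (by lia), if_pos (by lia),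
      if_neg (by lia)]
    push_cast
    module
  · simp
  · rw [if_neg (by lia), if_pos (by lia), if_neg (by lia), if_pos (by lia), if_neg (by lia),
      if_pos (by lia)]
    push_cast
    module

/-- Every summand ends in a positive mode, except for u(0)v(0), whose coefficient j/2 is zero. -/
theorem virasoro_vac {u v : V} {T : Module.End ℂ M}
    (h : IsPtSum (R.virasoroTerm u v) T) : T R.vac = 0 := by
  obtain ⟨N, h1⟩ := (h R.vac).exists
  rw [h1, Finset.sum_eq_zero]
  intro j _
  rw [virasoroTerm_apply, R.mode_vac (n := 1 + j) (Or.inl (by lia)),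
    R.mode_vac (n := j + 1) (Or.inl (by lia))]
  rcases Nat.eq_zero_or_pos j with rfl | hj
  · simp
  · rw [R.mode_vac (n := j) (Or.inl (by lia))]
    simp

end FockRep

/-! ### Expansion in dual bases and the charge involution -/

namespace DualBases

variable {κ : ℂ} {V : Type*} [AddCommGroup V] [Module ℂ V] {P : PolarizedSpace κ V}
  {ι : Type} [DecidableEq ι] (D : DualBases P ι)

theorem form_pos_neg (i j : ι) :
    P.form (D.pos i : V) (D.neg j : V) = κ * if j = i then 1 else 0 := by
  rw [P.symm, D.pairing]

variable [Fintype ι]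

/-- The involution of `V` that is `1` on `V⁺` and `-1` on `V⁻`. -/
def charge : V →ₗ[ℂ] V :=
  ∑ i, ((P.form (D.neg i : V)).smulRight (D.pos i : V)
    - κ • (P.form (D.pos i : V)).smulRight (D.neg i : V))

theorem charge_apply (x : V) : D.charge x = ∑ i, (P.form (D.neg i : V) x • (D.pos i : V)
    - (κ * P.form (D.pos i : V) x) • (D.neg i : V)) := by
  simp [charge, smul_smul]

theorem charge_pos (u : P.pos) : D.charge (u : V) = u := by
  have h1 := congrArg (fun w : P.pos => (w : V)) (sum_pos D u)
  simp only [Submodule.coe_sum, Submodule.coe_smul] at h1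
  rw [charge_apply, Finset.sum_sub_distrib, h1]
  simp [P.pos_isotropic _ (D.pos _).2 _ u.2]

theorem sum_neg (hκ : κ * κ = 1) (u : P.neg) :
    ∑ i, (κ * P.form (D.pos i : V) (u : V)) • D.neg i = u := by
  conv_rhs => rw [← D.neg.sum_repr u]
  refine Finset.sum_congr rfl fun i _ => ?_
  congr 1
  have h := congrArg (fun w : P.neg => P.form (D.pos i : V) (w : V)) (D.neg.sum_repr u)
  simp only [Submodule.coe_sum, Submodule.coe_smul, map_sum, map_smul, D.form_pos_neg] at h
  rw [← h]
  simp only [smul_eq_mul, mul_ite, mul_one, mul_zero, Finset.sum_ite_eq', Finset.mem_univ, if_true]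
  linear_combination (D.neg.repr u i) * hκ

theorem charge_neg (hκ : κ * κ = 1) (u : P.neg) : D.charge (u : V) = -u := by
  have h1 := congrArg (fun w : P.neg => (w : V)) (D.sum_neg hκ u)
  simp only [Submodule.coe_sum, Submodule.coe_smul] at h1
  rw [charge_apply, Finset.sum_sub_distrib, h1]
  simp [P.neg_isotropic _ (D.neg _).2 _ u.2]

theorem exists_add (P : PolarizedSpace κ V) (x : V) :
    ∃ (u : P.pos) (v : P.neg), x = (u : V) + (v : V) := by
  have hw : x ∈ P.pos ⊔ P.neg := by rw [P.isCompl.sup_eq_top]; trivial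
  obtain ⟨a, ha, b, hb, rfl⟩ := Submodule.mem_sup.1 hw
  exact ⟨⟨a, ha⟩, ⟨b, hb⟩, rfl⟩

theorem sum_form_smul (hκ : κ * κ = 1) (x : V) : ∑ i, (P.form (D.neg i : V) x • (D.pos i : V)
    + (κ * P.form (D.pos i : V) x) • (D.neg i : V)) = x := by
  obtain ⟨u, v, rfl⟩ := exists_add P x
  have h1 := congrArg (fun w : P.pos => (w : V)) (sum_pos D u)
  have h2 := congrArg (fun w : P.neg => (w : V)) (D.sum_neg hκ v)
  simp only [Submodule.coe_sum, Submodule.coe_smul] at h1 h2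
  rw [Finset.sum_add_distrib]
  simp only [map_add, P.pos_isotropic _ (D.pos _).2 _ u.2, P.neg_isotropic _ (D.neg _).2 _ v.2,
    zero_add, add_zero, h1, h2]

end DualBases

/-! ### Summation over dual pairs: vacuum values and commutators -/

namespace FockRep

variable {κ : ℂ} {V : Type*} [AddCommGroup V] [Module ℂ V] {P : PolarizedSpace κ V}
  {M : Type*} [AddCommGroup M] [Module ℂ M] (R : FockRep P M)
  {ι : Type} [Fintype ι] [DecidableEq ι] (D : DualBases P ι)

/-- Each pair contributes ⟨v⁺,v⁻⟩ - ⟨v⁺,v⁻⟩/2 = κ/2: the normally ordered value minus the twisted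
correction. -/
theorem sum_current_vac {T : ι → Module.End ℂ M} (h : ∀ i, IsPtSum
    (fun j => R.mode (-j) (D.pos i : V) * R.mode j (D.neg i : V)
      - κ • (R.mode (-1 - j) (D.neg i : V) * R.mode (j + 1) (D.pos i : V)))
    (T i + (P.form (D.pos i : V) (D.neg i : V) / 2) • 1)) :
    (∑ i, T i) R.vac = (κ * Fintype.card ι / 2) • R.vac := by
  have h1 : ∀ i, T i R.vac = (κ / 2) • R.vac := fun i => by
    have := R.current_vac (D.pos i).2 (h i)
    rw [D.form_pos_neg, if_pos rfl, mul_one] at this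
    simp only [LinearMap.add_apply, LinearMap.smul_apply, Module.End.one_apply] at this
    linear_combination (norm := module) this
  rw [LinearMap.sum_apply, Finset.sum_congr rfl fun i _ => h1 i, Finset.sum_const,
    Finset.card_univ, ← Nat.cast_smul_eq_nsmul ℂ, smul_smul]
  congr 1
  ring

theorem sum_current_comm (hκ : κ * κ = 1) {T : ι → Module.End ℂ M} (h : ∀ i, IsPtSum
    (fun j => R.mode (-j) (D.pos i : V) * R.mode j (D.neg i : V)
      - κ • (R.mode (-1 - j) (D.neg i : V) * R.mode (j + 1) (D.pos i : V)))
    (T i + (P.form (D.pos i : V) (D.neg i : V) / 2) • 1)) (n : ℤ) (x : V) (w : M) :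
    (∑ i, T i) (R.mode n x w) = R.mode n x ((∑ i, T i) w) + R.mode n (D.charge x) w := by
  have h1 : ∀ i, T i (R.mode n x w) = R.mode n x (T i w) + R.mode n
      (P.form (D.neg i : V) x • (D.pos i : V)
        - (κ * P.form (D.pos i : V) x) • (D.neg i : V)) w := fun i => by
    have := R.current_comm hκ (h i) n x w
    simp only [LinearMap.add_apply, LinearMap.smul_apply, Module.End.one_apply, map_add,
      map_smul] at this
    simp only [map_sub, map_smul, LinearMap.sub_apply, LinearMap.smul_apply]
    linear_combination (norm := module) this
  rw [LinearMap.sum_apply, LinearMap.sum_apply, Finset.sum_congr rfl fun i _ => h1 i,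
    Finset.sum_add_distrib, map_sum, D.charge_apply, map_sum, LinearMap.sum_apply]

/-- The corrections 3/8 and 1/8 combine to (3/8 - 1/8)/2 = 1/8, the ground state energy of a pair up
to the sign κ. -/
theorem isPtSum_virasoro {u v : V} {T₁ T₂ : Module.End ℂ M}
    (h₁ : IsPtSum (fun j => (j + 1 : ℂ) • (R.mode (-1 - j) u * R.mode (1 + j) v
          + κ • (R.mode (-1 - j) v * R.mode (j + 1) u))
        - (1 / 2 : ℂ) • (R.mode (-j) u * R.mode j v - κ • (R.mode (-1 - j) v * R.mode (j + 1) u)))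
      (T₁ - (3 * P.form u v / 8) • 1))
    (h₂ : IsPtSum (fun j => (-(j + 1 / 2 : ℂ)) • (R.mode (-j) u * R.mode j v
          + κ • (R.mode (-1 - j) v * R.mode (j + 1) u)))
      (T₂ - (P.form u v / 8) • 1)) :
    IsPtSum (R.virasoroTerm u v) ((1 / 2 : ℂ) • (T₁ - T₂) - (P.form u v / 8) • 1) := by
  have := (h₁.sub h₂).smul (1 / 2)
  rw [show (1 / 2 : ℂ) • (T₁ - T₂) - (P.form u v / 8) • (1 : Module.End ℂ M) = (1 / 2 : ℂ) •
    (T₁ - (3 * P.form u v / 8) • 1 - (T₂ - (P.form u v / 8) • 1)) by module]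
  exact this

theorem sum_virasoro_vac {T : ι → Module.End ℂ M} (h : ∀ i, IsPtSum
    (R.virasoroTerm (D.pos i : V) (D.neg i : V))
    ((1 / 2 : ℂ) • T i - (P.form (D.pos i : V) (D.neg i : V) / 8) • 1)) :
    ((1 / 2 : ℂ) • ∑ i, T i) R.vac = (κ * Fintype.card ι / 8) • R.vac := by
  have h1 : ∀ i, (1 / 2 : ℂ) • T i R.vac = (κ / 8) • R.vac := fun i => by
    have := R.virasoro_vac (h i)
    rw [D.form_pos_neg, if_pos rfl, mul_one] at this
    simp only [LinearMap.sub_apply, LinearMap.smul_apply, Module.End.one_apply] at this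
    linear_combination (norm := module) this
  rw [LinearMap.smul_apply, LinearMap.sum_apply, Finset.smul_sum,
    Finset.sum_congr rfl fun i _ => h1 i, Finset.sum_const,
    Finset.card_univ, ← Nat.cast_smul_eq_nsmul ℂ, smul_smul]
  congr 1
  ring

theorem sum_virasoro_comm (hκ : κ * κ = 1) {T : ι → Module.End ℂ M} (h : ∀ i, IsPtSum
    (R.virasoroTerm (D.pos i : V) (D.neg i : V))
    ((1 / 2 : ℂ) • T i - (P.form (D.pos i : V) (D.neg i : V) / 8) • 1))
    (n : ℤ) (x : V) (w : M) :
    ((1 / 2 : ℂ) • ∑ i, T i) (R.mode n x w) =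
      R.mode n x (((1 / 2 : ℂ) • ∑ i, T i) w) + R.mode n ((-(n : ℂ)) • x) w := by
  have h1 : ∀ i, (1 / 2 : ℂ) • T i (R.mode n x w) = R.mode n x ((1 / 2 : ℂ) • T i w)
      + (-(n : ℂ)) • R.mode n (P.form (D.neg i : V) x • (D.pos i : V)
        + (κ * P.form (D.pos i : V) x) • (D.neg i : V)) w := fun i => by
    have := R.virasoro_comm hκ (h i) n x w
    simp only [LinearMap.sub_apply, LinearMap.smul_apply, Module.End.one_apply, map_sub,
      map_smul] at this
    simp only [map_add, map_smul, LinearMap.add_apply, LinearMap.smul_apply]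
    linear_combination (norm := module) this
  rw [LinearMap.smul_apply, LinearMap.smul_apply, LinearMap.sum_apply, LinearMap.sum_apply,
    Finset.smul_sum, Finset.sum_congr rfl fun i _ => h1 i, Finset.sum_add_distrib,
    ← map_sum, ← Finset.smul_sum, ← Finset.smul_sum, ← LinearMap.sum_apply, ← LinearMap.sum_apply,
    ← map_sum (R.mode n), D.sum_form_smul hκ, map_smul (R.mode n), LinearMap.smul_apply]

end FockRep

/-! ### The operators `J0`, `L0` and `glAct` on modes and vacuum -/

section TwistedOperators

variable {κ : ℂ} {V : Type*} [AddCommGroup V] [Module ℂ V] (P : PolarizedSpace κ V)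

theorem genField_half (v : V) (m : ℤ) :
    genField P v ((m : ℚ) - 1 / 2) = (twFockRep P).mode m v := by
  have h : (m : ℚ) - 1 / 2 + 1 / 2 = m := by ring
  simp only [genField, h, Rat.den_intCast, if_true, Rat.num_intCast]
  rfl

theorem Ytw_generator (v : V) (m : ℤ) :
    Ytw P [(v, 0)] ((m : ℚ) - 1 / 2) = (twFockRep P).mode m v := by
  have h := twProd_idField_neg_one (genField_half P v) m
  have e : Ytw P [(v, 0)] ((m : ℚ) - 1 / 2) =
    twProd ((-κ) ^ 0) (-((0 : ℕ) : ℤ) - 1) (genField P v) idField ((m : ℚ) - 1 / 2) := rfl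
  rw [e, pow_zero]
  exact h

theorem Ytw_generator_deriv (v : V) (m : ℤ) :
    Ytw P [(v, 1)] ((m : ℚ) - 1 / 2) =
      (-((m : ℂ) - 1 / 2)) • (twFockRep P).mode (m - 1) v := by
  have h := twProd_idField_neg_two (genField_half P v) m
  have e : Ytw P [(v, 1)] ((m : ℚ) - 1 / 2) =
    twProd ((-κ) ^ 0) (-((1 : ℕ) : ℤ) - 1) (genField P v) idField ((m : ℚ) - 1 / 2) := rfl
  rw [e, pow_zero]
  exact h

variable {P} {ι : Type} [Fintype ι] [DecidableEq ι] (D : DualBases P ι)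

theorem isPtSum_Ytw_current (u v : V) : IsPtSum
    (fun j => (twFockRep P).mode (-j) u * (twFockRep P).mode j v
      - κ • ((twFockRep P).mode (-1 - j) v * (twFockRep P).mode (j + 1) u))
    (Ytw P [(u, 0), (v, 0)] 0 + (P.form u v / 2) • 1) := by
  have h := (twFockRep P).isPtSum_current (genField_half P u) (Ytw_generator P v)
  have e : Ytw P [(u, 0), (v, 0)] 0 =
    twProd ((-κ) ^ 1) (-((0 : ℕ) : ℤ) - 1) (genField P u) (Ytw P [(v, 0)]) 0 := rfl
  rw [e, pow_one]
  exact h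

theorem isPtSum_Ytw_virasoro (u v : V) : IsPtSum ((twFockRep P).virasoroTerm u v)
    ((1 / 2 : ℂ) • (Ytw P [(u, 1), (v, 0)] 1 - Ytw P [(u, 0), (v, 1)] 1)
      - (P.form u v / 8) • 1) := by
  have h1 := (twFockRep P).isPtSum_deriv_left (genField_half P u) (Ytw_generator P v)
  have h2 := (twFockRep P).isPtSum_deriv_right (genField_half P u) (Ytw_generator_deriv P v)
  have e1 : Ytw P [(u, 1), (v, 0)] 1 =
    twProd ((-κ) ^ 1) (-((1 : ℕ) : ℤ) - 1) (genField P u) (Ytw P [(v, 0)]) 1 := rfl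
  have e2 : Ytw P [(u, 0), (v, 1)] 1 =
    twProd ((-κ) ^ 1) (-((0 : ℕ) : ℤ) - 1) (genField P u) (Ytw P [(v, 1)]) 1 := rfl
  rw [e1, e2, pow_one]
  exact (twFockRep P).isPtSum_virasoro h1 h2

theorem J0_vac : J0 D (twFockRep P).vac = (κ * Fintype.card ι / 2) • (twFockRep P).vac :=
  (twFockRep P).sum_current_vac D fun _ => isPtSum_Ytw_current _ _

theorem J0_mode (hκ : κ * κ = 1) (n : ℤ) (x : V) (w : TwFock P) :
    J0 D ((twFockRep P).mode n x w) =
      (twFockRep P).mode n x (J0 D w) + (twFockRep P).mode n (D.charge x) w :=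
  (twFockRep P).sum_current_comm D hκ (fun _ => isPtSum_Ytw_current _ _) n x w

theorem L0_vac : L0 D (twFockRep P).vac = (κ * Fintype.card ι / 8) • (twFockRep P).vac :=
  (twFockRep P).sum_virasoro_vac D fun _ => isPtSum_Ytw_virasoro _ _

theorem L0_mode (hκ : κ * κ = 1) (n : ℤ) (x : V) (w : TwFock P) :
    L0 D ((twFockRep P).mode n x w) =
      (twFockRep P).mode n x (L0 D w) + (twFockRep P).mode n ((-(n : ℂ)) • x) w :=
  (twFockRep P).sum_virasoro_comm D hκ (fun _ => isPtSum_Ytw_virasoro _ _) n x w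

theorem glAct_vac (g : LinearMap.GeneralLinearGroup ℂ P.pos) :
    glAct D g (twFockRep P).vac = (twFockRep P).vac := by
  change (annihilators P).mkQ (algAct D g 1) = (annihilators P).mkQ 1
  rw [map_one]

theorem glAct_mode (g : LinearMap.GeneralLinearGroup ℂ P.pos) (n : ℤ) (x : V) (w : TwFock P) :
    glAct D g ((twFockRep P).mode n x w) = (twFockRep P).mode n (ext D g x) (glAct D g w) := by
  obtain ⟨a, rfl⟩ := Submodule.mkQ_surjective _ w
  change (annihilators P).mkQ (algAct D g (modeElt P n x * a)) =
    (annihilators P).mkQ (modeElt P n (ext D g x) * algAct D g a)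
  rw [map_mul, algAct_modeElt]

end TwistedOperators

/-! ### Ladder operators and monomial bases -/

/-- Joint eigenvectors of a family of operators with distinct characters are independent. -/
theorem linearIndependent_of_joint_eigenvector {M B X : Type*} [AddCommGroup M] [Module ℂ M]
    (N : X → Module.End ℂ M) (v : B → M) (e : B → X → ℂ) (he : Function.Injective e)
    (hN : ∀ x b, N x (v b) = e b x • v b) (hv : ∀ b, v b ≠ 0) : LinearIndependent ℂ v := by
  classical
  -- A product of factors N x - e t x, one for each t in F with x chosen to separate t from b₀,
  -- kills all of F but not v b₀.
  have sep : ∀ (b₀ : B) (F : Finset B), b₀ ∉ F → ∃ (Q : Module.End ℂ M) (q : B → ℂ),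
      (∀ b, Q (v b) = q b • v b) ∧ (∀ b ∈ F, q b = 0) ∧ q b₀ ≠ 0 := by
    intro b₀ F
    induction F using Finset.induction_on with
    | empty => exact fun _ => ⟨1, fun _ => 1, fun b => by simp, by simp, one_ne_zero⟩
    | insert t F ht ih =>
      intro hb
      rw [Finset.mem_insert, not_or] at hb
      obtain ⟨Q, q, h1, h2, h3⟩ := ih hb.2
      obtain ⟨x, hx⟩ := Function.ne_iff.1 (fun h => hb.1 (he h) : e b₀ ≠ e t)
      refine ⟨(N x - e t x • 1) * Q, fun b => (e b x - e t x) * q b, fun b => ?_, ?_, ?_⟩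
      · rw [Module.End.mul_apply, h1, map_smul, LinearMap.sub_apply, hN, LinearMap.smul_apply,
          Module.End.one_apply]
        module
      · intro b hb'
        rcases Finset.mem_insert.1 hb' with rfl | hb'
        · simp
        · simp [h2 b hb']
      · exact mul_ne_zero (sub_ne_zero.2 hx) h3
  rw [linearIndependent_iff']
  intro F a ha b₀ hb₀
  obtain ⟨Q, q, h1, h2, h3⟩ := sep b₀ (F.erase b₀) (Finset.notMem_erase _ _)
  have h := congrArg Q ha
  rw [map_sum, map_zero, Finset.sum_eq_single_of_mem b₀ hb₀ fun b hb hne => by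
    rw [map_smul, h1, h2 b (Finset.mem_erase.2 ⟨hne, hb⟩), zero_smul, smul_zero], map_smul, h1,
    smul_smul] at h
  exact ((smul_eq_zero.1 h).resolve_right (hv b₀) |> mul_eq_zero.1).resolve_right h3

/-- Creation operators `c x` and annihilation operators `d x` acting on a module that is generated
by a vacuum vector. -/
structure LadderRep (κ : ℂ) (X M : Type*) [DecidableEq X] [AddCommGroup M] [Module ℂ M] where
  c : X → Module.End ℂ M
  d : X → Module.End ℂ M
  vac : M
  c_c : ∀ x y w, c x (c y w) = -κ • c y (c x w)
  d_c : ∀ x y w, d x (c y w) = (if x = y then 1 else 0 : ℂ) • w - κ • c y (d x w)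
  d_vac : ∀ x, d x vac = 0
  vac_ne_zero : vac ≠ 0
  eq_top : ∀ S : Submodule ℂ M, vac ∈ S → (∀ x, ∀ w ∈ S, c x w ∈ S) → (∀ x, ∀ w ∈ S, d x w ∈ S) →
    S = ⊤

namespace LadderRep

variable {κ : ℂ} {X M : Type*} [DecidableEq X] [AddCommGroup M] [Module ℂ M]
  (A : LadderRep κ X M)

/-- The vector `c x₁ ⋯ c xₖ vac`. -/
def word : List X → M
  | [] => A.vac
  | x :: l => A.c x (word l)

theorem word_perm (hκ : κ = 1 ∨ κ = -1) {l l' : List X} (h : l.Perm l') :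
    ∃ ε : ℂ, (ε = 1 ∨ ε = -1) ∧ A.word l = ε • A.word l' := by
  induction h with
  | nil => exact ⟨1, Or.inl rfl, (one_smul _ _).symm⟩
  | cons x _ ih =>
    obtain ⟨ε, hε, h⟩ := ih
    exact ⟨ε, hε, by rw [word, word, h, map_smul]⟩
  | swap x y l => exact ⟨-κ, by rcases hκ with rfl | rfl <;> simp, A.c_c _ _ _⟩
  | trans _ _ ih₁ ih₂ =>
    obtain ⟨ε₁, h₁, e₁⟩ := ih₁
    obtain ⟨ε₂, h₂, e₂⟩ := ih₂
    refine ⟨ε₁ * ε₂, ?_, by rw [e₁, e₂, smul_smul]⟩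
    rcases h₁ with rfl | rfl <;> rcases h₂ with rfl | rfl <;> simp

/-- c x d x is a number operator: the factor κ² = 1 makes it commute past letters other than x, and
each letter x raises its eigenvalue by one. In the Clifford case a repeated letter makes the word
zero, so there is no contradiction. -/
theorem number_word (hκ : κ * κ = 1) (x : X) (l : List X) :
    A.c x (A.d x (A.word l)) = (l.count x : ℂ) • A.word l := by
  induction l with
  | nil => simp [word, A.d_vac]
  | cons y l ih =>
    have h : A.c x (A.d x (A.c y (A.word l))) =
        (if x = y then 1 else 0 : ℂ) • A.c x (A.word l) + A.c y (A.c x (A.d x (A.word l))) := by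
      rw [A.d_c, map_sub, map_smul, map_smul, A.c_c x y, smul_smul, mul_neg, hκ, neg_smul, one_smul,
        sub_neg_eq_add]
    rw [word, h, ih, map_smul, List.count_cons]
    by_cases hxy : x = y
    · subst hxy
      simp only [if_true, BEq.rfl]
      push_cast
      module
    · have : (y == x) = false := by simpa using Ne.symm hxy
      simp [hxy, this]

theorem annihilate_word (hκ : κ * κ = 1) (x : X) (l : List X) :
    A.d x (A.word (x :: l)) = (1 - κ * l.count x) • A.word l := by
  rw [word, A.d_c, if_pos rfl, A.number_word hκ]
  module

theorem word_ne_zero_of_neg (hκ : κ = -1) (l : List X) : A.word l ≠ 0 := by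
  subst hκ
  induction l with
  | nil => exact A.vac_ne_zero
  | cons x l ih =>
    intro h
    have h1 := A.annihilate_word (by norm_num) x l
    rw [h, map_zero] at h1
    refine ((smul_eq_zero.1 h1.symm).resolve_right ih |> fun h2 => ?_)
    have : ((1 + l.count x : ℕ) : ℂ) = 0 := by push_cast; linear_combination h2
    exact absurd (Nat.cast_eq_zero.1 this) (by lia)

/-- Removing a letter x multiplies by 1 plus the multiplicity of x in the rest, which is never zero
in characteristic zero. -/
theorem word_ne_zero_of_nodup (hκ : κ = 1) {l : List X} (hl : l.Nodup) : A.word l ≠ 0 := by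
  subst hκ
  induction l with
  | nil => exact A.vac_ne_zero
  | cons x l ih =>
    intro h
    have h1 := A.annihilate_word (by norm_num) x l
    rw [List.nodup_cons] at hl
    rw [h, map_zero, List.count_eq_zero_of_not_mem hl.1] at h1
    exact ih hl.2 (by simpa using h1.symm)

/-- As c x squares to zero, the number operator c x d x is idempotent; a multiplicity k on a nonzero
word satisfies k² = k. -/
theorem nodup_of_word_ne_zero (hκ : κ = 1) {l : List X} (hl : A.word l ≠ 0) : l.Nodup := by
  subst hκ
  rw [List.nodup_iff_count_le_one]
  intro x
  have hcc : ∀ w, A.c x (A.c x w) = 0 := fun w => by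
    have h := A.c_c x x w
    rw [neg_smul, one_smul] at h
    have h2 : (2 : ℂ) • A.c x (A.c x w) = 0 := by
      rw [two_smul]; nth_rewrite 1 [h]; exact neg_add_cancel _
    exact (smul_eq_zero.1 h2).resolve_left two_ne_zero
  have h1 := A.number_word (by norm_num) x l
  have h2 : A.c x (A.d x (A.c x (A.d x (A.word l)))) = A.c x (A.d x (A.word l)) := by
    rw [A.d_c, if_pos rfl, map_sub, one_smul, map_smul, hcc, smul_zero, sub_zero]
  rw [h1, map_smul, map_smul, h1, smul_smul] at h2
  have h3 : ((l.count x * l.count x : ℕ) : ℂ) = (l.count x : ℕ) := by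
    push_cast
    exact smul_left_injective ℂ hl h2
  have h4 : l.count x * l.count x = l.count x := by exact_mod_cast h3
  nlinarith [h4]

theorem span_word : Submodule.span ℂ (Set.range A.word) = ⊤ := by
  have hc : ∀ x, ∀ w ∈ Submodule.span ℂ (Set.range A.word),
      A.c x w ∈ Submodule.span ℂ (Set.range A.word) := fun x w hw => by
    induction hw using Submodule.span_induction with
    | mem _ h =>
      obtain ⟨l, rfl⟩ := h
      exact Submodule.subset_span ⟨x :: l, rfl⟩
    | zero => simp
    | add a b _ _ ha hb => rw [map_add]; exact add_mem ha hb
    | smul r a _ ha => rw [map_smul]; exact Submodule.smul_mem _ _ ha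
  refine A.eq_top _ (Submodule.subset_span ⟨[], rfl⟩) hc (fun x w hw => ?_)
  induction hw using Submodule.span_induction with
  | mem _ h =>
    obtain ⟨l, rfl⟩ := h
    induction l with
    | nil => rw [word, A.d_vac]; exact Submodule.zero_mem _
    | cons y l ih =>
      rw [word, A.d_c]
      exact sub_mem (Submodule.smul_mem _ _ (Submodule.subset_span ⟨l, rfl⟩))
        (Submodule.smul_mem _ _ (hc _ _ ih))
  | zero => simp
  | add a b _ _ ha hb => rw [map_add]; exact add_mem ha hb
  | smul r a _ ha => rw [map_smul]; exact Submodule.smul_mem _ _ ha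

section Diagonal

theorem word_eigen_add {T : Module.End ℂ M} {t : ℂ} {f : X → ℂ} (h0 : T A.vac = t • A.vac)
    (h : ∀ x w, T (A.c x w) = A.c x (T w) + f x • A.c x w) (l : List X) :
    T (A.word l) = (t + (l.map f).sum) • A.word l := by
  induction l with
  | nil => simpa [word] using h0
  | cons x l ih =>
    rw [word, h, ih, map_smul, List.map_cons, List.sum_cons]
    module

theorem word_eigen_mul {T : Module.End ℂ M} {f : X → ℂ} (h0 : T A.vac = A.vac)
    (h : ∀ x w, T (A.c x w) = f x • A.c x (T w)) (l : List X) :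
    T (A.word l) = (l.map f).prod • A.word l := by
  induction l with
  | nil => simpa [word] using h0
  | cons x l ih =>
    rw [word, h, ih, map_smul, List.map_cons, List.prod_cons, smul_smul]

end Diagonal

/-- The words indexed by multisets form a basis as soon as the index set hits exactly the
nonzero words. -/
def basisOfMultiset {B : Type*} (hκ : κ = 1 ∨ κ = -1) (m : B → Multiset X)
    (hm : Function.Injective m) (hne : ∀ b, A.word (m b).toList ≠ 0)
    (hsurj : ∀ l : List X, A.word l ≠ 0 → ∃ b, m b = l) : Module.Basis B ℂ M :=
  have hκ' : κ * κ = 1 := by rcases hκ with rfl | rfl <;> norm_num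
  Module.Basis.mk (v := fun b => A.word (m b).toList)
    -- The number operators read off all multiplicities, and these determine the multiset.
    (linearIndependent_of_joint_eigenvector (fun x => A.c x * A.d x) _
      (fun b x => ((m b).count x : ℂ))
      (fun b b' h => hm (Multiset.ext.2 fun x => Nat.cast_injective (congrFun h x)))
      (fun x b => by
        rw [Module.End.mul_apply, A.number_word hκ', ← Multiset.coe_count, Multiset.coe_toList])
      hne)
    (by
      rw [← A.span_word, Submodule.span_le]
      rintro _ ⟨l, rfl⟩
      by_cases hl : A.word l = 0
      · rw [hl]; exact Submodule.zero_mem _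
      · obtain ⟨b, hb⟩ := hsurj l hl
        have hp : l.Perm (m b).toList := by
          rw [← Multiset.coe_eq_coe, Multiset.coe_toList, hb]
        obtain ⟨ε, -, h⟩ := A.word_perm hκ hp
        rw [h]
        exact Submodule.smul_mem _ _ (Submodule.subset_span ⟨b, rfl⟩))

theorem basisOfMultiset_apply {B : Type*} (hκ : κ = 1 ∨ κ = -1) (m : B → Multiset X)
    (hm : Function.Injective m) (hne : ∀ b, A.word (m b).toList ≠ 0)
    (hsurj : ∀ l : List X, A.word l ≠ 0 → ∃ b, m b = l) (b : B) :
    A.basisOfMultiset hκ m hm hne hsurj b = A.word (m b).toList := by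
  rw [basisOfMultiset, Module.Basis.mk_apply]

/-- The basis of a bosonic Fock space. -/
def bosonBasis (A : LadderRep (-1) X M) : Module.Basis (Multiset X) ℂ M :=
  A.basisOfMultiset (Or.inr rfl) id Function.injective_id
    (fun _ => A.word_ne_zero_of_neg rfl _) (fun l _ => ⟨l, rfl⟩)

/-- The basis of a fermionic Fock space. -/
def fermionBasis (A : LadderRep 1 X M) : Module.Basis (Finset X) ℂ M :=
  A.basisOfMultiset (Or.inl rfl) Finset.val Finset.val_injective
    (fun S => A.word_ne_zero_of_nodup rfl S.nodup_toList)
    (fun l hl => ⟨⟨(l : Multiset X), A.nodup_of_word_ne_zero rfl hl⟩, rfl⟩)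

theorem bosonBasis_apply (A : LadderRep (-1) X M) (m : Multiset X) :
    A.bosonBasis m = A.word m.toList :=
  A.basisOfMultiset_apply _ _ _ _ _ _

theorem fermionBasis_apply (A : LadderRep 1 X M) (S : Finset X) :
    A.fermionBasis S = A.word S.toList :=
  A.basisOfMultiset_apply _ _ _ _ _ _

theorem bosonBasis_eigen_add (A : LadderRep (-1) X M) {T : Module.End ℂ M} {t : ℂ} {f : X → ℂ}
    (h0 : T A.vac = t • A.vac) (h : ∀ x w, T (A.c x w) = A.c x (T w) + f x • A.c x w)
    (m : Multiset X) : T (A.bosonBasis m) = (t + (m.map f).sum) • A.bosonBasis m := by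
  rw [bosonBasis_apply, A.word_eigen_add h0 h, Multiset.sum_map_toList]

theorem bosonBasis_eigen_mul (A : LadderRep (-1) X M) {T : Module.End ℂ M} {f : X → ℂ}
    (h0 : T A.vac = A.vac) (h : ∀ x w, T (A.c x w) = f x • A.c x (T w))
    (m : Multiset X) : T (A.bosonBasis m) = (m.map f).prod • A.bosonBasis m := by
  rw [bosonBasis_apply, A.word_eigen_mul h0 h, Multiset.prod_map_toList]

theorem fermionBasis_eigen_add (A : LadderRep 1 X M) {T : Module.End ℂ M} {t : ℂ} {f : X → ℂ}
    (h0 : T A.vac = t • A.vac) (h : ∀ x w, T (A.c x w) = A.c x (T w) + f x • A.c x w)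
    (S : Finset X) : T (A.fermionBasis S) = (t + ∑ x ∈ S, f x) • A.fermionBasis S := by
  rw [fermionBasis_apply, A.word_eigen_add h0 h, Finset.sum_map_toList]

theorem fermionBasis_eigen_mul (A : LadderRep 1 X M) {T : Module.End ℂ M} {f : X → ℂ}
    (h0 : T A.vac = A.vac) (h : ∀ x w, T (A.c x w) = f x • A.c x (T w))
    (S : Finset X) : T (A.fermionBasis S) = (∏ x ∈ S, f x) • A.fermionBasis S := by
  rw [fermionBasis_apply, A.word_eigen_mul h0 h, Finset.prod_map_toList]

end LadderRep

/-! ### Nonvanishing of the vacuum, from polynomial and exterior algebra models -/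

/-- The creation modes of the Fock space: `inl (i, k)` stands for `v_i⁺(-k-1)`, and `inr (i, k)`
for `v_i⁻(-k)`. -/
abbrev CreationMode (ι : Type) : Type := ι × ℕ ⊕ ι × ℕ

section Model

variable {κ : ℂ} {V : Type*} [AddCommGroup V] [Module ℂ V] {P : PolarizedSpace κ V}
  {ι : Type} [DecidableEq ι] (D : DualBases P ι)
  {N : Type*} [AddCommGroup N] [Module ℂ N] (C A : CreationMode ι → Module.End ℂ N)

/-- The operator of the mode `v_i⁺(n)` in terms of creation and annihilation operators. -/
def posOp (κ : ℂ) (n : ℤ) (i : ι) : Module.End ℂ N :=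
  if n < 0 then C (.inl (i, (-n - 1).toNat)) else κ • A (.inr (i, n.toNat))

/-- The operator of the mode `v_i⁻(n)` in terms of creation and annihilation operators. -/
def negOp (n : ℤ) (i : ι) : Module.End ℂ N :=
  if 0 < n then A (.inl (i, (n - 1).toNat)) else C (.inr (i, (-n).toNat))

variable {C A}

theorem posOp_posOp (hCC : ∀ x y, C x * C y = -κ • (C y * C x))
    (hAA : ∀ x y, A x * A y = -κ • (A y * A x)) 
    (hAC : ∀ x y, A x * C y = (if x = y then 1 else 0 : ℂ) • 1 - κ • (C y * A x))
    (hκ : κ * κ = 1) (m n : ℤ) (i j : ι) :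
    posOp C A κ m i * posOp C A κ n j + κ • (posOp C A κ n j * posOp C A κ m i) = 0 := by
  unfold posOp
  split_ifs
  · rw [hCC]; module
  · rw [smul_mul_assoc, mul_smul_comm, hAC, if_neg (by simp)]
    linear_combination (norm := module) (-hκ) • (κ • (C (.inl (i, (-m - 1).toNat)) * A (.inr (j, n.toNat))))
  · rw [smul_mul_assoc, mul_smul_comm, hAC, if_neg (by simp)]
    linear_combination (norm := module) (0 : ℂ) • hAA (.inr (j, n.toNat)) (.inr (j, n.toNat))
  · rw [smul_mul_assoc, mul_smul_comm, smul_mul_assoc, mul_smul_comm, hAA]; module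

theorem negOp_negOp (hCC : ∀ x y, C x * C y = -κ • (C y * C x))
    (hAA : ∀ x y, A x * A y = -κ • (A y * A x)) 
    (hAC : ∀ x y, A x * C y = (if x = y then 1 else 0 : ℂ) • 1 - κ • (C y * A x))
    (hκ : κ * κ = 1) (m n : ℤ) (i j : ι) :
    negOp C A m i * negOp C A n j + κ • (negOp C A n j * negOp C A m i) = 0 := by
  unfold negOp
  split_ifs
  · rw [hAA]; module
  · rw [hAC, if_neg (by simp)]; module
  · rw [hAC, if_neg (by simp)]
    linear_combination (norm := module) (-hκ) • (C (.inr (i, (-m).toNat)) * A (.inl (j, (n - 1).toNat)))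
  · rw [hCC]; module

theorem negOp_posOp (hCC : ∀ x y, C x * C y = -κ • (C y * C x))
    (hAA : ∀ x y, A x * A y = -κ • (A y * A x)) 
    (hAC : ∀ x y, A x * C y = (if x = y then 1 else 0 : ℂ) • 1 - κ • (C y * A x))
    (hκ : κ * κ = 1) (m n : ℤ) (i j : ι) :
    negOp C A m i * posOp C A κ n j + κ • (posOp C A κ n j * negOp C A m i) =
      (if m + n = 0 ∧ i = j then 1 else 0 : ℂ) • 1 := by
  unfold negOp posOp
  by_cases hm : 0 < m <;> by_cases hn : n < 0
  · rw [if_pos hm, if_pos hn, hAC]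
    have : ((.inl (i, (m - 1).toNat) : CreationMode ι) = .inl (j, (-n - 1).toNat)) ↔
        (m + n = 0 ∧ i = j) := by
      simp only [Sum.inl.injEq, Prod.mk.injEq]
      constructor <;> rintro ⟨h1, h2⟩ <;> constructor <;> first | assumption | lia
    simp only [this]
    module
  · rw [if_pos hm, if_neg hn, if_neg (by lia), mul_smul_comm, smul_mul_assoc, hAA]
    module
  · rw [if_neg hm, if_pos hn, if_neg (by lia), hCC]
    module
  · rw [if_neg hm, if_neg hn, mul_smul_comm, smul_mul_assoc, hAC]
    have : ((.inr (j, n.toNat) : CreationMode ι) = .inr (i, (-m).toNat)) ↔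
        (m + n = 0 ∧ i = j) := by
      simp only [Sum.inr.injEq, Prod.mk.injEq]
      constructor <;> rintro ⟨h1, h2⟩ <;> constructor <;> first | (symm; assumption) | lia
    simp only [this]
    linear_combination (norm := module) 
      hκ • ((if m + n = 0 ∧ i = j then 1 else 0 : ℂ) • (1 : Module.End ℂ N))
      - hκ • (κ • (C (.inr (i, (-m).toNat)) * A (.inr (j, n.toNat))))

variable [Fintype ι]

/-- The linear extension of `posOp` and `negOp` to all modes. -/
def modelMode (D : DualBases P ι) (C A : CreationMode ι → Module.End ℂ N) (n : ℤ) :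
    V →ₗ[ℂ] Module.End ℂ N :=
  ∑ i, ((P.form (D.neg i : V)).smulRight (posOp C A κ n i)
    + κ • (P.form (D.pos i : V)).smulRight (negOp C A n i))

theorem modelMode_apply (n : ℤ) (x : V) : modelMode D C A n x =
    ∑ i, (P.form (D.neg i : V) x • posOp C A κ n i
      + (κ * P.form (D.pos i : V) x) • negOp C A n i) := by
  simp [modelMode, smul_smul]

theorem modelMode_pos (n : ℤ) (i : ι) : modelMode D C A n (D.pos i : V) = posOp C A κ n i := by
  simp [modelMode_apply, D.pairing, P.pos_isotropic _ (D.pos _).2 _ (D.pos i).2]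

theorem modelMode_neg (hκ : κ * κ = 1) (n : ℤ) (i : ι) :
    modelMode D C A n (D.neg i : V) = negOp C A n i := by
  simp [modelMode_apply, D.form_pos_neg, P.neg_isotropic _ (D.neg _).2 _ (D.neg i).2, hκ]

/-- The vectors `v_i⁺` and `v_i⁻` together span `V`. -/
theorem span_bases (hκ : κ * κ = 1) (S : Submodule ℂ V) (h1 : ∀ i, (D.pos i : V) ∈ S)
    (h2 : ∀ i, (D.neg i : V) ∈ S) (x : V) : x ∈ S := by
  rw [← D.sum_form_smul hκ x]
  exact Submodule.sum_mem _ fun i _ => add_mem (S.smul_mem _ (h1 i)) (S.smul_mem _ (h2 i))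

/-- Both sides are bilinear in u and v, so it suffices to check the four cases of basis vectors of
V⁺ and V⁻. -/
theorem modelMode_rel (hCC : ∀ x y, C x * C y = -κ • (C y * C x))
    (hAA : ∀ x y, A x * A y = -κ • (A y * A x)) 
    (hAC : ∀ x y, A x * C y = (if x = y then 1 else 0 : ℂ) • 1 - κ • (C y * A x))
    (hκ : κ * κ = 1) (u v : V) (m n : ℤ) :
    modelMode D C A m u * modelMode D C A n v + κ • (modelMode D C A n v * modelMode D C A m u) =
      (if m + n = 0 then P.form u v else 0) • 1 := by
  let δ : ℂ := if m + n = 0 then 1 else 0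
  have hδ : ∀ a b : V, (if m + n = 0 then P.form a b else 0) = δ * P.form a b := fun a b => by
    simp [δ]
  let F := modelMode D C A m
  let G := modelMode D C A n
  let e := LinearMap.toSpanSingleton ℂ (Module.End ℂ N) 1
  have h1 : ∀ a : V, (∀ i, F a * G (D.pos i : V) + κ • (G (D.pos i : V) * F a) =
        (δ * P.form a (D.pos i : V)) • 1) →
      (∀ i, F a * G (D.neg i : V) + κ • (G (D.neg i : V) * F a) =
        (δ * P.form a (D.neg i : V)) • 1) →
      ∀ b, F a * G b + κ • (G b * F a) = (δ * P.form a b) • 1 := fun a ha ha' =>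
    span_bases D hκ (LinearMap.eqLocus
      (LinearMap.mulLeft ℂ (F a) ∘ₗ G + κ • (LinearMap.mulRight ℂ (F a) ∘ₗ G))
      (e ∘ₗ (δ • P.form a))) ha ha'
  have h2 : ∀ b : V, (∀ i, F (D.pos i : V) * G b + κ • (G b * F (D.pos i : V)) =
        (δ * P.form (D.pos i : V) b) • 1) →
      (∀ i, F (D.neg i : V) * G b + κ • (G b * F (D.neg i : V)) =
        (δ * P.form (D.neg i : V) b) • 1) →
      ∀ a, F a * G b + κ • (G b * F a) = (δ * P.form a b) • 1 := fun b hb hb' =>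
    span_bases D hκ (LinearMap.eqLocus
      (LinearMap.mulRight ℂ (G b) ∘ₗ F + κ • (LinearMap.mulLeft ℂ (G b) ∘ₗ F))
      (e ∘ₗ (δ • P.form.flip b))) hb hb'
  rw [hδ]
  refine h2 v (fun i => h1 _ (fun j => ?_) (fun j => ?_) v)
    (fun i => h1 _ (fun j => ?_) (fun j => ?_) v) u
  · simp only [F, G, modelMode_pos]
    rw [posOp_posOp hCC hAA hAC hκ, P.pos_isotropic _ (D.pos i).2 _ (D.pos j).2, mul_zero, zero_smul]
  · simp only [F, G, modelMode_pos, modelMode_neg D hκ, D.form_pos_neg]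
    have h := congrArg (κ • ·) (negOp_posOp hCC hAA hAC hκ n m j i)
    simp only [smul_add, smul_smul, hκ, one_smul] at h
    rw [add_comm, h]
    by_cases h1 : m + n = 0 <;> by_cases h2 : j = i <;> simp [δ, h1, h2, add_comm n m]
  · simp only [F, G, modelMode_pos, modelMode_neg D hκ, D.pairing]
    rw [negOp_posOp hCC hAA hAC hκ]
    by_cases h1 : m + n = 0 <;> by_cases h2 : i = j <;> simp [δ, h1, h2]
  · simp only [F, G, modelMode_neg D hκ]
    rw [negOp_negOp hCC hAA hAC hκ, P.neg_isotropic _ (D.neg i).2 _ (D.neg j).2, mul_zero, zero_smul]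

/-- The action of the mode algebra on a model. -/
def modelHom (hCC : ∀ x y, C x * C y = -κ • (C y * C x))
    (hAA : ∀ x y, A x * A y = -κ • (A y * A x))
    (hAC : ∀ x y, A x * C y = (if x = y then 1 else 0 : ℂ) • 1 - κ • (C y * A x))
    (hκ : κ * κ = 1) : ModeAlgebra P →ₐ[ℂ] Module.End ℂ N :=
  RingQuot.liftAlgHom ℂ ⟨TensorAlgebra.lift ℂ (Finsupp.lsum ℂ (modelMode D C A)), by
    rintro _ _ ⟨u, v, m, n⟩
    have h := modelMode_rel D hCC hAA hAC hκ u v m n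
    simp only [map_add, map_mul, map_smul, TensorAlgebra.lift_ι_apply, Finsupp.lsum_single,
      Algebra.algebraMap_eq_smul_one, map_one]
    exact h⟩

theorem modelHom_modeElt (hCC : ∀ x y, C x * C y = -κ • (C y * C x))
    (hAA : ∀ x y, A x * A y = -κ • (A y * A x))
    (hAC : ∀ x y, A x * C y = (if x = y then 1 else 0 : ℂ) • 1 - κ • (C y * A x))
    (hκ : κ * κ = 1) (n : ℤ) (x : V) :
    modelHom D hCC hAA hAC hκ (modeElt P n x) = modelMode D C A n x := by
  simp [modelHom, modeElt]

/-- The vacuum is nonzero as soon as there is a model with a nonzero vector annihilated by all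
annihilation operators. -/
theorem vac_ne_zero_of_model (hCC : ∀ x y, C x * C y = -κ • (C y * C x))
    (hAA : ∀ x y, A x * A y = -κ • (A y * A x))
    (hAC : ∀ x y, A x * C y = (if x = y then 1 else 0 : ℂ) • 1 - κ • (C y * A x))
    (hκ : κ * κ = 1) {w : N} (hw : w ≠ 0) (hA : ∀ x, A x w = 0) (D : DualBases P ι) :
    vac P ≠ 0 := by
  intro h
  rw [vac, Submodule.mkQ_apply, Submodule.Quotient.mk_eq_zero] at h
  have key : ∀ a ∈ annihilators P, modelHom D hCC hAA hAC hκ a w = 0 := by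
    intro a ha
    induction ha using Submodule.span_induction with
    | mem x hx =>
      obtain ⟨n, v, hv, rfl⟩ := hx
      rw [modelHom_modeElt, modelMode_apply, LinearMap.sum_apply]
      refine Finset.sum_eq_zero fun i _ => ?_
      rw [LinearMap.add_apply, LinearMap.smul_apply, LinearMap.smul_apply]
      have h1 : posOp C A κ n i w = 0 := by
        rw [posOp, if_neg (by lia), LinearMap.smul_apply, hA, smul_zero]
      rcases hv with hv | ⟨rfl, hv⟩
      · rw [h1, negOp, if_pos hv, hA, smul_zero, smul_zero, add_zero]
      · rw [h1, P.pos_isotropic _ (D.pos i).2 _ hv, mul_zero, zero_smul, smul_zero, add_zero]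
    | zero => rw [map_zero, LinearMap.zero_apply]
    | add x y _ _ hx hy => rw [map_add, LinearMap.add_apply, hx, hy, add_zero]
    | smul r x _ hx => rw [smul_eq_mul, map_mul, Module.End.mul_apply, hx, map_zero]
  have := key 1 h
  rw [map_one, Module.End.one_apply] at this
  exact hw this

/-- The commutator of two derivations is a derivation, and this one vanishes on the variables. -/
theorem pderiv_comm {X : Type*} [DecidableEq X] (x y : X) (p : MvPolynomial X ℂ) :
    MvPolynomial.pderiv x (MvPolynomial.pderiv y p) =
      MvPolynomial.pderiv y (MvPolynomial.pderiv x p) := by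
  have h : ∀ D : Derivation ℂ (MvPolynomial X ℂ) (MvPolynomial X ℂ),
      D = ⁅(MvPolynomial.pderiv x : Derivation ℂ (MvPolynomial X ℂ) (MvPolynomial X ℂ)),
        (MvPolynomial.pderiv y : Derivation ℂ (MvPolynomial X ℂ) (MvPolynomial X ℂ))⁆ →
      D = 0 := by
    intro D hD
    refine MvPolynomial.derivation_ext fun i => ?_
    rw [hD, Derivation.commutator_apply]
    simp only [MvPolynomial.pderiv_X, Pi.single_apply]
    split_ifs <;> simp
  have h' := congrArg (fun T : Derivation ℂ (MvPolynomial X ℂ) (MvPolynomial X ℂ) => T p) (h _ rfl)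
  simp only [Derivation.commutator_apply] at h'
  exact sub_eq_zero.1 h'

/-- The model is the polynomial ring in the creation modes, with multiplication by variables and
partial derivatives; the vector is 1. -/
theorem vac_ne_zero_weyl {P : PolarizedSpace (-1) V} (D : DualBases P ι) : vac P ≠ 0 := by
  refine vac_ne_zero_of_model (N := MvPolynomial (CreationMode ι) ℂ)
    (C := fun x => LinearMap.mulLeft ℂ (MvPolynomial.X x))
    (A := fun x => (MvPolynomial.pderiv x).toLinearMap) (fun x y => ?_) (fun x y => ?_)
    (fun x y => ?_) (by norm_num) one_ne_zero (fun x => ?_) D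
  · refine LinearMap.ext fun w => ?_
    simp [mul_left_comm]
  · refine LinearMap.ext fun w => ?_
    simp only [Module.End.mul_apply, neg_neg, one_smul]
    exact pderiv_comm x y w
  · refine LinearMap.ext fun w => ?_
    simp [MvPolynomial.pderiv_X, Pi.single_apply]
    split_ifs <;> simp_all [add_comm]
  · simp

/-- The model is the exterior algebra, realized as the Clifford algebra of the zero form, with left
multiplication by generators and contraction by coordinates; the vector is 1. -/
theorem vac_ne_zero_clifford {P : PolarizedSpace 1 V} (D : DualBases P ι) : vac P ≠ 0 := by
  let Q : QuadraticForm ℂ (CreationMode ι →₀ ℂ) := 0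
  let e : CreationMode ι → CliffordAlgebra Q := fun x => CliffordAlgebra.ι Q (Finsupp.single x 1)
  refine vac_ne_zero_of_model (N := CliffordAlgebra Q)
    (C := fun x => LinearMap.mulLeft ℂ (e x))
    (A := fun x => CliffordAlgebra.contractLeft (Finsupp.lapply x)) (fun x y => ?_) (fun x y => ?_)
    (fun x y => ?_) (by norm_num) one_ne_zero (fun x => ?_) D
  · refine LinearMap.ext fun w => ?_
    have h := CliffordAlgebra.ι_mul_ι_add_swap (Q := Q) (Finsupp.single x 1) (Finsupp.single y 1)
    have h' : e x * e y = -(e y * e x) := by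
      rw [eq_neg_iff_add_eq_zero, h]
      simp [Q, QuadraticMap.polar]
    simp only [Module.End.mul_apply, LinearMap.mulLeft_apply, LinearMap.smul_apply, ← mul_assoc, h']
    simp
  · refine LinearMap.ext fun w => ?_
    simp only [Module.End.mul_apply, LinearMap.smul_apply, neg_smul, one_smul]
    exact CliffordAlgebra.contractLeft_comm (Q := Q) (Finsupp.lapply x) (Finsupp.lapply y) w
  · refine LinearMap.ext fun w => ?_
    simp only [Module.End.mul_apply, LinearMap.smul_apply, one_smul, LinearMap.sub_apply,
      LinearMap.mulLeft_apply, Module.End.one_apply, e, CliffordAlgebra.contractLeft_ι_mul,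
      Finsupp.lapply_apply, Finsupp.single_apply, eq_comm]
  · exact CliffordAlgebra.contractLeft_one _ _

end Model

/-! ### The Fock module as a ladder representation -/

section LadderOperators

variable {κ : ℂ} {V : Type*} [AddCommGroup V] [Module ℂ V] {P : PolarizedSpace κ V}
  {M : Type*} [AddCommGroup M] [Module ℂ M] {ι : Type} [Fintype ι] [DecidableEq ι]

/-- The creation and annihilation operators attached to dual bases. -/
def FockRep.ladder (R : FockRep P M) (D : DualBases P ι) (hκ : κ * κ = 1) (h0 : R.vac ≠ 0) :
    LadderRep κ (CreationMode ι) M where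
  c
    | .inl (i, k) => R.mode (-k - 1) (D.pos i)
    | .inr (i, k) => R.mode (-k) (D.neg i)
  d
    | .inl (i, k) => R.mode (k + 1) (D.neg i)
    -- Since ⟨v_i⁺, v_i⁻⟩ = κ, the factor κ normalizes the contraction with v_i⁻(-k) to 1.
    | .inr (i, k) => κ • R.mode k (D.pos i)
  vac := R.vac
  c_c := by
    rintro (⟨i, k⟩ | ⟨i, k⟩) (⟨j, l⟩ | ⟨j, l⟩) w
    · simp only [R.mode_mode (D.pos i : V), P.pos_isotropic _ (D.pos i).2 _ (D.pos j).2]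
      simp
    · simp only [R.mode_mode (D.pos i : V)]
      rw [if_neg (by lia)]
      simp
    · simp only [R.mode_mode (D.neg i : V)]
      rw [if_neg (by lia)]
      simp
    · simp only [R.mode_mode (D.neg i : V), P.neg_isotropic _ (D.neg i).2 _ (D.neg j).2]
      simp
  d_c := by
    rintro (⟨i, k⟩ | ⟨i, k⟩) (⟨j, l⟩ | ⟨j, l⟩) w
    · simp only [R.mode_mode (D.neg i : V), D.pairing, Sum.inl.injEq, Prod.mk.injEq]
      congr 2
      rw [← ite_and]
      exact if_congr ⟨fun h => ⟨h.2, by lia⟩, fun h => ⟨by lia, h.1⟩⟩ rfl rfl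
    · simp only [R.mode_mode (D.neg i : V), P.neg_isotropic _ (D.neg i).2 _ (D.neg j).2]
      simp
    · simp only [LinearMap.smul_apply, R.mode_mode (D.pos i : V),
        P.pos_isotropic _ (D.pos i).2 _ (D.pos j).2]
      simp
    · simp only [LinearMap.smul_apply, R.mode_mode (D.pos i : V), D.form_pos_neg, Sum.inr.injEq,
        Prod.mk.injEq, map_smul, smul_sub, smul_smul]
      congr 2
      by_cases h : i = j ∧ k = l
      · obtain ⟨rfl, rfl⟩ := h
        simp [hκ]
      · rw [if_neg h]
        by_cases h1 : j = i
        · rw [if_neg (by rintro h2; exact h ⟨h1.symm, by lia⟩), mul_zero]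
        · simp [h1]
  d_vac := by
    rintro (⟨i, k⟩ | ⟨i, k⟩)
    · exact R.mode_vac (Or.inl (by lia))
    · simp only [LinearMap.smul_apply]
      rw [R.mode_vac, smul_zero]
      rcases Nat.eq_zero_or_pos k with rfl | hk
      · exact Or.inr ⟨rfl, (D.pos i).2⟩
      · exact Or.inl (by lia)
  vac_ne_zero := h0
  eq_top := by
    intro S hS hc hd
    refine R.eq_top S hS fun n v w hw => ?_
    -- Up to the factor κ, every mode of a basis vector is a creation or an annihilation operator.
    refine span_bases D hκ (S.comap ((R.mode n).flip w)) (fun i => ?_) (fun i => ?_) v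
    · change R.mode n (D.pos i : V) w ∈ S
      rcases lt_or_ge n 0 with hn | hn
      · have := hc (.inl (i, (-n - 1).toNat)) w hw
        simp only at this
        rwa [show -((-n - 1).toNat : ℤ) - 1 = n by lia] at this
      · have := S.smul_mem κ (hd (.inr (i, n.toNat)) w hw)
        simp only [LinearMap.smul_apply, smul_smul, hκ, one_smul] at this
        rwa [show (n.toNat : ℤ) = n by lia] at this
    · change R.mode n (D.neg i : V) w ∈ S
      rcases lt_or_ge 0 n with hn | hn
      · have := hd (.inl (i, (n - 1).toNat)) w hw
        simp only at this
        rwa [show ((n - 1).toNat : ℤ) + 1 = n by lia] at this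
      · have := hc (.inr (i, (-n).toNat)) w hw
        simp only at this
        rwa [show -((-n).toNat : ℤ) = n by lia] at this

end LadderOperators

/-! ### Eigenbases for group elements and adapted dual bases -/

section Diagonalization

/-- An endomorphism of finite order of a complex vector space has an eigenbasis. -/
theorem exists_eigenbasis {W ι : Type*} [AddCommGroup W] [Module ℂ W] [Fintype ι]
    (b : Module.Basis ι ℂ W) (g : Module.End ℂ W) {n : ℕ} (hn : n ≠ 0) (hg : g ^ n = 1) :
    ∃ (b' : Module.Basis ι ℂ W) (ν : ι → ℂ), ∀ i, g (b' i) = ν i • b' i := by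
  have : FiniteDimensional ℂ W := Module.Finite.of_basis b
  have hs : g.IsSemisimple := by
    refine Module.End.isSemisimple_of_squarefree_aeval_eq_zero (p := Polynomial.X ^ n - 1) ?_ ?_
    · exact (Polynomial.X_pow_sub_one_separable_iff.2 (by exact_mod_cast hn)).squarefree
    · simp [hg]
  have htop := hs.iSup_eigenspace_eq_top
  let s : Set W := {x | ∃ ν : ℂ, g x = ν • x}
  have hspan : ⊤ ≤ Submodule.span ℂ s := by
    rw [← htop]
    refine iSup_le fun ν x hx => Submodule.subset_span ⟨ν, Module.End.mem_eigenspace_iff.1 hx⟩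
  let b₀ := Module.Basis.ofSpan hspan
  have h₀ : ∀ i, ∃ ν : ℂ, g (b₀ i) = ν • b₀ i := fun i =>
    Module.Basis.ofSpan_subset hspan ⟨i, rfl⟩
  let σ := b₀.indexEquiv b
  choose ν hν using h₀
  exact ⟨b₀.reindex σ, fun i => ν (σ.symm i), fun i => by simp [hν]⟩

theorem trace_eq_sum_of_eigenbasis {W ι : Type*} [AddCommGroup W] [Module ℂ W] [Fintype ι]
    (b : Module.Basis ι ℂ W) (g : Module.End ℂ W) (ν : ι → ℂ)
    (h : ∀ i, g (b i) = ν i • b i) : LinearMap.trace ℂ W g = ∑ i, ν i := by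
  classical
  rw [LinearMap.trace_eq_matrix_trace ℂ b, Matrix.trace]
  refine Finset.sum_congr rfl fun i _ => ?_
  simp [Matrix.diag_apply, LinearMap.toMatrix_apply, h]

theorem pow_apply_of_eigenvector {W : Type*} [AddCommGroup W] [Module ℂ W] {g : Module.End ℂ W}
    {ν : ℂ} {x : W} (h : g x = ν • x) (k : ℕ) : (g ^ k) x = ν ^ k • x := by
  induction k with
  | zero => simp
  | succ k ih => rw [pow_succ, Module.End.mul_apply, h, map_smul, ih, smul_smul, pow_succ']

end Diagonalization

namespace DualBases

variable {κ : ℂ} {V : Type*} [AddCommGroup V] [Module ℂ V] {P : PolarizedSpace κ V}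
  {ι : Type} [Fintype ι] [DecidableEq ι] (D : DualBases P ι)

/-- The identification of `V⁻` with the dual of `V⁺` given by the form. -/
def negEquivDual : P.neg ≃ₗ[ℂ] Module.Dual ℂ P.pos :=
  D.neg.equiv D.pos.dualBasis (Equiv.refl ι)

theorem negEquivDual_apply (x : P.neg) (u : P.pos) :
    D.negEquivDual x u = P.form (x : V) (u : V) := by
  have h : D.negEquivDual.toLinearMap =
      (P.form.compl₁₂ P.neg.subtype P.pos.subtype) := by
    refine D.neg.ext fun i => D.pos.ext fun j => ?_
    simp [negEquivDual, D.pairing, Finsupp.single_apply, eq_comm]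
  exact congrArg (fun f : P.neg →ₗ[ℂ] Module.Dual ℂ P.pos => f x u) h

/-- The dual bases with a prescribed basis of `V⁺`. -/
def ofPos (b : Module.Basis ι ℂ P.pos) : DualBases P ι where
  pos := b
  neg := b.dualBasis.map D.negEquivDual.symm
  pairing i j := by
    rw [← D.negEquivDual_apply]
    simp [Finsupp.single_apply, eq_comm]

/-- Invariance of the form gives ν_j ⟨g'v_i⁻, v_j⁺⟩ = δ_ij, and these pairings determine a vector of
V⁻. -/
theorem ext_neg_of_eigenbasis (hκ : κ * κ = 1) (D' : DualBases P ι)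
    {g : LinearMap.GeneralLinearGroup ℂ P.pos} {ν : ι → ℂ}
    (h : ∀ i, g.val (D'.pos i) = ν i • D'.pos i) (i : ι) :
    ext D g (D'.neg i : V) = (ν i)⁻¹ • (D'.neg i : V) := by
  have h1 : ∀ j, ν j * P.form (ext D g (D'.neg i : V)) (D'.pos j : V) =
      if i = j then 1 else 0 := fun j => by
    have := form_ext D g (D'.neg i : V) (D'.pos j : V)
    rw [ext_pos, h, Submodule.coe_smul, map_smul, D'.pairing] at this
    exact this
  have h2 := congrArg (fun w : P.neg => (w : V)) (D'.sum_neg hκ ⟨_, ext_neg_mem D g (D'.neg i)⟩)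
  simp only [Submodule.coe_sum, Submodule.coe_smul] at h2
  rw [← h2, Finset.sum_eq_single_of_mem i (Finset.mem_univ _)]
  · have := h1 i
    rw [if_pos rfl] at this
    rw [P.symm, ← mul_assoc, hκ, one_mul, eq_inv_of_mul_eq_one_right this]
  · intro j _ hj
    -- A zero eigenvalue would contradict the invertibility of g.
    have hν : ν j ≠ 0 := fun h0 => by
      have h3 := h j
      rw [h0, zero_smul] at h3
      have h4 : g⁻¹.val (g.val (D'.pos j)) = D'.pos j := by
        change (g⁻¹.val * g.val) _ = _
        rw [Units.inv_mul]
        rfl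
      rw [h3, map_zero] at h4
      exact D'.pos.ne_zero j h4.symm
    have := h1 j
    rw [if_neg hj.symm, mul_eq_zero] at this
    rw [P.symm, this.resolve_left hν, mul_zero, mul_zero, zero_smul]

end DualBases

/-- The charge of a creation mode. -/
def chargeWt {ι : Type} : CreationMode ι → ℤ := Sum.elim (fun _ => 1) (fun _ => -1)

/-- The conformal weight of a creation mode. -/
def levelWt {ι : Type} : CreationMode ι → ℕ := Sum.elim (fun p => p.2 + 1) (fun p => p.2)

/-- The eigenvalue of a diagonal element of `GL(V⁺)` on a creation mode. -/
def glWt {ι : Type} (ν : ι → ℂ) : CreationMode ι → ℂ :=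
  Sum.elim (fun p => ν p.1) (fun p => (ν p.1)⁻¹)

section Ladder

variable {κ : ℂ} {V : Type*} [AddCommGroup V] [Module ℂ V] {P : PolarizedSpace κ V}
  {M : Type*} [AddCommGroup M] [Module ℂ M] {ι : Type} [Fintype ι] [DecidableEq ι]
  (R : FockRep P M) (D : DualBases P ι) (hκ : κ * κ = 1) (h0 : R.vac ≠ 0) {T : Module.End ℂ M}

/-- The charge attached to `D` is ±1 on V^±, whatever the basis. Hence J(0), defined by `D`, stays
diagonal in the monomials of the bases `D'` adapted to a group element. -/
theorem FockRep.ladder_charge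
    (hT : ∀ n x w, T (R.mode n x w) = R.mode n x (T w) + R.mode n (D.charge x) w)
    (D' : DualBases P ι) (x : CreationMode ι) (w : M) :
    T ((R.ladder D' hκ h0).c x w) = (R.ladder D' hκ h0).c x (T w)
      + (chargeWt x : ℂ) • (R.ladder D' hκ h0).c x w := by
  rcases x with ⟨i, k⟩ | ⟨i, k⟩
  · change T (R.mode _ (D'.pos i : V) w) = _
    rw [hT, D.charge_pos]
    simp [chargeWt, ladder]
  · change T (R.mode _ (D'.neg i : V) w) = _
    rw [hT, D.charge_neg hκ]
    simp [chargeWt, ladder]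

theorem FockRep.ladder_level
    (hT : ∀ (n : ℤ) x w, T (R.mode n x w) = R.mode n x (T w) + R.mode n ((-(n : ℂ)) • x) w)
    (x : CreationMode ι) (w : M) :
    T ((R.ladder D hκ h0).c x w) = (R.ladder D hκ h0).c x (T w)
      + (levelWt x : ℂ) • (R.ladder D hκ h0).c x w := by
  rcases x with ⟨i, k⟩ | ⟨i, k⟩
  · change T (R.mode _ (D.pos i : V) w) = R.mode _ (D.pos i : V) (T w) + _ • R.mode _ (D.pos i : V) w
    rw [hT, map_smul, LinearMap.smul_apply]
    congr 2
    simp [levelWt, add_comm]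
  · change T (R.mode _ (D.neg i : V) w) = R.mode _ (D.neg i : V) (T w) + _ • R.mode _ (D.neg i : V) w
    rw [hT, map_smul, LinearMap.smul_apply]
    congr 2
    simp [levelWt]

theorem FockRep.ladder_glAct {g : LinearMap.GeneralLinearGroup ℂ P.pos}
    (hT : ∀ (n : ℤ) x w, T (R.mode n x w) = R.mode n (ext D g x) (T w))
    (D' : DualBases P ι) {ν : ι → ℂ} (hν : ∀ i, g.val (D'.pos i) = ν i • D'.pos i)
    (x : CreationMode ι) (w : M) :
    T ((R.ladder D' hκ h0).c x w) = glWt ν x • (R.ladder D' hκ h0).c x (T w) := by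
  rcases x with ⟨i, k⟩ | ⟨i, k⟩
  · change T (R.mode _ (D'.pos i : V) w) = ν i • R.mode _ (D'.pos i : V) (T w)
    rw [hT, ext_pos, hν, Submodule.coe_smul, map_smul, LinearMap.smul_apply]
  · change T (R.mode _ (D'.neg i : V) w) = (ν i)⁻¹ • R.mode _ (D'.neg i : V) (T w)
    rw [hT, D.ext_neg_of_eigenbasis hκ D' hν, map_smul, LinearMap.smul_apply]

end Ladder

/-! ### Eigenvalues on the Clifford and Weyl bases -/

section FockBases

variable {V : Type*} [AddCommGroup V] [Module ℂ V] {ι : Type} [Fintype ι] [DecidableEq ι]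

/-- The basis of the Clifford module attached to dual bases. -/
def cliffordBasis {P : PolarizedSpace 1 V} (D : DualBases P ι) :
    Module.Basis (Finset (CreationMode ι)) ℂ (TwFock P) :=
  ((twFockRep P).ladder D (by norm_num) (vac_ne_zero_clifford D)).fermionBasis

/-- The basis of the Weyl module attached to dual bases. -/
def weylBasis {P : PolarizedSpace (-1) V} (D : DualBases P ι) :
    Module.Basis (Multiset (CreationMode ι)) ℂ (TwFock P) :=
  ((twFockRep P).ladder D (by norm_num) (vac_ne_zero_weyl D)).bosonBasis

variable {P : PolarizedSpace 1 V} (D D' : DualBases P ι)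

theorem J0_cliffordBasis (S : Finset (CreationMode ι)) : J0 D (cliffordBasis D' S) =
    ((1 * Fintype.card ι / 2 : ℂ) + ∑ x ∈ S, (chargeWt x : ℂ)) • cliffordBasis D' S :=
  LadderRep.fermionBasis_eigen_add _ (J0_vac D)
    ((twFockRep P).ladder_charge D (by norm_num) (vac_ne_zero_clifford D')
      (J0_mode D (by norm_num)) D') S

theorem L0_cliffordBasis (S : Finset (CreationMode ι)) : L0 D (cliffordBasis D' S) =
    ((1 * Fintype.card ι / 8 : ℂ) + ∑ x ∈ S, (levelWt x : ℂ)) • cliffordBasis D' S :=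
  LadderRep.fermionBasis_eigen_add _ (L0_vac D)
    ((twFockRep P).ladder_level D' (by norm_num) (vac_ne_zero_clifford D')
      (L0_mode D (by norm_num))) S

theorem glAct_cliffordBasis {g : LinearMap.GeneralLinearGroup ℂ P.pos} {ν : ι → ℂ}
    (hν : ∀ i, g.val (D'.pos i) = ν i • D'.pos i) (S : Finset (CreationMode ι)) :
    glAct D g (cliffordBasis D' S) = (∏ x ∈ S, glWt ν x) • cliffordBasis D' S :=
  LadderRep.fermionBasis_eigen_mul _ (glAct_vac D g)
    ((twFockRep P).ladder_glAct D (by norm_num) (vac_ne_zero_clifford D')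
      (glAct_mode D g) D' hν) S

end FockBases

section FockBases

variable {V : Type*} [AddCommGroup V] [Module ℂ V] {ι : Type} [Fintype ι] [DecidableEq ι]
  {P : PolarizedSpace (-1) V} (D D' : DualBases P ι)

theorem J0_weylBasis (m : Multiset (CreationMode ι)) : J0 D (weylBasis D' m) =
    ((-1 * Fintype.card ι / 2 : ℂ) + (m.map fun x => (chargeWt x : ℂ)).sum) • weylBasis D' m :=
  LadderRep.bosonBasis_eigen_add _ (J0_vac D)
    ((twFockRep P).ladder_charge D (by norm_num) (vac_ne_zero_weyl D')
      (J0_mode D (by norm_num)) D') m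

theorem L0_weylBasis (m : Multiset (CreationMode ι)) : L0 D (weylBasis D' m) =
    ((-1 * Fintype.card ι / 8 : ℂ) + (m.map fun x => (levelWt x : ℂ)).sum) • weylBasis D' m :=
  LadderRep.bosonBasis_eigen_add _ (L0_vac D)
    ((twFockRep P).ladder_level D' (by norm_num) (vac_ne_zero_weyl D')
      (L0_mode D (by norm_num))) m

theorem glAct_weylBasis {g : LinearMap.GeneralLinearGroup ℂ P.pos} {ν : ι → ℂ}
    (hν : ∀ i, g.val (D'.pos i) = ν i • D'.pos i) (m : Multiset (CreationMode ι)) :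
    glAct D g (weylBasis D' m) = (m.map (glWt ν)).prod • weylBasis D' m :=
  LadderRep.bosonBasis_eigen_mul _ (glAct_vac D g)
    ((twFockRep P).ladder_glAct D (by norm_num) (vac_ne_zero_weyl D')
      (glAct_mode D g) D' hν) m

end FockBases

/-! ### Traces on joint eigenspaces of diagonal operators -/

section GradedTrace

variable {M B : Type*} [AddCommGroup M] [Module ℂ M] (b : Module.Basis B ℂ M)

theorem repr_apply_of_eigenbasis {T : Module.End ℂ M} {t : B → ℂ}
    (h : ∀ i, T (b i) = t i • b i) (x : M) (i : B) : b.repr (T x) i = t i * b.repr x i := by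
  have e : b.coord i ∘ₗ T = t i • b.coord i := b.ext fun k => by
    by_cases hk : k = i
    · subst hk; simp [h]
    · simp [h, hk]
  exact congrArg (fun f : M →ₗ[ℂ] ℂ => f x) e

/-- A diagonal operator scales each coordinate separately, so a joint eigenvector is supported on
the basis vectors of its own bidegree. -/
theorem eigenspace_inf_eq_span {J L : Module.End ℂ M} {j : B → ℤ} {l : B → ℕ}
    (hJ : ∀ i, J (b i) = (j i : ℂ) • b i) (hL : ∀ i, L (b i) = (l i : ℂ) • b i) (m : ℤ) (n : ℕ) :
    J.eigenspace (m : ℂ) ⊓ L.eigenspace (n : ℂ) =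
      Submodule.span ℂ (Set.range fun i : {i // j i = m ∧ l i = n} => b i) := by
  have hr : (Set.range fun i : {i // j i = m ∧ l i = n} => b i) =
      b '' {i | j i = m ∧ l i = n} := by
    ext x; simp
  rw [hr]
  ext x
  rw [Submodule.mem_inf, Module.End.mem_eigenspace_iff, Module.End.mem_eigenspace_iff,
    b.mem_span_image]
  constructor
  · rintro ⟨h1, h2⟩ i hi
    have hi : b.repr x i ≠ 0 := by simpa using hi
    have e1 := repr_apply_of_eigenbasis b hJ x i
    have e2 := repr_apply_of_eigenbasis b hL x i
    rw [h1, map_smul, Finsupp.smul_apply, smul_eq_mul] at e1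
    rw [h2, map_smul, Finsupp.smul_apply, smul_eq_mul] at e2
    exact ⟨by exact_mod_cast (mul_right_cancel₀ hi e1).symm,
      by exact_mod_cast (mul_right_cancel₀ hi e2).symm⟩
  · intro h
    constructor <;> refine b.repr.injective (Finsupp.ext fun i => ?_)
    · rw [repr_apply_of_eigenbasis b hJ, map_smul, Finsupp.smul_apply, smul_eq_mul]
      by_cases hi : b.repr x i = 0
      · rw [hi]; simp
      · rw [(h (by simpa using hi)).1]
    · rw [repr_apply_of_eigenbasis b hL, map_smul, Finsupp.smul_apply, smul_eq_mul]
      by_cases hi : b.repr x i = 0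
      · rw [hi]; simp
      · rw [(h (by simpa using hi)).2]

theorem iSup_eigenspace_inf_eq_top {J L : Module.End ℂ M} {j : B → ℤ} {l : B → ℕ}
    (hJ : ∀ i, J (b i) = (j i : ℂ) • b i) (hL : ∀ i, L (b i) = (l i : ℂ) • b i) :
    ⨆ p : ℤ × ℕ, J.eigenspace (p.1 : ℂ) ⊓ L.eigenspace (p.2 : ℂ) = ⊤ := by
  rw [eq_top_iff, ← b.span_eq, Submodule.span_le]
  rintro _ ⟨i, rfl⟩
  refine Submodule.mem_iSup_of_mem (j i, l i) ⟨?_, ?_⟩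
  · exact Module.End.mem_eigenspace_iff.2 (hJ i)
  · exact Module.End.mem_eigenspace_iff.2 (hL i)

theorem mem_span_of_eigenbasis {T : Module.End ℂ M} {ι : Type*} {v : ι → M} {t : ι → ℂ}
    (hT : ∀ i, T (v i) = t i • v i) : ∀ x ∈ Submodule.span ℂ (Set.range v),
      T x ∈ Submodule.span ℂ (Set.range v) := by
  intro x hx
  induction hx using Submodule.span_induction with
  | mem _ h =>
    obtain ⟨i, rfl⟩ := h
    rw [hT]
    exact Submodule.smul_mem _ _ (Submodule.subset_span ⟨i, rfl⟩)
  | zero => simp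
  | add x y _ _ hx hy => rw [map_add]; exact add_mem hx hy
  | smul c x _ hx => rw [map_smul]; exact Submodule.smul_mem _ _ hx

theorem traceOn_span {T : Module.End ℂ M} {ι : Type*} [Fintype ι] {v : ι → M}
    (hv : LinearIndependent ℂ v) {t : ι → ℂ} (hT : ∀ i, T (v i) = t i • v i) :
    traceOn (Submodule.span ℂ (Set.range v)) T = ∑ i, t i := by
  rw [traceOn, dif_pos (mem_span_of_eigenbasis hT)]
  refine trace_eq_sum_of_eigenbasis (Module.Basis.span hv) _ t fun i => ?_
  ext
  simp [Module.Basis.span_apply, hT]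

theorem traceOn_eigenspace_inf {J L T : Module.End ℂ M} {j : B → ℤ} {l : B → ℕ} {t : B → ℂ}
    (hJ : ∀ i, J (b i) = (j i : ℂ) • b i) (hL : ∀ i, L (b i) = (l i : ℂ) • b i)
    (hT : ∀ i, T (b i) = t i • b i) (m : ℤ) (n : ℕ) [Fintype {i // j i = m ∧ l i = n}] :
    traceOn (J.eigenspace (m : ℂ) ⊓ L.eigenspace (n : ℂ)) T =
      ∑ i : {i // j i = m ∧ l i = n}, t i := by
  rw [eigenspace_inf_eq_span b hJ hL]
  exact traceOn_span (b.linearIndependent.comp _ Subtype.val_injective) fun i => hT i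

theorem finiteDimensional_eigenspace_inf {J L : Module.End ℂ M} {j : B → ℤ} {l : B → ℕ}
    (hJ : ∀ i, J (b i) = (j i : ℂ) • b i) (hL : ∀ i, L (b i) = (l i : ℂ) • b i) (m : ℤ) (n : ℕ)
    (hfin : {i | j i = m ∧ l i = n}.Finite) :
    FiniteDimensional ℂ ↥(J.eigenspace (m : ℂ) ⊓ L.eigenspace (n : ℂ)) := by
  rw [eigenspace_inf_eq_span b hJ hL]
  have : Finite {i // j i = m ∧ l i = n} := hfin
  exact FiniteDimensional.span_of_finite ℂ (Set.finite_range _)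

theorem eigenspace_inf_mapsTo {J L T : Module.End ℂ M} {j : B → ℤ} {l : B → ℕ} {t : B → ℂ}
    (hJ : ∀ i, J (b i) = (j i : ℂ) • b i) (hL : ∀ i, L (b i) = (l i : ℂ) • b i)
    (hT : ∀ i, T (b i) = t i • b i) (m : ℤ) (n : ℕ) :
    ∀ x ∈ J.eigenspace (m : ℂ) ⊓ L.eigenspace (n : ℂ),
      T x ∈ J.eigenspace (m : ℂ) ⊓ L.eigenspace (n : ℂ) := by
  rw [eigenspace_inf_eq_span b hJ hL]
  exact mem_span_of_eigenbasis fun i => hT i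

/-- The generating series of traces is the sum over the basis, grouped by bidegree. -/
theorem hasSum_traceOn {J L T : Module.End ℂ M} {j : B → ℤ} {l : B → ℕ} {t : B → ℂ}
    (hJ : ∀ i, J (b i) = (j i : ℂ) • b i) (hL : ∀ i, L (b i) = (l i : ℂ) • b i)
    (hT : ∀ i, T (b i) = t i • b i) (hfin : ∀ m n, {i | j i = m ∧ l i = n}.Finite) {y q s : ℂ}
    (hs : HasSum (fun i => t i * y ^ j i * q ^ l i) s) :
    HasSum (fun p : ℤ × ℕ => traceOn (J.eigenspace (p.1 : ℂ) ⊓ L.eigenspace (p.2 : ℂ)) T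
      * y ^ p.1 * q ^ p.2) s := by
  let e := Equiv.sigmaFiberEquiv fun i => (j i, l i)
  have hs' := (e.hasSum_iff (f := fun i => t i * y ^ j i * q ^ l i)).2 hs
  refine hs'.sigma fun p => ?_
  have : Finite {i // j i = p.1 ∧ l i = p.2} := hfin p.1 p.2
  let e' : {i // j i = p.1 ∧ l i = p.2} ≃ {i // (j i, l i) = p} :=
    Equiv.subtypeEquivRight fun i => by rw [Prod.ext_iff]
  rw [← e'.hasSum_iff]
  have := Fintype.ofFinite {i // j i = p.1 ∧ l i = p.2}
  rw [traceOn_eigenspace_inf b hJ hL hT, Finset.sum_mul, Finset.sum_mul]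
  convert hasSum_fintype _ using 1
  refine Finset.sum_congr rfl fun i _ => ?_
  change _ = t i * y ^ j i * q ^ l i
  rw [i.2.1, i.2.2]

theorem traceOn_eq_zero_of_empty {J L T : Module.End ℂ M} {j : B → ℤ} {l : B → ℕ} {t : B → ℂ}
    (hJ : ∀ i, J (b i) = (j i : ℂ) • b i) (hL : ∀ i, L (b i) = (l i : ℂ) • b i)
    (hT : ∀ i, T (b i) = t i • b i) {m : ℤ} {n : ℕ} (h : ∀ i, l i = n → j i ≠ m) :
    traceOn (J.eigenspace (m : ℂ) ⊓ L.eigenspace (n : ℂ)) T = 0 := by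
  have : IsEmpty {i // j i = m ∧ l i = n} := ⟨fun i => h i i.2.2 i.2.1⟩
  let _ := Fintype.ofIsEmpty (α := {i // j i = m ∧ l i = n})
  rw [traceOn_eigenspace_inf b hJ hL hT, Finset.univ_eq_empty, Finset.sum_empty]

end GradedTrace

/-! ### Sums over finite sets and multisets as infinite products -/

section FockSums

open Filter Topology

variable {X : Type*}

theorem hasSum_finset_prod {f : X → ℂ} (hf : Summable fun x => ‖f x‖) :
    HasSum (fun S : Finset X => ∏ x ∈ S, f x) (∏' x, (1 + f x)) := by
  have h := (summable_finsetProd_of_summable_norm hf).hasSum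
  rwa [← (hasProd_one_add_of_hasSum_prod h).tprod_eq] at h

theorem hasSum_mul_complex {α β : Type*} {f : α → ℂ} {g : β → ℂ} {a b : ℂ} (hf : HasSum f a)
    (hg : HasSum g b) : HasSum (fun p : α × β => f p.1 * g p.2) (a * b) :=
  hf.mul hg (summable_mul_of_summable_norm hf.summable.norm hg.summable.norm)

/-- Multisets supported in `insert a F` as pairs of a multiplicity and a multiset in `F`. -/
def multisetInsertEquiv [DecidableEq X] {a : X} {F : Finset X} (ha : a ∉ F) :
    {m : Multiset X // ∀ x ∈ m, x ∈ insert a F} ≃ ℕ × {m : Multiset X // ∀ x ∈ m, x ∈ F} where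
  toFun m := (m.1.count a, ⟨m.1.filter (· ≠ a), fun x hx => by
    rw [Multiset.mem_filter] at hx
    exact Finset.mem_of_mem_insert_of_ne (m.2 x hx.1) hx.2⟩)
  invFun p := ⟨Multiset.replicate p.1 a + p.2.1, fun x hx => by
    rcases Multiset.mem_add.1 hx with h | h
    · rw [Multiset.eq_of_mem_replicate h]; exact Finset.mem_insert_self _ _
    · exact Finset.mem_insert_of_mem (p.2.2 x h)⟩
  left_inv m := by
    ext1
    simp only
    rw [← Multiset.filter_eq' m.1 a, Multiset.filter_add_not]
  right_inv p := by
    obtain ⟨k, m, hm⟩ := p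
    have h1 : a ∉ m := fun h => ha (hm a h)
    refine Prod.ext ?_ (Subtype.ext ?_)
    · simp [Multiset.count_eq_zero_of_notMem h1]
    · simp only [Multiset.filter_add]
      rw [Multiset.filter_eq_nil.2 (fun x hx => by simp [Multiset.eq_of_mem_replicate hx]),
        Multiset.filter_eq_self.2 (fun x hx => ne_of_mem_of_not_mem hx h1), zero_add]

/-- Induction on F: the multiplicity of a new letter is free and contributes one geometric series.
-/
theorem hasSum_multiset_prod_subtype (F : Finset X) {f : X → ℂ} (hf : ∀ x, ‖f x‖ < 1) :
    HasSum (fun m : {m : Multiset X // ∀ x ∈ m, x ∈ F} => (m.1.map f).prod)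
      (∏ x ∈ F, (1 - f x)⁻¹) := by
  classical
  induction F using Finset.induction_on with
  | empty =>
    have h0 : ∀ m : {m : Multiset X // ∀ x ∈ m, x ∈ (∅ : Finset X)}, m.1 = 0 := fun m =>
      Multiset.eq_zero_of_forall_notMem fun x hx => by simpa using m.2 x hx
    have : Unique {m : Multiset X // ∀ x ∈ m, x ∈ (∅ : Finset X)} :=
      { default := ⟨0, by simp⟩
        uniq := fun m => Subtype.ext (h0 m) }
    convert hasSum_unique (fun m : {m : Multiset X // ∀ x ∈ m, x ∈ (∅ : Finset X)} =>
      (m.1.map f).prod) using 1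
    rw [h0, Finset.prod_empty]
    simp
  | insert a F ha ih =>
    rw [Finset.prod_insert ha, ← (multisetInsertEquiv ha).symm.hasSum_iff]
    convert hasSum_mul_complex (hasSum_geometric_of_norm_lt_one (hf a)) ih using 1
    funext p
    simp [multisetInsertEquiv]

/-- Any finite family of multisets uses finitely many letters, so its sum is at most a finite
product of geometric series. A uniform exponential bound on these products suffices. -/
theorem summable_multiset_prod {f : X → ℝ} {ρ : ℝ} (hρ : ρ < 1) (h0 : ∀ x, 0 ≤ f x)
    (hf : Summable f) (hfρ : ∀ x, f x ≤ ρ) :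
    Summable fun m : Multiset X => (m.map f).prod := by
  classical
  have hnn : ∀ m : Multiset X, 0 ≤ (m.map f).prod := fun m =>
    Multiset.prod_nonneg fun a ha => by
      obtain ⟨x, -, rfl⟩ := Multiset.mem_map.1 ha
      exact h0 x
  refine summable_of_sum_le hnn (c := Real.exp (∑' x, f x / (1 - ρ))) fun s => ?_
  let F : Finset X := s.biUnion Multiset.toFinset
  have hF := hasSum_multiset_prod_subtype F (f := fun x => (f x : ℂ)) fun x => by
    rw [Complex.norm_real, Real.norm_of_nonneg (h0 x)]
    exact (hfρ x).trans_lt hρ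
  have hF' : HasSum (fun m : {m : Multiset X // ∀ x ∈ m, x ∈ F} => (m.1.map f).prod)
      (∏ x ∈ F, (1 - f x)⁻¹) := by
    have : (fun m : {m : Multiset X // ∀ x ∈ m, x ∈ F} => (m.1.map fun x => (f x : ℂ)).prod) =
        fun m => (((m.1.map f).prod : ℝ) : ℂ) := by
      funext m
      have := (map_multiset_prod Complex.ofRealHom (m.1.map f)).symm
      simpa using this
    rw [this] at hF
    have h2 : ∏ x ∈ F, (1 - (f x : ℂ))⁻¹ = ((∏ x ∈ F, (1 - f x)⁻¹ : ℝ) : ℂ) := by push_cast; rfl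
    rw [h2] at hF
    exact Complex.hasSum_ofReal.1 hF
  have h1 : ∑ m ∈ s, (m.map f).prod ≤ ∏ x ∈ F, (1 - f x)⁻¹ := by
    have hmem : ∀ m ∈ s, ∀ x ∈ m, x ∈ F := fun m hm x hx =>
      Finset.mem_biUnion.2 ⟨m, hm, Multiset.mem_toFinset.2 hx⟩
    rw [← Finset.sum_subtype_of_mem (p := fun m : Multiset X => ∀ x ∈ m, x ∈ F) _ hmem]
    exact sum_le_hasSum _ (fun m _ => hnn m) hF'
  refine h1.trans ?_
  -- 1/(1 - f) = 1 + f/(1 - f) ≤ 1 + f/(1 - ρ) ≤ exp(f/(1 - ρ)).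
  have h2 : ∀ x, (1 - f x)⁻¹ ≤ Real.exp (f x / (1 - ρ)) := fun x => by
    have a1 : 0 < 1 - ρ := by linarith
    have a2 : 1 - ρ ≤ 1 - f x := by linarith [hfρ x]
    have a3 : (1 - f x)⁻¹ = f x / (1 - f x) + 1 := by field_simp [(a1.trans_le a2).ne']; ring
    rw [a3]
    exact (add_le_add_left (div_le_div_of_nonneg_left (h0 x) a1 a2) 1).trans (Real.add_one_le_exp _)
  calc ∏ x ∈ F, (1 - f x)⁻¹ ≤ ∏ x ∈ F, Real.exp (f x / (1 - ρ)) :=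
        Finset.prod_le_prod (fun x _ => inv_nonneg.2 (by linarith [hfρ x])) fun x _ => h2 x
    _ = Real.exp (∑ x ∈ F, f x / (1 - ρ)) := (Real.exp_sum _ _).symm
    _ ≤ _ := Real.exp_le_exp.2 ((hf.div_const _).sum_le_tsum F fun x _ =>
        div_nonneg (h0 x) (by linarith))

/-- The products over finite F are sums over the multisets supported in F. Dominated convergence,
with the absolute series as majorant, passes to the limit over F. -/
theorem hasSum_multiset_prod {f : X → ℂ} {ρ : ℝ} (hρ : ρ < 1) (hf : Summable fun x => ‖f x‖)
    (hfρ : ∀ x, ‖f x‖ ≤ ρ) :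
    HasSum (fun m : Multiset X => (m.map f).prod) (∏' x, (1 - f x))⁻¹ := by
  classical
  have hnorm : ∀ m : Multiset X, ‖(m.map f).prod‖ = (m.map fun x => ‖f x‖).prod := fun m => by
    have := map_multiset_prod (normHom : ℂ →*₀ ℝ) (m.map f)
    simpa using this
  have hsum := summable_multiset_prod hρ (fun x => norm_nonneg (f x)) hf hfρ
  have hsum' : Summable fun m : Multiset X => (m.map f).prod :=
    Summable.of_norm (by simpa only [hnorm] using hsum)
  have hprod : HasProd (fun x => (1 - f x)⁻¹) (∑' m : Multiset X, (m.map f).prod) := by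
    have key : ∀ F : Finset X, ∏ x ∈ F, (1 - f x)⁻¹ =
        ∑' m : Multiset X, if ∀ x ∈ m, x ∈ F then (m.map f).prod else 0 := fun F => by
      rw [← (hasSum_multiset_prod_subtype F fun x => (hfρ x).trans_lt hρ).tsum_eq]
      refine (tsum_subtype {m : Multiset X | ∀ x ∈ m, x ∈ F} fun m => (m.map f).prod).trans
        (tsum_congr fun m => ?_)
      by_cases h : ∀ x ∈ m, x ∈ F
      · rw [if_pos h, Set.indicator_of_mem (show m ∈ {m : Multiset X | ∀ x ∈ m, x ∈ F} from h)]
      · rw [if_neg h, Set.indicator_of_notMem (show m ∉ {m : Multiset X | ∀ x ∈ m, x ∈ F} from h)]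
    unfold HasProd
    simp only [key]
    refine tendsto_tsum_of_dominated_convergence hsum (fun m => ?_) (Eventually.of_forall fun F m => ?_)
    · refine tendsto_const_nhds.congr' ?_
      filter_upwards [eventually_ge_atTop m.toFinset] with F hF
      rw [if_pos fun x hx => hF (Multiset.mem_toFinset.2 hx)]
    · split_ifs
      · exact (hnorm m).le
      · rw [norm_zero, ← hnorm]; exact norm_nonneg _
  have hprod' : HasProd (fun x => 1 - f x) (∏' x, (1 - f x)) := by
    simpa [sub_eq_add_neg] using
      (multipliable_one_add_of_summable (f := fun x => -f x) (by simpa using hf)).hasProd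
  -- Multiplying with the convergent product of the 1 - f x gives the constant 1, which identifies
  -- the value as an inverse.
  have h1 := hprod.mul hprod'
  have h2 : (fun x => (1 - f x)⁻¹ * (1 - f x)) = fun _ => 1 := by
    funext x
    refine inv_mul_cancel₀ fun h => ?_
    have h3 := (hfρ x).trans_lt hρ
    rw [← sub_eq_zero.1 h, norm_one] at h3
    exact lt_irrefl _ h3
  rw [h2] at h1
  rw [← eq_inv_of_mul_eq_one_left (h1.unique hasProd_one)]
  exact hsum'.hasSum

end FockSums

/-! ### Generating functions of the individual Fock spaces -/

section GeneratingFunctions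

variable {ι : Type}

/-- The theta product `∏_{k ≥ 0} (1 - u⁻¹ q^k) (1 - u q^(k+1))`. -/
def thetaProd (q u : ℂ) : ℂ := ∏' k : ℕ, (1 - u⁻¹ * q ^ k) * (1 - u * q ^ (k + 1))

/-- The Euler product `∏_{k ≥ 1} (1 - q^k)`. -/
def eulerProd (q : ℂ) : ℂ := ∏' k : ℕ, (1 - q ^ (k + 1))

/-- The contribution of a creation operator to a twined character. -/
def modeWt (ν : ι → ℂ) (v q : ℂ) (x : CreationMode ι) : ℂ :=
  glWt ν x * v ^ chargeWt x * q ^ levelWt x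

theorem summable_norm_mul_pow (c : ℂ) {q : ℂ} (hq : ‖q‖ < 1) : Summable fun k : ℕ => ‖c * q ^ k‖ := by
  simp only [norm_mul, norm_pow]
  exact (summable_geometric_of_lt_one (norm_nonneg q) hq).mul_left _

theorem summable_norm_mul_pow_succ (c : ℂ) {q : ℂ} (hq : ‖q‖ < 1) :
    Summable fun k : ℕ => ‖c * q ^ (k + 1)‖ :=
  (summable_nat_add_iff (f := fun k => ‖c * q ^ k‖) 1).2 (summable_norm_mul_pow c hq)

theorem multipliable_one_sub {X : Type*} {f : X → ℂ} (hf : Summable fun x => ‖f x‖) :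
    Multipliable fun x => 1 - f x := by
  simpa [sub_eq_add_neg] using
    multipliable_one_add_of_summable (f := fun x => -f x) (by simpa using hf)

theorem thetaProd_eq_mul {q : ℂ} (hq : ‖q‖ < 1) (u : ℂ) :
    thetaProd q u = (∏' k : ℕ, (1 - u⁻¹ * q ^ k)) * ∏' k : ℕ, (1 - u * q ^ (k + 1)) :=
  (multipliable_one_sub (summable_norm_mul_pow _ hq)).tprod_mul
    (multipliable_one_sub (summable_norm_mul_pow_succ _ hq))

theorem summable_creationMode [Finite ι] {c : CreationMode ι → ℂ} {g : ι → ℂ} {g' : ι → ℂ} {q : ℂ}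
    (hq : ‖q‖ < 1) (h : ∀ i k, c (Sum.inl (i, k)) = g i * q ^ (k + 1))
    (h' : ∀ i k, c (Sum.inr (i, k)) = g' i * q ^ k) : Summable fun x => ‖c x‖ := by
  have key : ∀ d : ι → ℂ, Summable fun p : ι × ℕ => ‖d p.1 * q ^ p.2‖ := fun d => by
    simp only [norm_mul, norm_pow]
    exact Summable.mul_of_nonneg (f := fun i => ‖d i‖) (g := fun k : ℕ => ‖q‖ ^ k)
      (Summable.of_finite) (summable_geometric_of_lt_one (norm_nonneg q) hq)
      (fun i => norm_nonneg _) (fun k => pow_nonneg (norm_nonneg _) _)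
  refine Summable.sum _ ?_ ?_
  · refine (key fun i => g i * q).congr fun p => ?_
    simp only [Function.comp, h, pow_succ]
    ring_nf
  · exact (key g').congr fun p => by simp only [Function.comp, h']

theorem tprod_creationMode [Fintype ι] {c : CreationMode ι → ℂ} (hc : Summable fun x => ‖c x‖) :
    ∏' x, (1 - c x) = ∏ i, (∏' k : ℕ, (1 - c (Sum.inl (i, k)))) *
      ∏' k : ℕ, (1 - c (Sum.inr (i, k))) := by
  have hl : Summable fun p : ι × ℕ => ‖c (Sum.inl p)‖ := hc.comp_injective Sum.inl_injective
  have hr : Summable fun p : ι × ℕ => ‖c (Sum.inr p)‖ := hc.comp_injective Sum.inr_injective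
  have ml := multipliable_one_sub hl
  have mr := multipliable_one_sub hr
  rw [Multipliable.tprod_sum (f := fun x => 1 - c x) ml mr,
    ml.tprod_prod' fun i => multipliable_one_sub (hl.prod_factor i),
    mr.tprod_prod' fun i => multipliable_one_sub (hr.prod_factor i),
    tprod_fintype, tprod_fintype, Finset.prod_mul_distrib]

theorem modeWt_inl (ν : ι → ℂ) (v q : ℂ) (i : ι) (k : ℕ) :
    modeWt ν v q (Sum.inl (i, k)) = ν i * v * q ^ (k + 1) := by
  simp [modeWt, glWt, chargeWt, levelWt]

theorem modeWt_inr (ν : ι → ℂ) (v q : ℂ) (i : ι) (k : ℕ) :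
    modeWt ν v q (Sum.inr (i, k)) = (ν i * v)⁻¹ * q ^ k := by
  simp [modeWt, glWt, chargeWt, levelWt, mul_comm]

theorem summable_modeWt [Finite ι] (ν : ι → ℂ) (v : ℂ) {q : ℂ} (hq : ‖q‖ < 1) :
    Summable fun x => ‖modeWt ν v q x‖ :=
  summable_creationMode hq (modeWt_inl ν v q) (modeWt_inr ν v q)

theorem tprod_modeWt [Fintype ι] (ν : ι → ℂ) (v : ℂ) {q : ℂ} (hq : ‖q‖ < 1) :
    ∏' x, (1 - modeWt ν v q x) = ∏ i, thetaProd q (ν i * v) := by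
  rw [tprod_creationMode (summable_modeWt ν v hq)]
  refine Finset.prod_congr rfl fun i _ => ?_
  simp only [modeWt_inl, modeWt_inr]
  rw [thetaProd_eq_mul hq, mul_comm]

/-- The minus sign on each letter is the effect of (-1)^F. -/
theorem hasSum_clifford [Fintype ι] (ν : ι → ℂ) (v : ℂ) {q : ℂ} (hq : ‖q‖ < 1) :
    HasSum (fun S : Finset (CreationMode ι) => ∏ x ∈ S, -modeWt ν v q x)
      (∏ i, thetaProd q (ν i * v)) := by
  rw [← tprod_modeWt ν v hq]
  simpa only [sub_eq_add_neg] using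
    hasSum_finset_prod (f := fun x => -modeWt ν v q x) (by simpa using summable_modeWt ν v hq)

/-- The letters have weights νvq^(k+1) and (νv)⁻¹q^k. The conditions |v| > 1 and |vq| < 1 keep all
of them, including the level zero modes of V⁻, uniformly below 1 in norm. -/
theorem hasSum_weyl [Fintype ι] {ν : ι → ℂ} (hν : ∀ i, ‖ν i‖ = 1) {v q : ℂ} (hv : 1 < ‖v‖)
    (hvq : ‖v * q‖ < 1) :
    HasSum (fun m : Multiset (CreationMode ι) => (m.map (modeWt ν v q)).prod)
      (∏ i, thetaProd q (ν i * v))⁻¹ := by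
  have hq : ‖q‖ < 1 := by
    rw [norm_mul] at hvq
    exact (le_mul_of_one_le_left (norm_nonneg _) hv.le).trans_lt hvq
  rw [← tprod_modeWt ν v hq]
  refine hasSum_multiset_prod (ρ := max ‖v * q‖ ‖v‖⁻¹) (max_lt hvq (inv_lt_one_of_one_lt₀ hv))
    (summable_modeWt ν v hq) ?_
  rintro (⟨i, k⟩ | ⟨i, k⟩)
  · refine le_trans ?_ (le_max_left _ _)
    rw [modeWt_inl, norm_mul, norm_mul, hν, one_mul, norm_mul, pow_succ, norm_mul, norm_pow]
    exact mul_le_mul_of_nonneg_left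
      (mul_le_of_le_one_left (norm_nonneg _) (pow_le_one₀ (norm_nonneg _) hq.le)) (norm_nonneg _)
  · refine le_trans ?_ (le_max_right _ _)
    rw [modeWt_inr, norm_mul, norm_inv, norm_mul, hν, one_mul, norm_pow]
    exact mul_le_of_le_one_right (inv_nonneg.2 (norm_nonneg _)) (pow_le_one₀ (norm_nonneg _) hq.le)

/-- The summand of the trace of `J(0) (-1)^F q^{L(0)}` on a rank one Clifford module. -/
def chargeTerm (q : ℂ) (S : Finset (CreationMode (Fin 1))) : ℂ :=
  (1 / 2 + ∑ x ∈ S, (chargeWt x : ℂ)) * ∏ x ∈ S, -q ^ levelWt x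

theorem summable_chargeTerm {q : ℂ} (hq : ‖q‖ < 1) : Summable (chargeTerm q) := by
  have h1 : Summable fun x : CreationMode (Fin 1) => ‖2 * q ^ levelWt x‖ :=
    summable_creationMode (g := fun _ => 2) (g' := fun _ => 2) hq
      (fun i k => by simp [levelWt]) (fun i k => by simp [levelWt])
  refine Summable.of_norm_bounded
    (summable_finsetProd_of_summable_nonneg (fun x => norm_nonneg _) h1) fun S => ?_
  -- The charge is at most 1/2 + |S| in norm; the bound 2^|S| can be absorbed as a factor 2 on each
  -- letter.
  have h2 : ‖(1 / 2 + ∑ x ∈ S, (chargeWt x : ℂ))‖ ≤ 2 ^ S.card := by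
    have h3 : ‖∑ x ∈ S, (chargeWt x : ℂ)‖ ≤ S.card := by
      refine (norm_sum_le _ _).trans ?_
      rw [Finset.card_eq_sum_ones, Nat.cast_sum]
      refine Finset.sum_le_sum fun x _ => ?_
      rcases x with x | x <;> simp [chargeWt]
    have h4 : ((S.card + 1 : ℕ) : ℝ) ≤ ((2 ^ S.card : ℕ) : ℝ) :=
      Nat.cast_le.2 (Nat.succ_le_of_lt S.card.lt_two_pow_self)
    push_cast at h4
    have h5 : ‖(1 / 2 : ℂ)‖ = 1 / 2 := by simp
    linarith [norm_add_le (1 / 2 : ℂ) (∑ x ∈ S, (chargeWt x : ℂ))]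
  rw [chargeTerm, norm_mul, Finset.prod_congr rfl fun x _ => norm_mul (2 : ℂ) _,
    Finset.prod_mul_distrib, norm_prod]
  simp only [norm_neg, Complex.norm_ofNat, Finset.prod_const]
  exact mul_le_mul_of_nonneg_right h2 (Finset.prod_nonneg fun x _ => norm_nonneg _)

/-- The mode x₀ = v⁻(0) has level 0 and charge -1. Adding it to a set changes the sign and lowers
the charge by one, so the two terms add up to the plain product without the charge. The remaining
letters are two families of weights q^(k+1), which explains the square. -/
theorem hasSum_chargeTerm {q : ℂ} (hq : ‖q‖ < 1) :
    HasSum (chargeTerm q) (eulerProd q ^ 2) := by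
  classical
  let x₀ : CreationMode (Fin 1) := Sum.inr (0, 0)
  -- The value -1 at x₀ makes the factor of x₀ in the products of -f' equal to 1, so that S and its
  -- partner get the same weight.
  let f' : CreationMode (Fin 1) → ℂ := fun x => if x = x₀ then -1 else q ^ levelWt x
  have hs := (summable_chargeTerm hq).hasSum
  let σ := (symmDiff_right_involutive ({x₀} : Finset (CreationMode (Fin 1)))).toPerm
  have hs2 := hs.add ((σ.hasSum_iff (f := chargeTerm q)).2 hs)
  have hpair : ∀ T : Finset (CreationMode (Fin 1)), x₀ ∉ T →
      chargeTerm q T + chargeTerm q (insert x₀ T) = ∏ x ∈ T, -q ^ levelWt x := fun T hT => by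
    rw [chargeTerm, chargeTerm, Finset.sum_insert hT, Finset.prod_insert hT]
    simp only [x₀, chargeWt, levelWt, Sum.elim_inr, pow_zero, Int.cast_neg, Int.cast_one]
    ring
  have hprod : ∀ T : Finset (CreationMode (Fin 1)), x₀ ∉ T →
      ∏ x ∈ T, -f' x = ∏ x ∈ T, -q ^ levelWt x := fun T hT =>
    Finset.prod_congr rfl fun x hx => by
      simp only [f']
      rw [if_neg (ne_of_mem_of_not_mem hx hT)]
  have hterm : ∀ S, chargeTerm q S + (chargeTerm q ∘ σ) S = ∏ x ∈ S, -f' x := fun S => by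
    have hσ : (chargeTerm q ∘ σ) S = chargeTerm q (symmDiff {x₀} S) := rfl
    rw [hσ]
    by_cases hS : x₀ ∈ S
    · have e : symmDiff {x₀} S = S.erase x₀ := by
        ext x
        by_cases hx : x = x₀
        · subst hx; simp [Finset.mem_symmDiff, hS]
        · simp [Finset.mem_symmDiff, hx]
      have h1 := Finset.notMem_erase x₀ S
      have h2 := hpair _ h1
      rw [← hprod _ h1, Finset.insert_erase hS] at h2
      rw [e, add_comm, h2, ← Finset.mul_prod_erase S _ hS]
      simp [f']
    · have e : symmDiff {x₀} S = insert x₀ S := by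
        ext x
        by_cases hx : x = x₀
        · subst hx; simp [Finset.mem_symmDiff, hS]
        · simp [Finset.mem_symmDiff, hx]
      rw [e, hpair S hS, hprod S hS]
  have hf' : Summable fun x => ‖f' x‖ := by
    have h1 : Summable fun x : CreationMode (Fin 1) => ‖q ^ levelWt x‖ :=
      summable_creationMode (g := fun _ => 1) (g' := fun _ => 1) hq
        (fun i k => by simp [levelWt]) (fun i k => by simp [levelWt])
    refine h1.congr fun x => ?_
    by_cases hx : x = x₀
    · subst hx; simp [f', x₀, levelWt]
    · simp [f', hx]
  have h3 := hasSum_finset_prod (f := fun x => -f' x) (by simpa using hf')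
  have h4 : ∏' x, (1 + -f' x) = 2 * eulerProd q ^ 2 := by
    simp only [← sub_eq_add_neg]
    rw [tprod_creationMode hf', Fin.prod_univ_one]
    have e1 : ∀ k, f' (Sum.inl (0, k)) = q ^ (k + 1) := fun k => by simp [f', x₀, levelWt]
    have e2 : ∀ k, f' (Sum.inr (0, k + 1)) = q ^ (k + 1) := fun k => by simp [f', x₀, levelWt]
    have e3 : f' (Sum.inr (0, 0)) = -1 := by simp [f', x₀]
    have m : Multipliable fun k : ℕ => 1 - q ^ (k + 1) := multipliable_one_sub <| by
      simpa using summable_norm_mul_pow_succ 1 hq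
    -- Splitting off x₀ produces the factor 1 + 1 = 2, which matches the fact that each pair was
    -- counted twice.
    rw [tprod_eq_zero_mul' (f := fun k => 1 - f' (Sum.inr (0, k))) (by simpa only [e2] using m)]
    simp only [e1, e2, e3, eulerProd]
    ring
  rw [h4] at h3
  have h5 : ∑' S, chargeTerm q S + ∑' S, chargeTerm q S = 2 * eulerProd q ^ 2 :=
    hs2.unique (h3.congr_fun hterm)
  have h6 : ∑' S, chargeTerm q S = eulerProd q ^ 2 := by linear_combination h5 / 2
  rwa [h6] at hs

end GeneratingFunctions

/-! ### Diagonal operators on a fourfold tensor product -/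

section Diagonal

variable {M₁ M₂ M₃ M₄ B₁ B₂ B₃ B₄ : Type*} [AddCommGroup M₁] [Module ℂ M₁]
  [AddCommGroup M₂] [Module ℂ M₂] [AddCommGroup M₃] [Module ℂ M₃] [AddCommGroup M₄] [Module ℂ M₄]

/-- The tensor product of four bases. -/
def tensorBasis (b₁ : Module.Basis B₁ ℂ M₁) (b₂ : Module.Basis B₂ ℂ M₂)
    (b₃ : Module.Basis B₃ ℂ M₃) (b₄ : Module.Basis B₄ ℂ M₄) :
    Module.Basis (B₁ × B₂ × B₃ × B₄) ℂ (M₁ ⊗[ℂ] (M₂ ⊗[ℂ] (M₃ ⊗[ℂ] M₄))) :=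
  b₁.tensorProduct (b₂.tensorProduct (b₃.tensorProduct b₄))

theorem map_tensorBasis (b₁ : Module.Basis B₁ ℂ M₁) (b₂ : Module.Basis B₂ ℂ M₂)
    (b₃ : Module.Basis B₃ ℂ M₃) (b₄ : Module.Basis B₄ ℂ M₄)
    {f₁ : Module.End ℂ M₁} {f₂ : Module.End ℂ M₂} {f₃ : Module.End ℂ M₃} {f₄ : Module.End ℂ M₄}
    {x : B₁ × B₂ × B₃ × B₄} {c₁ c₂ c₃ c₄ : ℂ}
    (h₁ : f₁ (b₁ x.1) = c₁ • b₁ x.1) (h₂ : f₂ (b₂ x.2.1) = c₂ • b₂ x.2.1)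
    (h₃ : f₃ (b₃ x.2.2.1) = c₃ • b₃ x.2.2.1) (h₄ : f₄ (b₄ x.2.2.2) = c₄ • b₄ x.2.2.2) :
    TensorProduct.map f₁ (TensorProduct.map f₂ (TensorProduct.map f₃ f₄))
      (tensorBasis b₁ b₂ b₃ b₄ x) = (c₁ * c₂ * c₃ * c₄) • tensorBasis b₁ b₂ b₃ b₄ x := by
  simp only [tensorBasis, Module.Basis.tensorProduct_apply', TensorProduct.map_tmul, h₁, h₂, h₃, h₄,
    TensorProduct.smul_tmul_smul, mul_assoc]

theorem one_apply_eq_smul {M : Type*} [AddCommGroup M] [Module ℂ M] (x : M) :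
    (1 : Module.End ℂ M) x = (1 : ℂ) • x := by simp

variable {M : Type*} [AddCommGroup M] [Module ℂ M]

theorem linearCombination_apply_of_eigenvector {T₁ T₂ T₃ : Module.End ℂ M} {x : M} {c₁ c₂ c₃ : ℂ}
    (h₁ : T₁ x = c₁ • x) (h₂ : T₂ x = c₂ • x) (h₃ : T₃ x = c₃ • x) (a b : ℂ) :
    (a • T₁ + b • T₂ + T₃) x = (a * c₁ + b * c₂ + c₃) • x := by
  simp [h₁, h₂, h₃, add_smul, smul_smul]

theorem add_apply_of_eigenvector {T₁ T₂ : Module.End ℂ M} {x : M} {c₁ c₂ : ℂ}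
    (h₁ : T₁ x = c₁ • x) (h₂ : T₂ x = c₂ • x) : (T₁ + T₂) x = (c₁ + c₂) • x := by
  simp [h₁, h₂, add_smul]

theorem mul_apply_of_eigenvector {T₁ T₂ : Module.End ℂ M} {x : M} {c₁ c₂ : ℂ}
    (h₁ : T₁ x = c₁ • x) (h₂ : T₂ x = c₂ • x) : (T₁ * T₂) x = (c₁ * c₂) • x := by
  simp [h₁, h₂, smul_smul, mul_comm]

end Diagonal

/-! ### Weights of monomials in `W_tw` and the sum over all of them -/

section Weights

/-- The index set of a monomial basis of `W_tw`. -/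
abbrev WIndex : Type :=
  Finset (CreationMode (Fin 1)) × Finset (CreationMode (Fin 1)) × Finset (CreationMode (Fin 1)) ×
    Multiset (CreationMode (Fin 3))

/-- The eigenvalue of `J(0)` on a monomial. -/
def jWt (x : WIndex) : ℤ :=
  1 + 2 * ∑ a ∈ x.2.1, chargeWt a + 3 * ∑ a ∈ x.2.2.1, chargeWt a + (x.2.2.2.map chargeWt).sum

/-- The eigenvalue of `L(0)` on a monomial. -/
def lWt (x : WIndex) : ℕ :=
  ∑ a ∈ x.1, levelWt a + ∑ a ∈ x.2.1, levelWt a + ∑ a ∈ x.2.2.1, levelWt a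
    + (x.2.2.2.map levelWt).sum

/-- The eigenvalue on a monomial of an element of the group that acts diagonally. -/
def grpWt (l m : ℂ) (ν : Fin 3 → ℂ) (x : WIndex) : ℂ :=
  (∏ a ∈ x.2.1, glWt (fun _ => l) a) * (∏ a ∈ x.2.2.1, glWt (fun _ => m) a) *
    (x.2.2.2.map (glWt ν)).prod

/-- The eigenvalue of `(-1)^F` on a monomial. -/
def parityWt (x : WIndex) : ℂ :=
  (∏ a ∈ x.1, glWt (fun _ => -1) a) * (∏ a ∈ x.2.1, glWt (fun _ => -1) a) *
    ∏ a ∈ x.2.2.1, glWt (fun _ => -1) a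

/-- The eigenvalue of `(h + h⁻¹) J_e(0) (-1)^F` on a monomial. -/
def twinedWt (l m : ℂ) (ν : Fin 3 → ℂ) (x : WIndex) : ℂ :=
  (grpWt l m ν x + grpWt l⁻¹ m⁻¹ (fun i => (ν i)⁻¹) x) * (1 / 2 + ∑ a ∈ x.1, (chargeWt a : ℂ)) *
    parityWt x

variable {ι : Type}

theorem zpow_sum_eq_prod {X : Type*} {v : ℂ} (hv : v ≠ 0) (S : Finset X) (c : X → ℤ) :
    v ^ (∑ x ∈ S, c x) = ∏ x ∈ S, v ^ c x := by
  classical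
  induction S using Finset.induction_on with
  | empty => simp
  | insert a S ha ih => rw [Finset.sum_insert ha, Finset.prod_insert ha, zpow_add₀ hv, ih]

theorem prod_neg_modeWt (ν : ι → ℂ) {v : ℂ} (hv : v ≠ 0) (q : ℂ) (S : Finset (CreationMode ι)) :
    ∏ x ∈ S, -modeWt ν v q x = (∏ x ∈ S, glWt (fun _ => -1) x) * (∏ x ∈ S, glWt ν x) *
      v ^ (∑ x ∈ S, chargeWt x) * q ^ (∑ x ∈ S, levelWt x) := by
  rw [zpow_sum_eq_prod hv, ← Finset.prod_pow_eq_pow_sum, ← Finset.prod_mul_distrib,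
    ← Finset.prod_mul_distrib, ← Finset.prod_mul_distrib]
  refine Finset.prod_congr rfl fun x _ => ?_
  have : glWt (fun _ : ι => (-1 : ℂ)) x = -1 := by rcases x with x | x <;> simp [glWt]
  rw [this, modeWt]
  ring

theorem prod_map_modeWt (ν : ι → ℂ) {v : ℂ} (hv : v ≠ 0) (q : ℂ) (m : Multiset (CreationMode ι)) :
    (m.map (modeWt ν v q)).prod =
      (m.map (glWt ν)).prod * v ^ (m.map chargeWt).sum * q ^ (m.map levelWt).sum := by
  induction m using Multiset.induction_on with
  | empty => simp
  | cons a m ih =>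
    simp only [Multiset.map_cons, Multiset.prod_cons, Multiset.sum_cons, ih, zpow_add₀ hv, pow_add]
    rw [modeWt]
    ring

theorem chargeTerm_eq (q : ℂ) (S : Finset (CreationMode (Fin 1))) : chargeTerm q S =
    (1 / 2 + ∑ x ∈ S, (chargeWt x : ℂ)) * (∏ x ∈ S, glWt (fun _ => -1) x) *
      q ^ (∑ x ∈ S, levelWt x) := by
  have h := prod_neg_modeWt (fun _ : Fin 1 => 1) one_ne_zero q S
  have h1 : ∀ x, modeWt (fun _ : Fin 1 => 1) 1 q x = q ^ levelWt x := fun x => by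
    rcases x with x | x <;> simp [modeWt, glWt]
  have h2 : ∀ x, glWt (fun _ : Fin 1 => (1 : ℂ)) x = 1 := fun x => by
    rcases x with x | x <;> simp [glWt]
  simp only [h1, h2, Finset.prod_const_one, one_zpow, mul_one] at h
  rw [chargeTerm, h]
  ring

/-- The trace of one diagonal group element, as the product of the traces on the four factors. -/
theorem hasSum_grpWt (l m : ℂ) {ν : Fin 3 → ℂ} (hν : ∀ i, ‖ν i‖ = 1) {y q : ℂ} (hy : 1 < ‖y‖)
    (hyq : ‖y * q‖ < 1) :
    HasSum (fun x : WIndex => grpWt l m ν x * (1 / 2 + ∑ a ∈ x.1, (chargeWt a : ℂ)) * parityWt x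
        * y ^ jWt x * q ^ lWt x)
      (y * (eulerProd q ^ 2 * (thetaProd q (l * y ^ 2) * (thetaProd q (m * y ^ 3) *
        (∏ i, thetaProd q (ν i * y))⁻¹)))) := by
  have hq : ‖q‖ < 1 := by
    rw [norm_mul] at hyq
    exact (le_mul_of_one_le_left (norm_nonneg _) hy.le).trans_lt hyq
  have hy0 : y ≠ 0 := norm_pos_iff.1 (zero_lt_one.trans hy)
  have h2 := hasSum_clifford (fun _ : Fin 1 => l) (y ^ 2) hq
  have h3 := hasSum_clifford (fun _ : Fin 1 => m) (y ^ 3) hq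
  rw [Fin.prod_univ_one] at h2 h3
  have h := (hasSum_mul_complex (hasSum_chargeTerm hq) (hasSum_mul_complex h2
    (hasSum_mul_complex h3 (hasSum_weyl hν hy hyq)))).mul_left y
  refine h.congr_fun fun x => ?_
  rw [chargeTerm_eq, prod_neg_modeWt _ (pow_ne_zero 2 hy0), prod_neg_modeWt _ (pow_ne_zero 3 hy0),
    prod_map_modeWt _ hy0, grpWt, parityWt, jWt, lWt, zpow_add₀ hy0, zpow_add₀ hy0, zpow_add₀ hy0,
    zpow_mul, zpow_mul, pow_add, pow_add, pow_add, zpow_one]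
  norm_cast
  ring

theorem hasSum_twinedWt (l m : ℂ) {ν : Fin 3 → ℂ} (hν : ∀ i, ‖ν i‖ = 1) {y q : ℂ} (hy : 1 < ‖y‖)
    (hyq : ‖y * q‖ < 1) :
    HasSum (fun x : WIndex => twinedWt l m ν x * y ^ jWt x * q ^ lWt x)
      (y * eulerProd q ^ 2 *
        (thetaProd q (l * y ^ 2) * thetaProd q (m * y ^ 3) / (∏ i, thetaProd q (ν i * y)) +
          thetaProd q (l⁻¹ * y ^ 2) * thetaProd q (m⁻¹ * y ^ 3) /
            (∏ i, thetaProd q ((ν i)⁻¹ * y)))) := by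
  have h1 := hasSum_grpWt l m hν hy hyq
  have h2 := hasSum_grpWt l⁻¹ m⁻¹ (ν := fun i => (ν i)⁻¹)
    (fun i => by rw [norm_inv, hν, inv_one]) hy hyq
  convert h1.add h2 using 1
  · funext x
    rw [twinedWt]
    ring
  · ring

/-- At fixed numerical y and q the series over all monomials converges, so its terms tend to zero
along the cofinite filter. On one bidegree they all have the same nonzero norm, hence there are
finitely many. -/
theorem finite_jWt_lWt (m : ℤ) (n : ℕ) : {x : WIndex | jWt x = m ∧ lWt x = n}.Finite := by
  have hq : ‖(1 / 8 : ℂ)‖ < 1 := by norm_num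
  have hb := hasSum_clifford (fun _ : Fin 1 => 1) 1 hq
  have h2 := hasSum_clifford (fun _ : Fin 1 => 1) (2 ^ 2) hq
  have h3 := hasSum_clifford (fun _ : Fin 1 => 1) (2 ^ 3) hq
  -- The values y = 2, q = 1/8 satisfy |y| > 1 and |yq| = 1/4 < 1.
  have h4 := hasSum_weyl (ν := fun _ : Fin 3 => 1) (fun _ => norm_one) (v := 2) (q := 1 / 8)
    (by norm_num) (by norm_num)
  have h := (hasSum_mul_complex hb (hasSum_mul_complex h2
    (hasSum_mul_complex h3 h4))).summable.tendsto_cofinite_zero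
  have hpos : (0 : ℝ) < ‖(2 : ℂ) ^ (m - 1) * (1 / 8) ^ n‖ := 
    norm_pos_iff.2 (mul_ne_zero (zpow_ne_zero _ two_ne_zero) (pow_ne_zero _ (by norm_num)))
  have h5 := h.norm.eventually_lt_const (norm_zero.trans_lt hpos)
  refine (Filter.eventually_cofinite.1 h5).subset fun x hx => ?_
  obtain ⟨hm, hn⟩ := hx
  have e1 : ∀ {ι : Type} (S : Finset (CreationMode ι)),
      ‖∏ x ∈ S, glWt (fun _ => -1) x‖ = 1 := fun S => by
    rw [norm_prod]
    exact Finset.prod_eq_one fun x _ => by rcases x with x | x <;> simp [glWt]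
  have e2 : ∀ {ι : Type} (x : CreationMode ι), glWt (fun _ => (1 : ℂ)) x = 1 := fun x => by
    rcases x with x | x <;> simp [glWt]
  rw [Set.mem_ofPred_eq, not_lt, prod_neg_modeWt _ one_ne_zero,
    prod_neg_modeWt _ (pow_ne_zero 2 two_ne_zero), prod_neg_modeWt _ (pow_ne_zero 3 two_ne_zero),
    prod_map_modeWt _ two_ne_zero]
  have hm' : m - 1 = 2 * ∑ a ∈ x.2.1, chargeWt a + 3 * ∑ a ∈ x.2.2.1, chargeWt a
      + (x.2.2.2.map chargeWt).sum := by rw [← hm, jWt]; ring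
  rw [hm', ← hn, lWt, zpow_add₀ two_ne_zero, zpow_add₀ two_ne_zero, zpow_mul, zpow_mul, pow_add,
    pow_add, pow_add]
  simp only [norm_mul, e1, e2, Finset.prod_const_one, Multiset.map_const', Multiset.prod_replicate,
    one_pow, norm_one, one_zpow]
  norm_cast
  apply le_of_eq
  ring

/-- A letter's charge is at most its level, and the multiplicities 2, 3, 1 of the three charges are
at most 3. This bounds the powers of y at each power of q. -/
theorem jWt_le (x : WIndex) : jWt x ≤ 1 + 3 * lWt x := by
  have h0 : ∀ {ι : Type} (a : CreationMode ι), chargeWt a ≤ (levelWt a : ℤ) := fun a => by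
    rcases a with a | a <;> simp [chargeWt, levelWt]
  have h1 : ∀ {ι : Type} (S : Finset (CreationMode ι)),
      ∑ a ∈ S, chargeWt a ≤ ((∑ a ∈ S, levelWt a : ℕ) : ℤ) := fun S => by
    push_cast
    exact Finset.sum_le_sum fun a _ => h0 a
  have h2 : (x.2.2.2.map chargeWt).sum ≤ (((x.2.2.2.map levelWt).sum : ℕ) : ℤ) := by
    induction x.2.2.2 using Multiset.induction_on with
    | empty => simp
    | cons a m ih =>
      simp only [Multiset.map_cons, Multiset.sum_cons, Nat.cast_add]
      exact add_le_add (h0 a) ih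
  have h3 := h1 x.2.1
  have h4 := h1 x.2.2.1
  rw [jWt, lWt]
  push_cast at *
  have h5 : (0 : ℤ) ≤ ∑ a ∈ x.1, (levelWt a : ℤ) := Finset.sum_nonneg fun _ _ => by positivity
  have h6 : (0 : ℤ) ≤ ∑ a ∈ x.2.1, (levelWt a : ℤ) := Finset.sum_nonneg fun _ _ => by positivity
  have h7 : (0 : ℤ) ≤ ((x.2.2.2.map levelWt).sum : ℕ) := by positivity
  push_cast at h7
  linarith

end Weights

/-! ### The trace on `W_tw` -/

section Module5

variable {U₁ U₂ U₃ U₄ : Type*}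
  [AddCommGroup U₁] [Module ℂ U₁] [AddCommGroup U₂] [Module ℂ U₂]
  [AddCommGroup U₃] [Module ℂ U₃] [AddCommGroup U₄] [Module ℂ U₄]
  {Pe : PolarizedSpace 1 U₁} {Pa : PolarizedSpace 1 U₂} {Pa' : PolarizedSpace 1 U₃}
  {Pb : PolarizedSpace (-1) U₄}
  (De : DualBases Pe (Fin 1)) (Da : DualBases Pa (Fin 1)) (Da' : DualBases Pa' (Fin 1))
  (Db Db' : DualBases Pb (Fin 3))

/-- The monomial basis of `W_tw`. -/
def wBasis : Module.Basis WIndex ℂ (Wtw Pe Pa Pa' Pb) :=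
  tensorBasis (cliffordBasis De) (cliffordBasis Da) (cliffordBasis Da') (weylBasis Db')

theorem op4_wBasis {f₁ : Module.End ℂ (TwFock Pe)} {f₂ : Module.End ℂ (TwFock Pa)}
    {f₃ : Module.End ℂ (TwFock Pa')} {f₄ : Module.End ℂ (TwFock Pb)}
    {x : WIndex} {c₁ c₂ c₃ c₄ : ℂ}
    (h₁ : f₁ (cliffordBasis De x.1) = c₁ • cliffordBasis De x.1)
    (h₂ : f₂ (cliffordBasis Da x.2.1) = c₂ • cliffordBasis Da x.2.1)
    (h₃ : f₃ (cliffordBasis Da' x.2.2.1) = c₃ • cliffordBasis Da' x.2.2.1)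
    (h₄ : f₄ (weylBasis Db' x.2.2.2) = c₄ • weylBasis Db' x.2.2.2) :
    op4 f₁ f₂ f₃ f₄ (wBasis De Da Da' Db' x) = (c₁ * c₂ * c₃ * c₄) • wBasis De Da Da' Db' x :=
  map_tensorBasis _ _ _ _ h₁ h₂ h₃ h₄

/-- The vacuum has charge 2 · 1/2 + 3 · 1/2 - 3/2 = 1, the constant in `jWt`. -/
theorem J5_wBasis (x : WIndex) :
    J5 Da Da' Db (wBasis De Da Da' Db' x) = (jWt x : ℂ) • wBasis De Da Da' Db' x := by
  refine (linearCombination_apply_of_eigenvector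
    (op4_wBasis De Da Da' Db' (one_apply_eq_smul _) (J0_cliffordBasis Da Da _)
      (one_apply_eq_smul _) (one_apply_eq_smul _))
    (op4_wBasis De Da Da' Db' (one_apply_eq_smul _) (one_apply_eq_smul _)
      (J0_cliffordBasis Da' Da' _) (one_apply_eq_smul _))
    (op4_wBasis De Da Da' Db' (one_apply_eq_smul _) (one_apply_eq_smul _)
      (one_apply_eq_smul _) (J0_weylBasis Db Db' _)) 2 3).trans ?_
  congr 1
  simp only [jWt, Fintype.card_fin]
  push_cast
  rw [Multiset.map_map]
  simp only [Function.comp_def]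
  ring

/-- The ground state energies cancel: 3 · 1/8 from the Clifford factors and -3/8 from the Weyl
factor. -/
theorem L5_wBasis (x : WIndex) :
    L5 De Da Da' Db (wBasis De Da Da' Db' x) = (lWt x : ℂ) • wBasis De Da Da' Db' x := by
  refine (add_apply_of_eigenvector (add_apply_of_eigenvector (add_apply_of_eigenvector
    (op4_wBasis De Da Da' Db' (L0_cliffordBasis De De _) (one_apply_eq_smul _)
      (one_apply_eq_smul _) (one_apply_eq_smul _))
    (op4_wBasis De Da Da' Db' (one_apply_eq_smul _) (L0_cliffordBasis Da Da _)
      (one_apply_eq_smul _) (one_apply_eq_smul _)))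
    (op4_wBasis De Da Da' Db' (one_apply_eq_smul _) (one_apply_eq_smul _)
      (L0_cliffordBasis Da' Da' _) (one_apply_eq_smul _)))
    (op4_wBasis De Da Da' Db' (one_apply_eq_smul _) (one_apply_eq_smul _)
      (one_apply_eq_smul _) (L0_weylBasis Db Db' _))).trans ?_
  congr 1
  simp only [lWt, Fintype.card_fin]
  push_cast
  rw [Multiset.map_map]
  simp only [Function.comp_def]
  ring

theorem neg_one_apply_eq_smul {W ι : Type*} [AddCommGroup W] [Module ℂ W] (b : ι → W) (i : ι) :
    (-1 : LinearMap.GeneralLinearGroup ℂ W).val (b i) = (-1 : ℂ) • b i := by simp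

theorem parity_wBasis (x : WIndex) :
    (parity De Da Da' : Module.End ℂ (Wtw Pe Pa Pa' Pb)) (wBasis De Da Da' Db' x) =
      parityWt x • wBasis De Da Da' Db' x := by
  refine (op4_wBasis De Da Da' Db' (glAct_cliffordBasis De De (neg_one_apply_eq_smul De.pos) _)
    (glAct_cliffordBasis Da Da (neg_one_apply_eq_smul Da.pos) _) (glAct_cliffordBasis Da' Da' (neg_one_apply_eq_smul Da'.pos) _)
    (one_apply_eq_smul _)).trans ?_
  rw [mul_one]
  rfl

theorem Je_wBasis (x : WIndex) :
    (Je De : Module.End ℂ (Wtw Pe Pa Pa' Pb)) (wBasis De Da Da' Db' x) =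
      (1 / 2 + ∑ a ∈ x.1, (chargeWt a : ℂ)) • wBasis De Da Da' Db' x := by
  refine (op4_wBasis De Da Da' Db' (J0_cliffordBasis De De _) (one_apply_eq_smul _)
      (one_apply_eq_smul _) (one_apply_eq_smul _)).trans ?_
  congr 1
  simp

variable {H : Type*} [Group H] (r : H →* LinearMap.GeneralLinearGroup ℂ Pa.pos)
  (r' : H →* LinearMap.GeneralLinearGroup ℂ Pa'.pos)
  (s : H →* LinearMap.GeneralLinearGroup ℂ Pb.pos)

theorem grpAct_wBasis {h : H} {l m : ℂ} {ν : Fin 3 → ℂ} (hl : ∀ i, (r h).val (Da.pos i) = l • Da.pos i)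
    (hm : ∀ i, (r' h).val (Da'.pos i) = m • Da'.pos i)
    (hν : ∀ i, (s h).val (Db'.pos i) = ν i • Db'.pos i) (x : WIndex) :
    (grpAct Da Da' Db r r' s h : Module.End ℂ (Wtw Pe Pa Pa' Pb)) (wBasis De Da Da' Db' x) =
      grpWt l m ν x • wBasis De Da Da' Db' x := by
  refine (op4_wBasis De Da Da' Db' (one_apply_eq_smul _) (glAct_cliffordBasis Da Da hl _)
    (glAct_cliffordBasis Da' Da' hm _) (glAct_weylBasis Db Db' hν _)).trans ?_
  rw [one_mul]
  rfl

theorem inv_apply_of_eigenvector {W : Type*} [AddCommGroup W] [Module ℂ W]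
    {g : LinearMap.GeneralLinearGroup ℂ W} {w : W} {c : ℂ} (hw : w ≠ 0) (h : g.val w = c • w) :
    (g⁻¹).val w = c⁻¹ • w := by
  have h1 : (g⁻¹).val (g.val w) = w := by
    change (g⁻¹.val * g.val) w = w
    rw [Units.inv_mul]
    rfl
  rw [h, map_smul] at h1
  have hc : c ≠ 0 := fun hc => hw (by rw [← h1, hc, zero_smul])
  rw [eq_inv_smul_iff₀ hc, h1]

theorem twinedOp_wBasis {h : H} {l m : ℂ} {ν : Fin 3 → ℂ}
    (hl : ∀ i, (r h).val (Da.pos i) = l • Da.pos i)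
    (hm : ∀ i, (r' h).val (Da'.pos i) = m • Da'.pos i)
    (hν : ∀ i, (s h).val (Db'.pos i) = ν i • Db'.pos i) (x : WIndex) :
    twinedOp De Da Da' Db r r' s h (wBasis De Da Da' Db' x) =
      twinedWt l m ν x • wBasis De Da Da' Db' x :=
  mul_apply_of_eigenvector (mul_apply_of_eigenvector (add_apply_of_eigenvector
    (grpAct_wBasis De Da Da' Db Db' r r' s hl hm hν x)
    (grpAct_wBasis De Da Da' Db Db' r r' s
      (fun i => by rw [map_inv]; exact inv_apply_of_eigenvector (Da.pos.ne_zero i) (hl i))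
      (fun i => by rw [map_inv]; exact inv_apply_of_eigenvector (Da'.pos.ne_zero i) (hm i))
      (fun i => by rw [map_inv]; exact inv_apply_of_eigenvector (Db'.pos.ne_zero i) (hν i)) x))
    (Je_wBasis De Da Da' Db' x)) (parity_wBasis De Da Da' Db' x)

theorem finiteDimensional_Wpiece (m : ℤ) (n : ℕ) :
    FiniteDimensional ℂ (Wpiece De Da Da' Db m n) :=
  finiteDimensional_eigenspace_inf (wBasis De Da Da' Db) (J5_wBasis De Da Da' Db Db)
    (L5_wBasis De Da Da' Db Db) m n (finite_jWt_lWt m n)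

theorem iSup_Wpiece : ⨆ p : ℤ × ℕ, Wpiece De Da Da' Db p.1 p.2 = ⊤ :=
  iSup_eigenspace_inf_eq_top (wBasis De Da Da' Db) (J5_wBasis De Da Da' Db Db)
    (L5_wBasis De Da Da' Db Db)

section Eigenbasis

variable {h : H} {l m : ℂ} {ν : Fin 3 → ℂ}
  (hl : ∀ i, (r h).val (Da.pos i) = l • Da.pos i)
  (hm : ∀ i, (r' h).val (Da'.pos i) = m • Da'.pos i)
  (hν : ∀ i, (s h).val (Db'.pos i) = ν i • Db'.pos i)

include hl hm hν

theorem twinedOp_mem_Wpiece (j : ℤ) (n : ℕ) : ∀ x ∈ Wpiece De Da Da' Db j n,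
    twinedOp De Da Da' Db r r' s h x ∈ Wpiece De Da Da' Db j n :=
  eigenspace_inf_mapsTo (wBasis De Da Da' Db') (J5_wBasis De Da Da' Db Db')
    (L5_wBasis De Da Da' Db Db') (twinedOp_wBasis De Da Da' Db Db' r r' s hl hm hν) j n

theorem psiTildeCoeff_eq_zero {j : ℤ} {n : ℕ} (hj : 1 + 3 * (n : ℤ) < j) :
    psiTildeCoeff De Da Da' Db r r' s h j n = 0 :=
  neg_eq_zero.2 <| traceOn_eq_zero_of_empty (wBasis De Da Da' Db') (J5_wBasis De Da Da' Db Db')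
    (L5_wBasis De Da Da' Db Db') (twinedOp_wBasis De Da Da' Db Db' r r' s hl hm hν)
    fun x hx hx' => by
      have := jWt_le x
      rw [hx, hx'] at this
      omega

theorem hasSum_psiTildeCoeff (hν1 : ∀ i, ‖ν i‖ = 1) {y q : ℂ} (hy : 1 < ‖y‖) (hyq : ‖y * q‖ < 1) :
    HasSum (fun p : ℤ × ℕ => psiTildeCoeff De Da Da' Db r r' s h p.1 p.2 * y ^ p.1 * q ^ p.2)
      (-(y * eulerProd q ^ 2 *
        (thetaProd q (l * y ^ 2) * thetaProd q (m * y ^ 3) / (∏ i, thetaProd q (ν i * y)) +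
          thetaProd q (l⁻¹ * y ^ 2) * thetaProd q (m⁻¹ * y ^ 3) /
            (∏ i, thetaProd q ((ν i)⁻¹ * y))))) := by
  refine (hasSum_traceOn (wBasis De Da Da' Db') (J5_wBasis De Da Da' Db Db')
    (L5_wBasis De Da Da' Db Db') (twinedOp_wBasis De Da Da' Db Db' r r' s hl hm hν)
    finite_jWt_lWt (hasSum_twinedWt l m hν1 hy hyq)).neg.congr_fun fun p => ?_
  rw [psiTildeCoeff, Wpiece, neg_mul, neg_mul]

end Eigenbasis

end Module5

/-! ### Recovering eigenvalues from characters -/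

section Eigenvalues

/-- By Newton's identities three power sums determine the monic cubic with these roots, hence the
multiset of values and any symmetric product over it. -/
theorem prod_eq_of_power_sums_eq {ν ν' : Fin 3 → ℂ} (h1 : ∑ i, ν i = ∑ i, ν' i)
    (h2 : ∑ i, ν i ^ 2 = ∑ i, ν' i ^ 2) (h3 : ∑ i, ν i ^ 3 = ∑ i, ν' i ^ 3) (F : ℂ → ℂ) :
    ∏ i, F (ν i) = ∏ i, F (ν' i) := by
  have key : ∀ x : ℂ, ∏ i, (x - ν i) = ∏ i, (x - ν' i) := fun x => by
    simp only [Fin.sum_univ_three, Fin.prod_univ_three] at *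
    linear_combination (-x ^ 2 + x * (ν 0 + ν 1 + ν 2 + ν' 0 + ν' 1 + ν' 2) / 2
        - ((ν 0 + ν 1 + ν 2) ^ 2 + (ν 0 + ν 1 + ν 2) * (ν' 0 + ν' 1 + ν' 2)
          + (ν' 0 + ν' 1 + ν' 2) ^ 2) / 6 + (ν 0 ^ 2 + ν 1 ^ 2 + ν 2 ^ 2) / 2) * h1
      + (-x / 2 + (ν' 0 + ν' 1 + ν' 2) / 2) * h2 - h3 / 3
  have hpoly : ∏ i, (Polynomial.X - Polynomial.C (ν i)) =
      ∏ i, (Polynomial.X - Polynomial.C (ν' i)) :=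
    Polynomial.funext fun x => by simpa [Polynomial.eval_prod] using key x
  have hms : Finset.univ.val.map ν = Finset.univ.val.map ν' := by
    have := congrArg Polynomial.roots hpoly
    rw [Polynomial.roots_prod _ _ (Finset.prod_ne_zero_iff.2 fun i _ => Polynomial.X_sub_C_ne_zero _),
      Polynomial.roots_prod _ _ (Finset.prod_ne_zero_iff.2 fun i _ => Polynomial.X_sub_C_ne_zero _)]
      at this
    simpa only [Polynomial.roots_X_sub_C, Multiset.bind_singleton] using this
  have := congrArg (fun m => (m.map F).prod) hms
  rw [Multiset.map_map, Multiset.map_map] at this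
  exact this

theorem apply_eq_trace_smul {W : Type*} [AddCommGroup W] [Module ℂ W]
    (b : Module.Basis (Fin 1) ℂ W) (g : Module.End ℂ W) (i : Fin 1) :
    g (b i) = LinearMap.trace ℂ W g • b i := by
  have h : ∀ i, g (b i) = b.repr (g (b 0)) 0 • b i := fun i => by
    rw [Subsingleton.elim i 0]
    conv_lhs => rw [← b.sum_repr (g (b 0))]
    simp
  rw [trace_eq_sum_of_eigenbasis b g _ h, Fin.sum_univ_one]
  exact h i

end Eigenvalues

/-! ### Power maps on the classes of S₃ × 4 and the eigenvalues on 𝔟⁺ -/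

section Classes

instance : DecidableEq Cls24 := fun a b => by
  cases a <;> cases b <;> first | exact isTrue rfl | exact isFalse (by rintro ⟨⟩)

/-- The class of the squares of the elements of a class. -/
def Cls24.sq : Cls24 → Cls24
  | .c1A => .c1A | .c2A => .c1A | .c4A => .c2A | .c4B => .c2A | .c2B => .c1A | .c2C => .c1A
  | .c4C => .c2A | .c4D => .c2A | .c3A => .c3A | .c6A => .c3A | .c12A => .c6A | .c12B => .c6A

/-- The class of the cubes of the elements of a class. -/
def Cls24.cube : Cls24 → Cls24
  | .c1A => .c1A | .c2A => .c2A | .c4A => .c4B | .c4B => .c4A | .c2B => .c2B | .c2C => .c2C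
  | .c4C => .c4D | .c4D => .c4C | .c3A => .c1A | .c6A => .c2A | .c12A => .c4B | .c12B => .c4A

theorem cls24_sq : ∀ x : S3C4, cls24 (x ^ 2) = (cls24 x).sq := by decide

theorem cls24_cube : ∀ x : S3C4, cls24 (x ^ 3) = (cls24 x).cube := by decide

/-- A primitive cube root of unity. -/
def omega3 : ℂ := e (1 / 3)

theorem e_add (x y : ℂ) : e (x + y) = e x * e y := by
  rw [e, e, e, ← Complex.exp_add]; ring_nf

theorem e_nat_mul (n : ℕ) (x : ℂ) : e (n * x) = e x ^ n := by
  rw [e, e, ← Complex.exp_nat_mul]; ring_nf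

theorem e_neg (x : ℂ) : e (-x) = (e x)⁻¹ := by
  rw [e, e, ← Complex.exp_neg]; ring_nf

theorem e_ne_zero (x : ℂ) : e x ≠ 0 := Complex.exp_ne_zero _

theorem omega3_sq_add : omega3 ^ 2 + omega3 + 1 = 0 := by
  have h : IsPrimitiveRoot omega3 3 := by
    have := Complex.isPrimitiveRoot_exp 3 (by norm_num)
    rw [omega3, e]
    convert this using 2
    push_cast
    ring
  have := h.geom_sum_eq_zero (by norm_num)
  simp only [Finset.sum_range_succ, Finset.sum_range_zero, pow_zero, pow_one] at this
  linear_combination this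

/-- Eigenvalues of a representation with character `χ₇ + χ₁₂`. -/
def stdEig : Cls24 → Fin 3 → ℂ
  | .c1A => ![1, 1, 1] | .c2A => ![-1, -1, -1]
  | .c2B => ![-1, 1, -1] | .c2C => ![1, -1, 1]
  | .c3A => ![1, omega3, omega3 ^ 2] | .c6A => ![-1, -omega3, -omega3 ^ 2]
  | .c4A => ![I, -I, -I] | .c4C => ![I, -I, -I]
  | .c4B => ![-I, I, I] | .c4D => ![-I, I, I]
  | .c12A => ![I, -I * omega3, -I * omega3 ^ 2]
  | .c12B => ![-I, I * omega3, I * omega3 ^ 2]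

/-- This and the next two lemmas match the first three power sums of the listed eigenvalues with the
character at the class, its squares and its cubes. That is enough to pin down the eigenvalues. -/
theorem sum_stdEig (c : Cls24) : ∑ i, stdEig c i = chi7 c + chi12 c := by
  have h := omega3_sq_add
  cases c <;> simp only [Fin.sum_univ_three, stdEig, chi7, chi12, Matrix.cons_val] <;>
    first
      | ring1
      | linear_combination h
      | linear_combination -h
      | linear_combination I * h
      | linear_combination -I * h

theorem sum_stdEig_sq (c : Cls24) : ∑ i, stdEig c i ^ 2 = chi7 c.sq + chi12 c.sq := by
  have h := omega3_sq_add
  have hI := Complex.I_sq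
  cases c <;>
    simp only [Fin.sum_univ_three, stdEig, chi7, chi12, Cls24.sq, Matrix.cons_val, mul_pow, neg_sq,
      hI] <;>
    first
      | ring1
      | linear_combination (omega3 ^ 2 - omega3 + 1) * h
      | linear_combination -(omega3 ^ 2 - omega3 + 1) * h

theorem sum_stdEig_cube (c : Cls24) : ∑ i, stdEig c i ^ 3 = chi7 c.cube + chi12 c.cube := by
  have h : omega3 ^ 3 = 1 := by linear_combination (omega3 - 1) * omega3_sq_add
  have h' : (omega3 ^ 2) ^ 3 = 1 := by rw [← pow_mul, mul_comm, pow_mul, h, one_pow]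
  have hI : I ^ 3 = -I := Complex.I_pow_three
  have hn : ∀ x : ℂ, (-x) ^ 3 = -x ^ 3 := fun x => by ring
  cases c <;>
    simp only [Fin.sum_univ_three, stdEig, chi7, chi12, Cls24.cube, Matrix.cons_val, mul_pow, hn,
      hI, h, h', one_pow] <;> ring1

end Classes

/-! ### Theta and eta functions as theta and Euler products -/

section Theta

theorem norm_e (x : ℂ) : ‖e x‖ = Real.exp (-(2 * Real.pi * x.im)) := by
  rw [e, Complex.norm_exp]
  congr 1
  simp [Complex.mul_re, Complex.mul_im]

theorem norm_e_lt_one {x : ℂ} (h : 0 < x.im) : ‖e x‖ < 1 := by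
  rw [norm_e, Real.exp_lt_one_iff]
  have := mul_pos Real.two_pi_pos h
  linarith

theorem one_lt_norm_e {x : ℂ} (h : 0 < -x.im) : 1 < ‖e x‖ := by
  rw [norm_e, Real.one_lt_exp_iff]
  have := mul_pos Real.two_pi_pos h
  linarith

theorem eulerProd_ne_zero {q : ℂ} (hq : ‖q‖ < 1) : eulerProd q ≠ 0 := by
  have h := tprod_one_add_ne_zero_of_summable (f := fun k : ℕ => -q ^ (k + 1)) (fun k => by
    intro h
    have h1 : q ^ (k + 1) = 1 := by linear_combination -h
    have h2 := pow_lt_one₀ (norm_nonneg q) hq (Nat.succ_ne_zero k)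
    rw [← norm_pow, h1, norm_one] at h2
    exact lt_irrefl _ h2) (by simpa using summable_norm_mul_pow_succ 1 hq)
  simpa only [eulerProd, sub_eq_add_neg] using h

/-- In the annulus 1 < |u| < 1/|q| no linear factor vanishes, since u⁻¹q^k and uq^(k+1) are smaller
than 1 in norm. -/
theorem thetaProd_ne_zero {q u : ℂ} (hu : 1 < ‖u‖) (huq : ‖u * q‖ < 1) : thetaProd q u ≠ 0 := by
  have hq : ‖q‖ < 1 := by
    rw [norm_mul] at huq
    exact (le_mul_of_one_le_left (norm_nonneg _) hu.le).trans_lt huq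
  have h1 : ∀ k : ℕ, 1 + -(u⁻¹ * q ^ k) ≠ 0 := fun k h => by
    have h1 : u⁻¹ * q ^ k = 1 := by linear_combination -h
    have h2 : ‖u⁻¹ * q ^ k‖ < 1 := by
      rw [norm_mul, norm_inv, norm_pow]
      exact mul_lt_one_of_nonneg_of_lt_one_left (inv_nonneg.2 (norm_nonneg _))
        (inv_lt_one_of_one_lt₀ hu) (pow_le_one₀ (norm_nonneg _) hq.le)
    rw [h1, norm_one] at h2
    exact lt_irrefl _ h2
  have h2 : ∀ k : ℕ, 1 + -(u * q ^ (k + 1)) ≠ 0 := fun k h => by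
    have h1 : u * q * q ^ k = 1 := by linear_combination -h
    have h2 : ‖u * q * q ^ k‖ < 1 := by
      rw [norm_mul, norm_pow]
      exact mul_lt_one_of_nonneg_of_lt_one_left (norm_nonneg _) huq
        (pow_le_one₀ (norm_nonneg _) hq.le)
    rw [h1, norm_one] at h2
    exact lt_irrefl _ h2
  have t1 := tprod_one_add_ne_zero_of_summable h1 (by simpa using summable_norm_mul_pow u⁻¹ hq)
  have t2 := tprod_one_add_ne_zero_of_summable h2 (by simpa using summable_norm_mul_pow_succ u hq)
  rw [thetaProd_eq_mul hq]
  simpa only [sub_eq_add_neg] using mul_ne_zero t1 t2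

theorem multipliable_thetaProd {q : ℂ} (hq : ‖q‖ < 1) (u : ℂ) :
    Multipliable fun k : ℕ => (1 - u⁻¹ * q ^ k) * (1 - u * q ^ (k + 1)) :=
  (multipliable_one_sub (summable_norm_mul_pow _ hq)).mul
    (multipliable_one_sub (summable_norm_mul_pow_succ _ hq))

/-- A product of theta products over twists whose linear factors multiply to `1 - a x^N`. -/
theorem prod_thetaProd {κ : Type*} [Fintype κ] {ζ : κ → ℂ} {a : ℂ} {N : ℕ}
    (h : ∀ x, ∏ i, (1 - ζ i * x) = 1 - a * x ^ N)
    (h' : ∀ x, ∏ i, (1 - (ζ i)⁻¹ * x) = 1 - a⁻¹ * x ^ N) {q : ℂ} (hq : ‖q‖ < 1) (u : ℂ) :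
    ∏ i, thetaProd q (ζ i * u) = thetaProd (q ^ N) (a * u ^ N) := by
  simp only [thetaProd]
  rw [← Multipliable.tprod_finsetProd fun i _ => multipliable_thetaProd hq (ζ i * u)]
  refine tprod_congr fun k => ?_
  rw [Finset.prod_mul_distrib]
  have e1 := h' (u⁻¹ * q ^ k)
  have e2 := h (u * q ^ (k + 1))
  simp only [mul_inv, mul_assoc] at *
  rw [e1, e2]
  simp only [mul_pow, inv_pow, ← pow_mul, mul_comm N]

theorem multipliable_eulerProd {q : ℂ} (hq : ‖q‖ < 1) : Multipliable fun k : ℕ => 1 - q ^ (k + 1) :=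
  multipliable_one_sub (by simpa using summable_norm_mul_pow_succ 1 hq)

theorem theta1_eq {τ : ℂ} (hτ : 0 < τ.im) (z : ℂ) : theta1 τ z =
    -I * e (τ / 8) * e (z / 2) * (thetaProd (e τ) (e z) * eulerProd (e τ)) := by
  rw [theta1, (multipliable_thetaProd (norm_e_lt_one hτ) _).tprod_mul
    (multipliable_eulerProd (norm_e_lt_one hτ))]
  rfl

theorem theta2_eq {τ : ℂ} (hτ : 0 < τ.im) (z : ℂ) : theta2 τ z =
    e (τ / 8) * e (z / 2) * (thetaProd (e τ) (-e z) * eulerProd (e τ)) := by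
  have h := (multipliable_thetaProd (norm_e_lt_one hτ) (-e z)).tprod_mul
    (multipliable_eulerProd (norm_e_lt_one hτ))
  simp only [inv_neg, neg_mul, sub_neg_eq_add] at h
  rw [theta2, h, thetaProd]
  simp only [inv_neg, neg_mul, sub_neg_eq_add]
  rfl

theorem eta_eq (τ : ℂ) : ModularForm.eta τ = e (τ / 24) * eulerProd (e τ) := by
  have h : ∀ n, ModularForm.eta_q n τ = e τ ^ (n + 1) := fun n => ModularForm.eta_q_eq_pow n τ
  rw [ModularForm.eta, eulerProd]
  simp only [h]
  congr 1
  rw [Function.Periodic.qParam, e]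
  congr 1
  push_cast
  ring

end Theta

/-! ### The theta identities, class by class -/

section Identities

open ModularForm (eta)

theorem e_eq_pow {x w : ℂ} (n : ℕ) (h : x = n * w) : e x = e w ^ n := by rw [h, e_nat_mul]

theorem e_eq_mul_pow {x v w : ℂ} (n : ℕ) (h : x = v + n * w) : e x = e v * e w ^ n := by
  rw [h, e_add, e_nat_mul]

theorem e_eq_mul_inv_pow {x v w : ℂ} (n : ℕ) (h : x = v - n * w) : e x = e v * (e w ^ n)⁻¹ := by
  rw [h, sub_eq_add_neg, e_add, e_neg, e_nat_mul]

theorem e_quarter : e (1 / 4) = I := by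
  rw [e, show 2 * (Real.pi : ℂ) * I * (1 / 4) = Real.pi / 2 * I by ring, Complex.exp_pi_div_two_mul_I]

theorem e_one_div_pow_six : e (1 / 24) ^ 6 = I := by
  rw [← e_quarter]
  exact (e_eq_pow 6 (by norm_num)).symm

theorem eta_nat_mul (τ : ℂ) (N : ℕ) :
    eta (N * τ) = e (τ / 24) ^ N * eulerProd (e τ ^ N) := by
  rw [eta_eq, mul_div_assoc, e_nat_mul, e_nat_mul]

variable {τ : ℂ} (hτ : 0 < τ.im) (z : ℂ)

include hτ

/-- All fractional exponents become integral powers of e(τ/24), e(z/2) and, for shifts of z,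
e(1/24), so that the identities reduce to algebra of monomials and abstract products. -/
theorem theta1_nat_mul (n : ℕ) : theta1 τ (n * z) = -I * e (τ / 24) ^ 3 * e (z / 2) ^ n *
    (thetaProd (e τ) (e z ^ n) * eulerProd (e τ)) := by
  rw [theta1_eq hτ, e_eq_pow (x := τ / 8) (w := τ / 24) 3 (by push_cast; ring),
    e_eq_pow (x := n * z / 2) n (mul_div_assoc _ _ _), e_nat_mul]

theorem theta2_nat_mul (n : ℕ) : theta2 τ (n * z) = e (τ / 24) ^ 3 * e (z / 2) ^ n *
    (thetaProd (e τ) (-e z ^ n) * eulerProd (e τ)) := by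
  rw [theta2_eq hτ, e_eq_pow (x := τ / 8) (w := τ / 24) 3 (by push_cast; ring),
    e_eq_pow (x := n * z / 2) n (mul_div_assoc _ _ _), e_nat_mul]

theorem theta1_nat_mul_nat_mul {N : ℕ} (hN : N ≠ 0) (n : ℕ) : theta1 (N * τ) (n * z) =
    -I * e (τ / 24) ^ (3 * N) * e (z / 2) ^ n *
      (thetaProd (e τ ^ N) (e z ^ n) * eulerProd (e τ ^ N)) := by
  have h : 0 < ((N : ℂ) * τ).im := by
    simpa using mul_pos (Nat.cast_pos.2 (Nat.pos_of_ne_zero hN)) hτ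
  rw [theta1_nat_mul h, mul_div_assoc, e_nat_mul, e_nat_mul, ← pow_mul, mul_comm N 3]

theorem theta2_nat_mul_nat_mul {N : ℕ} (hN : N ≠ 0) (n : ℕ) : theta2 (N * τ) (n * z) =
    e (τ / 24) ^ (3 * N) * e (z / 2) ^ n *
      (thetaProd (e τ ^ N) (-e z ^ n) * eulerProd (e τ ^ N)) := by
  have h : 0 < ((N : ℂ) * τ).im := by
    simpa using mul_pos (Nat.cast_pos.2 (Nat.pos_of_ne_zero hN)) hτ
  rw [theta2_nat_mul h, mul_div_assoc, e_nat_mul, e_nat_mul, ← pow_mul, mul_comm N 3]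

theorem theta1_nat_mul_add (n k : ℕ) : theta1 τ (n * z + k / 12) =
    -I * e (τ / 24) ^ 3 * (e (z / 2) ^ n * e (1 / 24) ^ k) *
      (thetaProd (e τ) (e (1 / 24) ^ (2 * k) * e z ^ n) * eulerProd (e τ)) := by
  have h1 : e ((n * z + k / 12) / 2) = e (z / 2) ^ n * e (1 / 24) ^ k := by
    rw [← e_nat_mul]; exact e_eq_mul_pow k (by ring)
  have h2 : e (n * z + k / 12) = e (1 / 24) ^ (2 * k) * e z ^ n := by
    rw [← e_nat_mul n, mul_comm (e (1 / 24) ^ (2 * k))]; exact e_eq_mul_pow _ (by push_cast; ring)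
  rw [theta1_eq hτ, e_eq_pow (x := τ / 8) (w := τ / 24) 3 (by push_cast; ring), h1, h2]

theorem theta1_nat_mul_sub (n k : ℕ) : theta1 τ (n * z - k / 12) =
    -I * e (τ / 24) ^ 3 * (e (z / 2) ^ n * (e (1 / 24) ^ k)⁻¹) *
      (thetaProd (e τ) ((e (1 / 24) ^ (2 * k))⁻¹ * e z ^ n) * eulerProd (e τ)) := by
  have h1 : e ((n * z - k / 12) / 2) = e (z / 2) ^ n * (e (1 / 24) ^ k)⁻¹ := by
    rw [← e_nat_mul]; exact e_eq_mul_inv_pow k (by ring)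
  have h2 : e (n * z - k / 12) = (e (1 / 24) ^ (2 * k))⁻¹ * e z ^ n := by
    rw [← e_nat_mul n, mul_comm (e (1 / 24) ^ (2 * k))⁻¹]; exact e_eq_mul_inv_pow _ (by push_cast; ring)
  rw [theta1_eq hτ, e_eq_pow (x := τ / 8) (w := τ / 24) 3 (by push_cast; ring), h1, h2]

end Identities

section Identities

variable {τ z : ℂ}

theorem e_half_sq (z : ℂ) : e (z / 2) ^ 2 = e z := (e_eq_pow 2 (by push_cast; ring)).symm

/-- The value of a twined trace in terms of theta products. -/
def twinedValue (l m : ℂ) (ν : Fin 3 → ℂ) (q y : ℂ) : ℂ :=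
  -(y * eulerProd q ^ 2 *
    (thetaProd q (l * y ^ 2) * thetaProd q (m * y ^ 3) / (∏ i, thetaProd q (ν i * y)) +
      thetaProd q (l⁻¹ * y ^ 2) * thetaProd q (m⁻¹ * y ^ 3) / (∏ i, thetaProd q ((ν i)⁻¹ * y))))

/-- All parameters are their own inverses here, and likewise for 2A, 2B and 2C. The terms of g and
g⁻¹ coincide, which is the factor 2 in the formula. Both sides have the same theta products in the
denominator, so no condition on z is needed. -/
theorem psi5_c1A (hτ : 0 < τ.im) :
    psi5 .c1A τ z = twinedValue 1 1 ![1, 1, 1] (e τ) (e z) := by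
  have hE := eulerProd_ne_zero (norm_e_lt_one hτ)
  have hT := e_ne_zero (τ / 24)
  have hZ := e_ne_zero (z / 2)
  have h11 := theta1_nat_mul hτ z 1
  have h12 := theta1_nat_mul hτ z 2
  have h13 := theta1_nat_mul hτ z 3
  have h := eta_nat_mul τ 1
  simp only [Nat.cast_one, Nat.cast_ofNat, one_mul, pow_one] at *
  simp only [psi5, h11, h12, h13, h, twinedValue, Fin.prod_univ_three, Matrix.cons_val, inv_one,
    one_mul, neg_mul]
  rw [← e_half_sq z]
  field_simp
  ring

theorem psi5_c2A (hτ : 0 < τ.im) :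
    psi5 .c2A τ z = twinedValue 1 (-1) ![-1, -1, -1] (e τ) (e z) := by
  have hE := eulerProd_ne_zero (norm_e_lt_one hτ)
  have hT := e_ne_zero (τ / 24)
  have hZ := e_ne_zero (z / 2)
  have h21 := theta2_nat_mul hτ z 1
  have h12 := theta1_nat_mul hτ z 2
  have h23 := theta2_nat_mul hτ z 3
  have h := eta_nat_mul τ 1
  simp only [Nat.cast_one, Nat.cast_ofNat, one_mul, pow_one] at *
  simp only [psi5, h21, h12, h23, h, twinedValue, Fin.prod_univ_three, Matrix.cons_val, inv_one,
    one_mul, inv_neg, neg_mul]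
  rw [← e_half_sq z]
  field_simp
  simp only [Complex.I_sq]
  ring

theorem psi5_c2B (hτ : 0 < τ.im) :
    psi5 .c2B τ z = twinedValue 1 1 ![-1, 1, -1] (e τ) (e z) := by
  have hE := eulerProd_ne_zero (norm_e_lt_one hτ)
  have hT := e_ne_zero (τ / 24)
  have hZ := e_ne_zero (z / 2)
  have h11 := theta1_nat_mul hτ z 1
  have h21 := theta2_nat_mul hτ z 1
  have h12 := theta1_nat_mul hτ z 2
  have h13 := theta1_nat_mul hτ z 3
  have h := eta_nat_mul τ 1
  simp only [Nat.cast_one, Nat.cast_ofNat, one_mul, pow_one] at *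
  simp only [psi5, h11, h21, h12, h13, h, twinedValue, Fin.prod_univ_three, Matrix.cons_val, inv_one,
    one_mul, inv_neg, neg_mul]
  rw [← e_half_sq z]
  field_simp
  simp only [Complex.I_sq]
  ring

theorem psi5_c2C (hτ : 0 < τ.im) :
    psi5 .c2C τ z = twinedValue 1 (-1) ![1, -1, 1] (e τ) (e z) := by
  have hE := eulerProd_ne_zero (norm_e_lt_one hτ)
  have hT := e_ne_zero (τ / 24)
  have hZ := e_ne_zero (z / 2)
  have h11 := theta1_nat_mul hτ z 1
  have h21 := theta2_nat_mul hτ z 1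
  have h12 := theta1_nat_mul hτ z 2
  have h23 := theta2_nat_mul hτ z 3
  have h := eta_nat_mul τ 1
  simp only [Nat.cast_one, Nat.cast_ofNat, one_mul, pow_one] at *
  simp only [psi5, h11, h21, h12, h23, h, twinedValue, Fin.prod_univ_three, Matrix.cons_val, inv_one,
    one_mul, inv_neg, neg_mul]
  rw [← e_half_sq z]
  field_simp
  ring

/-- The theta products of the twists of `u` by the cube roots of unity. -/
theorem prod_thetaProd_omega3 {q : ℂ} (hq : ‖q‖ < 1) (u : ℂ) :
    thetaProd q u * thetaProd q (omega3 * u) * thetaProd q (omega3 ^ 2 * u) =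
      thetaProd (q ^ 3) (u ^ 3) := by
  have h := omega3_sq_add
  have h0 : omega3⁻¹ = omega3 ^ 2 := inv_eq_of_mul_eq_one_right
    (by linear_combination (omega3 - 1) * h)
  have h1 : (omega3 ^ 2)⁻¹ = omega3 := by rw [← h0, inv_inv]
  have key : ∀ x : ℂ, (1 - x) * (1 - omega3 * x) * (1 - omega3 ^ 2 * x) = 1 - x ^ 3 := fun x => by
    linear_combination (-x + x ^ 2 * omega3 - x ^ 3 * (omega3 - 1)) * h
  have := prod_thetaProd (ζ := ![1, omega3, omega3 ^ 2]) (a := 1) (N := 3)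
    (fun x => by simpa [Fin.prod_univ_three] using key x)
    (fun x => by
      simp only [Fin.prod_univ_three, Matrix.cons_val, inv_one, one_mul, h0, h1]
      rw [← key]; ring) hq u
  simpa [Fin.prod_univ_three] using this

/-- Comes from (1 - ix)(1 + ix) = 1 + x². -/
theorem thetaProd_I_mul_thetaProd_neg_I {q : ℂ} (hq : ‖q‖ < 1) (u : ℂ) :
    thetaProd q (I * u) * thetaProd q (-I * u) = thetaProd (q ^ 2) (-u ^ 2) := by
  have hI := Complex.I_sq
  have := prod_thetaProd (ζ := ![I, -I]) (a := -1) (N := 2)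
    (fun x => by
      simp only [Fin.prod_univ_two, Matrix.cons_val]
      linear_combination -x ^ 2 * hI)
    (fun x => by
      simp only [Fin.prod_univ_two, Matrix.cons_val, inv_neg, Complex.inv_I, inv_one]
      linear_combination -x ^ 2 * hI) hq u
  simpa [Fin.prod_univ_two] using this

/-- Pairing the twists by ±i passes to q² and -u²; the three cube root twists of the result then
pass to q⁶ and -u⁶. -/
theorem prod_thetaProd_fourth_roots_omega3 {q : ℂ} (hq : ‖q‖ < 1) (u : ℂ) :
    (thetaProd q (I * u) * thetaProd q (-I * omega3 * u) * thetaProd q (-I * omega3 ^ 2 * u)) *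
      (thetaProd q (-I * u) * thetaProd q (I * omega3 * u) * thetaProd q (I * omega3 ^ 2 * u)) =
      thetaProd (q ^ 6) (-u ^ 6) := by
  have h1 := thetaProd_I_mul_thetaProd_neg_I hq u
  have h2 := thetaProd_I_mul_thetaProd_neg_I hq (omega3 * u)
  have h3 := thetaProd_I_mul_thetaProd_neg_I hq (omega3 ^ 2 * u)
  have h4 := prod_thetaProd_omega3 (q := q ^ 2)
    (by rw [norm_pow]; exact pow_lt_one₀ (norm_nonneg q) hq two_ne_zero) (-u ^ 2)
  have ho : omega3 ^ 3 = 1 := by linear_combination (omega3 - 1) * omega3_sq_add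
  rw [← pow_mul, show (-u ^ 2) ^ 3 = -u ^ 6 by ring] at h4
  rw [show -(omega3 * u) ^ 2 = omega3 ^ 2 * -u ^ 2 by ring] at h2
  rw [show -(omega3 ^ 2 * u) ^ 2 = omega3 * -u ^ 2 by linear_combination -omega3 * u ^ 2 * ho] at h3
  simp only [← mul_assoc] at *
  rw [← h4, ← h1, ← h2, ← h3]
  ring

/-- Inversion swaps ω and ω², so g and g⁻¹ have the same denominator, the theta product at (q³, y³).
-/
theorem psi5_c3A (hτ : 0 < τ.im) :
    psi5 .c3A τ z = twinedValue 1 1 ![1, omega3, omega3 ^ 2] (e τ) (e z) := by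
  have hq := norm_e_lt_one hτ
  have hE := eulerProd_ne_zero hq
  have hE3 : eulerProd (e τ ^ 3) ≠ 0 := eulerProd_ne_zero (by
    rw [norm_pow]; exact pow_lt_one₀ (norm_nonneg _) hq three_ne_zero)
  have hT := e_ne_zero (τ / 24)
  have hZ := e_ne_zero (z / 2)
  have ho : omega3⁻¹ = omega3 ^ 2 := inv_eq_of_mul_eq_one_right
    (by linear_combination (omega3 - 1) * omega3_sq_add)
  have ho' : (omega3 ^ 2)⁻¹ = omega3 := by rw [← ho, inv_inv]
  have hp := prod_thetaProd_omega3 hq (e z)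
  have h12 := theta1_nat_mul hτ z 2
  have h13 := theta1_nat_mul hτ z 3
  have h33 := theta1_nat_mul_nat_mul hτ z three_ne_zero 3
  have h := eta_nat_mul τ 3
  simp only [Nat.cast_ofNat] at h12 h13 h33 h
  have hp' : ∏ i, thetaProd (e τ) ((![1, omega3, omega3 ^ 2] : Fin 3 → ℂ) i * e z) =
      thetaProd (e τ ^ 3) (e z ^ 3) := by
    rw [← hp, Fin.prod_univ_three]
    simp [mul_assoc]
  have hp'' : ∏ i, thetaProd (e τ) (((![1, omega3, omega3 ^ 2] : Fin 3 → ℂ) i)⁻¹ * e z) =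
      thetaProd (e τ ^ 3) (e z ^ 3) := by
    rw [← hp, Fin.prod_univ_three]
    simp only [Matrix.cons_val, inv_one, ho, ho', one_mul]
    ring
  rw [twinedValue, hp', hp'']
  simp only [psi5, h12, h13, h33, h, inv_one, one_mul, neg_mul]
  rw [← e_half_sq z]
  field_simp
  simp only [Complex.I_sq]
  ring

theorem psi5_c6A (hτ : 0 < τ.im) :
    psi5 .c6A τ z = twinedValue 1 (-1) ![-1, -omega3, -omega3 ^ 2] (e τ) (e z) := by
  have hq := norm_e_lt_one hτ
  have hE := eulerProd_ne_zero hq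
  have hE3 : eulerProd (e τ ^ 3) ≠ 0 := eulerProd_ne_zero (by
    rw [norm_pow]; exact pow_lt_one₀ (norm_nonneg _) hq three_ne_zero)
  have hT := e_ne_zero (τ / 24)
  have hZ := e_ne_zero (z / 2)
  have ho : omega3⁻¹ = omega3 ^ 2 := inv_eq_of_mul_eq_one_right
    (by linear_combination (omega3 - 1) * omega3_sq_add)
  have ho' : (omega3 ^ 2)⁻¹ = omega3 := by rw [← ho, inv_inv]
  have hp := prod_thetaProd_omega3 hq (-e z)
  have h12 := theta1_nat_mul hτ z 2
  have h23 := theta2_nat_mul hτ z 3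
  have h33 := theta2_nat_mul_nat_mul hτ z three_ne_zero 3
  have h := eta_nat_mul τ 3
  rw [show (-e z) ^ 3 = -e z ^ 3 by ring] at hp
  simp only [Nat.cast_ofNat] at h12 h23 h33 h
  have hp' : ∏ i, thetaProd (e τ) ((![-1, -omega3, -omega3 ^ 2] : Fin 3 → ℂ) i * e z) =
      thetaProd (e τ ^ 3) (-e z ^ 3) := by
    rw [← hp, Fin.prod_univ_three]
    simp [mul_assoc]
  have hp'' : ∏ i, thetaProd (e τ) (((![-1, -omega3, -omega3 ^ 2] : Fin 3 → ℂ) i)⁻¹ * e z) =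
      thetaProd (e τ ^ 3) (-e z ^ 3) := by
    rw [← hp, Fin.prod_univ_three]
    simp only [Matrix.cons_val, inv_one, inv_neg, ho, ho', one_mul, neg_mul, mul_neg]
    ring
  rw [twinedValue, hp', hp'']
  simp only [psi5, h12, h23, h33, h, inv_one, one_mul, inv_neg, neg_mul]
  rw [← e_half_sq z]
  field_simp
  simp only [Complex.I_sq]
  ring

theorem thetaProd_mul_e_ne_zero (hz : 0 < -z.im) (hzτ : -z.im < τ.im) {c : ℂ} (hc : ‖c‖ = 1) :
    thetaProd (e τ) (c * e z) ≠ 0 := by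
  refine thetaProd_ne_zero ?_ ?_
  · rw [norm_mul, hc, one_mul]
    exact one_lt_norm_e hz
  · rw [mul_assoc, norm_mul, hc, one_mul, ← e_add]
    exact norm_e_lt_one (by rw [Complex.add_im]; linarith)

theorem norm_omega3 : ‖omega3‖ = 1 := by
  have h : omega3 ^ 3 = 1 := by linear_combination (omega3 - 1) * omega3_sq_add
  exact Complex.norm_eq_one_of_pow_eq_one h three_ne_zero

/-- The trace is symmetric in h and h⁻¹, which transfers the formulas from 4A and 12A to the inverse
classes 4B and 12B. -/
theorem twinedValue_inv (l m : ℂ) (ν : Fin 3 → ℂ) (q y : ℂ) :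
    twinedValue l⁻¹ m⁻¹ (fun i => (ν i)⁻¹) q y = twinedValue l m ν q y := by
  simp only [twinedValue, inv_inv]
  rw [add_comm]

/-- Let A and B be the theta products at iy and -iy. The denominators for g and g⁻¹ are AB² and A²B,
and AB is the product behind θ₂(2τ,2z). Over (AB)² the numerators acquire A and B, which are the
factors θ₁(τ, z ± 1/4). Cancelling them requires A, B ≠ 0, hence the restriction on z. -/
theorem psi5_c4A (hz : 0 < -z.im) (hzτ : -z.im < τ.im) :
    psi5 .c4A τ z = twinedValue (-1) I ![I, -I, -I] (e τ) (e z) := by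
  have hτ : 0 < τ.im := hz.trans hzτ
  have hq := norm_e_lt_one hτ
  have hE := eulerProd_ne_zero hq
  have hE2 : eulerProd (e τ ^ 2) ≠ 0 := eulerProd_ne_zero (by
    rw [norm_pow]; exact pow_lt_one₀ (norm_nonneg _) hq two_ne_zero)
  have hT := e_ne_zero (τ / 24)
  have hZ := e_ne_zero (z / 2)
  have hR := e_ne_zero (1 / 24)
  have hR6 := e_one_div_pow_six
  have hp := thetaProd_I_mul_thetaProd_neg_I hq (e z)
  have n1 := thetaProd_mul_e_ne_zero hz hzτ Complex.norm_I
  have n2 : thetaProd (e τ) (-I * e z) ≠ 0 :=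
    thetaProd_mul_e_ne_zero hz hzτ (by rw [norm_neg, Complex.norm_I])
  have h2 := theta2_nat_mul hτ z 2
  have h22 := theta2_nat_mul_nat_mul hτ z two_ne_zero 2
  have h1 := eta_nat_mul τ 1
  have h := eta_nat_mul τ 2
  have a1 := theta1_nat_mul_add hτ z 1 3
  have a3 := theta1_nat_mul_add hτ z 3 3
  have s1 := theta1_nat_mul_sub hτ z 1 3
  have s3 := theta1_nat_mul_sub hτ z 3 3
  have e4 : (3 : ℂ) / 12 = 1 / 4 := by norm_num
  simp only [Nat.cast_ofNat, Nat.cast_one, one_mul, pow_one, e4, Nat.reduceMul, hR6, Complex.inv_I]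
    at h2 h22 h1 h a1 a3 s1 s3
  simp only [psi5, twinedValue, h2, h22, h1, h, a1, a3, s1, s3, Fin.prod_univ_three,
    Matrix.cons_val, inv_neg, Complex.inv_I, inv_one, neg_neg, ← hp]
  rw [neg_one_mul]
  generalize thetaProd (e τ) (I * e z) = A at *
  generalize thetaProd (e τ) (-I * e z) = B at *
  generalize thetaProd (e τ) (I * e z ^ 3) = C
  generalize thetaProd (e τ) (-I * e z ^ 3) = D
  generalize thetaProd (e τ) (-e z ^ 2) = F
  rw [← e_half_sq z]
  generalize e (z / 2) = Z at *
  generalize e (τ / 24) = T at *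
  generalize e (1 / 24) = R at *
  generalize eulerProd (e τ) = E at *
  generalize eulerProd (e τ ^ 2) = E2 at *
  field_simp
  have hR12 : R ^ 12 = -1 := by rw [show 12 = 6 * 2 from rfl, pow_mul, hR6, Complex.I_sq]
  rw [hR12, hR6, Complex.I_pow_three]
  ring

/-- The denominators for g and g⁻¹ are complementary triples among the six twists of y whose theta
products multiply to the one behind θ₂(6τ,6z). Over this common denominator each term acquires the
other's triple, namely the θ₁ at z ± 1/12, z ± 1/4, z ± 5/12. -/
theorem psi5_c12A (hz : 0 < -z.im) (hzτ : -z.im < τ.im) :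
    psi5 .c12A τ z = twinedValue (-1) I ![I, -I * omega3, -I * omega3 ^ 2] (e τ) (e z) := by
  have hτ : 0 < τ.im := hz.trans hzτ
  have hq := norm_e_lt_one hτ
  have hE := eulerProd_ne_zero hq
  have hE6 : eulerProd (e τ ^ 6) ≠ 0 := eulerProd_ne_zero (by
    rw [norm_pow]; exact pow_lt_one₀ (norm_nonneg _) hq (by norm_num))
  have hT := e_ne_zero (τ / 24)
  have hZ := e_ne_zero (z / 2)
  have hR := e_ne_zero (1 / 24)
  have hR6 := e_one_div_pow_six
  have hp := prod_thetaProd_fourth_roots_omega3 hq (e z)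
  have hI : ‖-I‖ = 1 := by rw [norm_neg, Complex.norm_I]
  have n1 := thetaProd_mul_e_ne_zero hz hzτ Complex.norm_I
  have n2 := thetaProd_mul_e_ne_zero hz hzτ hI
  have n3 : thetaProd (e τ) (-I * omega3 * e z) ≠ 0 :=
    thetaProd_mul_e_ne_zero hz hzτ (by rw [norm_mul, hI, norm_omega3, one_mul])
  have n4 : thetaProd (e τ) (-I * omega3 ^ 2 * e z) ≠ 0 :=
    thetaProd_mul_e_ne_zero hz hzτ (by rw [norm_mul, norm_pow, hI, norm_omega3, one_pow, one_mul])
  have n5 : thetaProd (e τ) (I * omega3 * e z) ≠ 0 :=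
    thetaProd_mul_e_ne_zero hz hzτ (by rw [norm_mul, Complex.norm_I, norm_omega3, one_mul])
  have n6 : thetaProd (e τ) (I * omega3 ^ 2 * e z) ≠ 0 :=
    thetaProd_mul_e_ne_zero hz hzτ
      (by rw [norm_mul, norm_pow, Complex.norm_I, norm_omega3, one_pow, one_mul])
  have ho3 : omega3 ^ 3 = 1 := by linear_combination (omega3 - 1) * omega3_sq_add
  have ho : omega3⁻¹ = omega3 ^ 2 := inv_eq_of_mul_eq_one_right (by rw [← ho3]; ring)
  have ho' : (omega3 ^ 2)⁻¹ = omega3 := by rw [← ho, inv_inv]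
  have hR8 : e (1 / 24) ^ 8 = omega3 := (e_eq_pow 8 (by norm_num)).symm
  -- With R = e(1/24): iω = R⁶R⁸ = R¹²R² = -R².
  have hR2 : e (1 / 24) ^ 2 = -I * omega3 := by
    rw [← hR8, ← hR6, neg_mul, ← pow_add, show 6 + 8 = 6 + 6 + 2 from rfl, pow_add, pow_add, hR6,
      Complex.I_mul_I]
    ring
  have hR10 : e (1 / 24) ^ 10 = -I * omega3 ^ 2 := by
    rw [show 10 = 2 + 8 from rfl, pow_add, hR2, hR8]
    ring
  have i1 : (-I * omega3)⁻¹ = I * omega3 ^ 2 := by rw [mul_inv, ho, inv_neg, Complex.inv_I, neg_neg]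
  have i2 : (-I * omega3 ^ 2)⁻¹ = I * omega3 := by rw [mul_inv, ho', inv_neg, Complex.inv_I, neg_neg]
  have h2 := theta2_nat_mul hτ z 2
  have h66 := theta2_nat_mul_nat_mul hτ z (N := 6) (by norm_num) 6
  have h1 := eta_nat_mul τ 1
  have h := eta_nat_mul τ 6
  have a1 := theta1_nat_mul_add hτ z 1 1
  have a3 := theta1_nat_mul_add hτ z 1 3
  have a5 := theta1_nat_mul_add hτ z 1 5
  have a := theta1_nat_mul_add hτ z 3 3
  have s1 := theta1_nat_mul_sub hτ z 1 1
  have s3 := theta1_nat_mul_sub hτ z 1 3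
  have s5 := theta1_nat_mul_sub hτ z 1 5
  have s := theta1_nat_mul_sub hτ z 3 3
  have e4 : (3 : ℂ) / 12 = 1 / 4 := by norm_num
  simp only [Nat.cast_ofNat, Nat.cast_one, one_mul, pow_one, e4, Nat.reduceMul, hR6, hR2, hR10,
    i1, i2, Complex.inv_I] at h2 h66 h1 h a1 a3 a5 a s1 s3 s5 s
  simp only [psi5, twinedValue, h2, h66, h1, h, a1, a3, a5, a, s1, s3, s5, s, Fin.prod_univ_three,
    Matrix.cons_val, i1, i2, Complex.inv_I, inv_neg, inv_one, ← hp]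
  rw [neg_one_mul]
  generalize thetaProd (e τ) (I * e z) = A at *
  generalize thetaProd (e τ) (-I * e z) = B at *
  generalize thetaProd (e τ) (-I * omega3 * e z) = A1 at *
  generalize thetaProd (e τ) (-I * omega3 ^ 2 * e z) = A2 at *
  generalize thetaProd (e τ) (I * omega3 * e z) = B1 at *
  generalize thetaProd (e τ) (I * omega3 ^ 2 * e z) = B2 at *
  generalize thetaProd (e τ) (I * e z ^ 3) = C
  generalize thetaProd (e τ) (-I * e z ^ 3) = D
  generalize thetaProd (e τ) (-e z ^ 2) = F
  rw [← e_half_sq z]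
  generalize e (z / 2) = Z at *
  generalize e (τ / 24) = T at *
  generalize e (1 / 24) = R at *
  generalize eulerProd (e τ) = E at *
  generalize eulerProd (e τ ^ 6) = E6 at *
  field_simp
  have hR12 : R ^ 12 = -1 := by rw [show 12 = 6 * 2 from rfl, pow_mul, hR6, Complex.I_sq]
  rw [hR12, hR6, show I ^ 5 = I by rw [pow_succ, Complex.I_pow_four, one_mul]]
  ring

/-- The twined traces agree with the meromorphic Jacobi forms. -/
theorem psi5_fusion (hz : 0 < -z.im) (hzτ : -z.im < τ.im) (c : Cls24) :
    psi5 c.fusion τ z = twinedValue (chi2 c) (chi3 c) (stdEig c) (e τ) (e z) := by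
  have hτ : 0 < τ.im := hz.trans hzτ
  have ho : omega3⁻¹ = omega3 ^ 2 := inv_eq_of_mul_eq_one_right
    (by linear_combination (omega3 - 1) * omega3_sq_add)
  have ho' : (omega3 ^ 2)⁻¹ = omega3 := by rw [← ho, inv_inv]
  -- Same function as for 4A, with all eigenvalues inverted.
  have h4 : psi5 .c4B τ z = twinedValue (-1) (-I) ![-I, I, I] (e τ) (e z) := by
    refine (psi5_c4A hz hzτ).trans ((twinedValue_inv _ _ _ _ _).symm.trans ?_)
    rw [inv_neg, inv_one, Complex.inv_I]
    congr 1
    funext i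
    fin_cases i <;> simp
  have h12 : psi5 .c12B τ z =
      twinedValue (-1) (-I) ![-I, I * omega3, I * omega3 ^ 2] (e τ) (e z) := by
    refine (psi5_c12A hz hzτ).trans ((twinedValue_inv _ _ _ _ _).symm.trans ?_)
    rw [inv_neg, inv_one, Complex.inv_I, twinedValue, twinedValue]
    simp only [Fin.prod_univ_three, Matrix.cons_val, mul_inv, inv_neg, ho, ho', Complex.inv_I,
      neg_neg, neg_mul]
    ring
  cases c
  · exact psi5_c1A hτ
  · exact psi5_c2A hτ
  · exact psi5_c4A hz hzτ
  · exact h4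
  · exact psi5_c2B hτ
  · exact psi5_c2C hτ
  -- The class 4C of S₃ × 4 fuses into 4A and has the same eigenvalues; 4D behaves likewise with 4B.
  · exact psi5_c4A hz hzτ
  · exact h4
  · exact psi5_c3A hτ
  · exact psi5_c6A hτ
  · exact psi5_c12A hz hzτ
  · exact h12

end Identities

/-- Replaces the unknown eigenvalues of a group element by the listed ones. -/
theorem twinedValue_congr {l m : ℂ} {ν ν' : Fin 3 → ℂ} (h1 : ∑ i, ν i = ∑ i, ν' i)
    (h2 : ∑ i, ν i ^ 2 = ∑ i, ν' i ^ 2) (h3 : ∑ i, ν i ^ 3 = ∑ i, ν' i ^ 3) (q y : ℂ) :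
    twinedValue l m ν q y = twinedValue l m ν' q y := by
  rw [twinedValue, prod_eq_of_power_sums_eq h1 h2 h3 fun t => thetaProd q (t * y),
    prod_eq_of_power_sums_eq h1 h2 h3 fun t => thetaProd q (t⁻¹ * y)]
  rfl

end Umbral5

end

/-! ### The proposition -/

open Umbral5 in
theorem proposition2
    {G : Type*} [Group G] (φ : G ≃* GL25mod2)
    (H : Subgroup G) (hmax : IsCoatom H) (hcard : Nat.card H = 24)
    (f : H ≃* S3C4) (hfus : ∀ h : H, cls5 (φ h) = (cls24 (f h)).fusion)
    {U₁ U₂ U₃ U₄ : Type*}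
    [AddCommGroup U₁] [Module ℂ U₁] [AddCommGroup U₂] [Module ℂ U₂]
    [AddCommGroup U₃] [Module ℂ U₃] [AddCommGroup U₄] [Module ℂ U₄]
    (Pe : PolarizedSpace 1 U₁) (Pa : PolarizedSpace 1 U₂) (Pa' : PolarizedSpace 1 U₃)
    (Pb : PolarizedSpace (-1) U₄)
    (De : DualBases Pe (Fin 1)) (Da : DualBases Pa (Fin 1)) (Da' : DualBases Pa' (Fin 1))
    (Db : DualBases Pb (Fin 3))
    (r : H →* LinearMap.GeneralLinearGroup ℂ Pa.pos)
    (hr : ∀ h, LinearMap.trace ℂ Pa.pos (r h).val = chi2 (cls24 (f h)))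
    (r' : H →* LinearMap.GeneralLinearGroup ℂ Pa'.pos)
    (hr' : ∀ h, LinearMap.trace ℂ Pa'.pos (r' h).val = chi3 (cls24 (f h)))
    (s : H →* LinearMap.GeneralLinearGroup ℂ Pb.pos)
    (hs : ∀ h, LinearMap.trace ℂ Pb.pos (s h).val = chi7 (cls24 (f h)) + chi12 (cls24 (f h))) :
    (∀ m n, FiniteDimensional ℂ (Wpiece De Da Da' Db m n)) ∧
    (⨆ p : ℤ × ℕ, Wpiece De Da Da' Db p.1 p.2) = ⊤ ∧
    (∀ (h : H) (m : ℤ) (n : ℕ), ∀ x ∈ Wpiece De Da Da' Db m n,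
      twinedOp De Da Da' Db r r' s h x ∈ Wpiece De Da Da' Db m n) ∧
    (∀ (h : H) (n : ℕ), ∃ N : ℤ, ∀ m > N, psiTildeCoeff De Da Da' Db r r' s h m n = 0) ∧
    ∀ (h : H) (τ z : ℂ), 0 < -z.im → -z.im < τ.im →
      HasSum (fun p : ℤ × ℕ => psiTildeCoeff De Da Da' Db r r' s h p.1 p.2 * e z ^ p.1 * e τ ^ p.2)
        (psi5 (cls5 (φ h)) τ z) := by
  have key : ∀ h : H, ∃ (D' : DualBases Pb (Fin 3)) (ν : Fin 3 → ℂ),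
      (∀ i, (s h).val (D'.pos i) = ν i • D'.pos i) ∧ (∀ i, ‖ν i‖ = 1) ∧
      ∑ i, ν i = ∑ i, stdEig (cls24 (f h)) i ∧ ∑ i, ν i ^ 2 = ∑ i, stdEig (cls24 (f h)) i ^ 2 ∧
      ∑ i, ν i ^ 3 = ∑ i, stdEig (cls24 (f h)) i ^ 3 := by
    intro h
    -- The order of the group bounds the order of s(h), which makes it diagonalizable with roots of
    -- unity as eigenvalues.
    have h24 : h ^ 24 = 1 := by rw [← hcard]; exact pow_card_eq_one'
    have hpow : ∀ k, (s h).val ^ k = (s (h ^ k)).val := fun k => by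
      rw [map_pow, Units.val_pow_eq_pow_val]
    have hs24 : (s h).val ^ 24 = 1 := by rw [hpow, h24, map_one, Units.val_one]
    obtain ⟨b, ν, hb⟩ := exists_eigenbasis Db.pos (s h).val (n := 24) (by norm_num) hs24
    -- The k-th power sum of the eigenvalues is the trace of s(h)^k = s(h^k), a character value.
    have htr : ∀ k, ∑ i, ν i ^ k = chi7 (cls24 (f h ^ k)) + chi12 (cls24 (f h ^ k)) := fun k => by
      rw [← map_pow, ← hs, ← hpow]
      exact (trace_eq_sum_of_eigenbasis b _ _ fun i => pow_apply_of_eigenvector (hb i) k).symm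
    refine ⟨Db.ofPos b, ν, hb, fun i => ?_, ?_, ?_, ?_⟩
    · have h1 := pow_apply_of_eigenvector (hb i) 24
      rw [hs24, Module.End.one_apply] at h1
      have h2 : ν i ^ 24 = 1 := by
        have h3 : (1 - ν i ^ 24) • b i = 0 := by rw [sub_smul, one_smul, ← h1, sub_self]
        exact (sub_eq_zero.1 ((smul_eq_zero.1 h3).resolve_right (b.ne_zero i))).symm
      exact Complex.norm_eq_one_of_pow_eq_one h2 (by norm_num)
    · rw [sum_stdEig]
      simpa using htr 1
    · rw [sum_stdEig_sq, htr, cls24_sq]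
    · rw [sum_stdEig_cube, htr, cls24_cube]
  -- On a one-dimensional space an operator is the scalar given by its trace.
  have hl : ∀ (h : H) i, (r h).val (Da.pos i) = chi2 (cls24 (f h)) • Da.pos i := fun h i => by
    rw [← hr]; exact apply_eq_trace_smul Da.pos _ i
  have hm : ∀ (h : H) i, (r' h).val (Da'.pos i) = chi3 (cls24 (f h)) • Da'.pos i := fun h i => by
    rw [← hr']; exact apply_eq_trace_smul Da'.pos _ i
  -- The bound 1 + 3n on the exponents of y comes from `jWt_le`. The adapted bases depend on h, but
  -- the graded pieces and operators are those of `Db`.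
  refine ⟨finiteDimensional_Wpiece De Da Da' Db, iSup_Wpiece De Da Da' Db, fun h m n => ?_,
    fun h n => ⟨1 + 3 * n, fun m hmn => ?_⟩, fun h τ z hz hzτ => ?_⟩
  all_goals obtain ⟨D', ν, hν, hν1, e1, e2, e3⟩ := key h
  · exact twinedOp_mem_Wpiece De Da Da' Db D' r r' s (hl h) (hm h) hν m n
  · exact psiTildeCoeff_eq_zero De Da Da' Db D' r r' s (hl h) (hm h) hν hmn
  · rw [hfus, psi5_fusion hz hzτ, ← twinedValue_congr e1 e2 e3]
    exact hasSum_psiTildeCoeff De Da Da' Db D' r r' s (hl h) (hm h) hν hν1 (one_lt_norm_e hz)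
      (by rw [← e_add]; exact norm_e_lt_one (by rw [Complex.add_im]; linarith))
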